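/- **Setting.** Let $\Omega\subset\mathbb R^2$ be a bounded polygonal domain (without slits), whose boundary is the union of a clamped part $\Gamma_c$, a simply supported part $\Gamma_s$ and a free part $\Gamma_f$; each part is a finite union of segments and any two of them meet in a set of length zero. The plate has thickness $d>0$, Young's modulus $E>0$ and Poisson ratio $\nu\in(-1,1)$. Put $\varepsilon(\boldsymbol v)=\tfrac12(\nabla\boldsymbol v+\nabla\boldsymbol v^T)$, $$K(v)=-\varepsilon(\nabla v),\quad M(v)=\tfrac{d^3}{12}\,\mathcal C K(v),\quad \mathcal C A=\tfrac{E}{1+\nu}\big(A+\tfrac{\nu}{1-\nu}(\operatorname{tr}A)I\big),\quad \mathcal A(v)=\tfrac{Ed^3}{12(1-\nu^2)}\Delta^2v ,$$ and, for a unit normal $n$ and the corresponding unit tangent $s$, $$M_{nn}(v)=n\cdot M(v)n,\quad M_{ns}(v)=s\cdot M(v)n,\quad V_n(v)=\operatorname{Div}M(v)\cdot n+\tfrac{\partial}{\partial s}M_{ns}(v).$$ Let $f\in L^2(\Omega)$, $g\in L^2(S)$ for a line $S$ in $\Omega$, $F\in\mathbb R$, $x_0\in\Omega$, and $$V=\{v\in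 H^2(\Omega): v|_{\Gamma_c\cup\Gamma_s}=0,\ \nabla v\cdot n|_{\Gamma_c}=0\},\quad a(w,v)=\int_\Omega M(w):K(v)\,dx,\quad l(v)=\int_\Omega fv\,dx+\int_S gv\,ds+Fv(x_0).$$ Let $u\in V$ satisfy $a(u,v)=l(v)$ for all $v\in V$. Let $\mathcal C_h$ be a conforming triangulation of $\overline\Omega$ that is shape regular with constant $\kappa$: every $K\in\mathcal C_h$ contains a closed disc of some radius $\rho>0$ with $h_K\le\kappa\rho$, where $h_K=\operatorname{diam}K$. Assume that every boundary edge lies in one of $\Gamma_c,\Gamma_s,\Gamma_f$, that $S$ is a union of interior edges, and that $x_0$ is a node if $F\neq0$. Let $\mathcal E_h^i$, $\mathcal E_h^S\subset\mathcal E_h^i$, $\mathcal E_h^f$, $\mathcal E_h^s$ be the sets of interior edges, of interior edges on $S$, and of boundary edges on $\Gamma_f$ and on $\Gamma_s$; let $h_E$ be the length of $E$. Let $V_h\subset V$ be a linear space of functions that are polynomials of degree at most $k$ on every $K\in\mathcal C_h$, and let $u_h\in V_h$ satisfy $a(u_h,v_h)=l(v_h)$ for all $v_h\in V_h$. On an interior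 edge $E$ with adjacent triangles $K,K'$ and their outer unit normals $n$, $n'$ put $[\![M_{nn}(u_h)]\!]=M_{nn}(u_h|_K)-M_{n'n'}(u_h|_{K'})$ and $[\![V_n(u_h)]\!]=V_n(u_h|_K)+V_{n'}(u_h|_{K'})$; on a boundary edge $n$ is the outer unit normal. The error estimator $\eta\ge0$ is given by $$\begin{aligned}\eta^2={}&\sum_{K\in\mathcal C_h}h_K^4\|\mathcal A(u_h)-f\|_{0,K}^2+\sum_{E\in\mathcal E_h^S}h_E^3\|[\![V_n(u_h)]\!]-g\|_{0,E}^2+\sum_{E\in\mathcal E_h^i\setminus\mathcal E_h^S}h_E^3\|[\![V_n(u_h)]\!]\|_{0,E}^2\\&+\sum_{E\in\mathcal E_h^i}h_E\|[\![M_{nn}(u_h)]\!]\|_{0,E}^2+\sum_{E\in\mathcal E_h^f}h_E^3\|V_n(u_h)\|_{0,E}^2+\sum_{E\in\mathcal E_h^f\cup\mathcal E_h^s}h_E\|M_{nn}(u_h)\|_{0,E}^2.\end{aligned}$$ Let $f_h$ be a function that is a polynomial of degree at most $k$ on every $K\in\mathcal C_h$ (for instance an interpolant of $f$ in $V_h$),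 let $g_h$ be a polynomial of degree at most $m$ on every $E\in\mathcal E_h^S$, and put $$\operatorname{osc}(f)=\Big(\sum_{K\in\mathcal C_h}h_K^4\|f-f_h\|_{0,K}^2\Big)^{1/2},\qquad \operatorname{osc}(g)=\Big(\sum_{E\in\mathcal E_h^S}h_E^3\|g-g_h\|_{0,E}^2\Big)^{1/2}.$$ **Theorem (global efficiency).** There is a constant $C>0$, depending only on the material parameters $d$, $\nu$ and Young's modulus, on $\kappa$ and on the degrees $k,m$, such that in the above setting always $$\eta\le C\big(\|u-u_h\|_2+\operatorname{osc}(f)+\operatorname{osc}(g)\big),$$ where $\|\cdot\|_2$ is the norm of $H^2(\Omega)$. -/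

import Mathlib

open MeasureTheory Filter Topology
open scoped ContDiff RealInnerProductSpace ENNReal

noncomputable section

namespace Kirchhoff

/-- The Euclidean plane. -/
abbrev Plane : Type := EuclideanSpace ℝ (Fin 2)

/-! ### Weak derivatives and Sobolev spaces -/

/-- The classical partial derivative `∂w/∂x_i`. -/
def pd (i : Fin 2) (w : Plane → ℝ) (x : Plane) : ℝ :=
  fderiv ℝ w x (EuclideanSpace.single i 1)

/-- `w` is the weak partial derivative `∂v/∂x_i` in the open set `Ω`. -/
def IsWeakDeriv (Ω : Set Plane) (i : Fin 2) (v w : Plane → ℝ) : Prop :=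
  LocallyIntegrableOn v Ω volume ∧ LocallyIntegrableOn w Ω volume ∧
    ∀ φ : Plane → ℝ, ContDiff ℝ ∞ φ → HasCompactSupport φ → tsupport φ ⊆ Ω →
      ∫ x in Ω, v x * pd i φ x = -∫ x in Ω, w x * φ x

/-- `H¹(Ω)`. -/
def MemH1 (Ω : Set Plane) (v : Plane → ℝ) : Prop :=
  MemLp v 2 (volume.restrict Ω) ∧
    ∀ i, ∃ w, MemLp w 2 (volume.restrict Ω) ∧ IsWeakDeriv Ω i v w

/-- `H²(Ω)`. -/
def MemH2 (Ω : Set Plane) (v : Plane → ℝ) : Prop :=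
  MemLp v 2 (volume.restrict Ω) ∧ ∀ i, ∃ w, MemH1 Ω w ∧ IsWeakDeriv Ω i v w

open Classical in
/-- The weak partial derivative as a function (unique almost everywhere in `Ω`; zero if there is
none). -/
def weakDeriv (Ω : Set Plane) (i : Fin 2) (v : Plane → ℝ) : Plane → ℝ :=
  if h : ∃ w, IsWeakDeriv Ω i v w then h.choose else 0

/-- The `L²` norm with respect to the measure `μ`. -/
def normL2 (μ : Measure Plane) (w : Plane → ℝ) : ℝ := √(∫ x, w x ^ 2 ∂μ)

/-- The `H²(Ω)` norm. -/
def normH2 (Ω : Set Plane) (v : Plane → ℝ) : ℝ :=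
  √(normL2 (volume.restrict Ω) v ^ 2
    + ∑ i, normL2 (volume.restrict Ω) (weakDeriv Ω i v) ^ 2
    + ∑ i, ∑ j, normL2 (volume.restrict Ω) (weakDeriv Ω j (weakDeriv Ω i v)) ^ 2)

/-- Arc length on a set `Γ` (one-dimensional Hausdorff measure restricted to `Γ`). -/
def arc (Γ : Set Plane) : Measure Plane := (μH[1] : Measure Plane).restrict Γ

/-- `t` is the trace on `Γ ⊆ ∂Ω` of the function `w ∈ H¹(Ω)`: the trace operator is the continuous
extension to `H¹(Ω)` of the restriction `φ ↦ φ|_Γ`, `φ ∈ H¹(Ω) ∩ C(closure Ω)`. -/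
def HasTrace (Ω : Set Plane) (w : Plane → ℝ) (Γ : Set Plane) (t : Plane → ℝ) : Prop :=
  MemLp t 2 (arc Γ) ∧
    ∃ φ : ℕ → Plane → ℝ,
      (∀ n, ContinuousOn (φ n) (closure Ω) ∧ MemH1 Ω (φ n)) ∧
      Tendsto (fun n => eLpNorm (φ n - w) 2 (volume.restrict Ω)) atTop (𝓝 0) ∧
      (∀ i, Tendsto (fun n => eLpNorm (weakDeriv Ω i (φ n) - weakDeriv Ω i w) 2
        (volume.restrict Ω)) atTop (𝓝 0)) ∧
      Tendsto (fun n => eLpNorm (φ n - t) 2 (arc Γ)) atTop (𝓝 0)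

/-- `n` is the outer unit normal to `Ω` at the boundary point `x`, near which `Ω` is a half disc. -/
def IsOuterNormalAt (Ω : Set Plane) (x n : Plane) : Prop :=
  ‖n‖ = 1 ∧ ∃ r > 0, ∀ y ∈ Metric.ball x r, y ∈ Ω ↔ ⟪y - x, n⟫ < 0

/-! ### The plate model -/

/-- Thickness, Young's modulus and Poisson ratio of the plate. -/
structure Material where
  d : ℝ
  E : ℝ
  ν : ℝ
  d_pos : 0 < d
  E_pos : 0 < E
  ν_gt : -1 < ν
  ν_lt : ν < 1

/-- The bending stiffness `D`. -/
def Material.D (mat : Material) : ℝ := mat.E * mat.d ^ 3 / (12 * (1 - mat.ν ^ 2))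

/-- The linear elastic constitutive relation `A ↦ C A`. -/
def Material.constRel (mat : Material) (A : Matrix (Fin 2) (Fin 2) ℝ) :
    Matrix (Fin 2) (Fin 2) ℝ :=
  (mat.E / (1 + mat.ν)) • (A + (mat.ν / (1 - mat.ν) * A.trace) • (1 : Matrix (Fin 2) (Fin 2) ℝ))

/-- The infinitesimal strain belonging to a displacement gradient. -/
def strain (G : Matrix (Fin 2) (Fin 2) ℝ) : Matrix (Fin 2) (Fin 2) ℝ :=
  (1 / 2 : ℝ) • (G + G.transpose)

/-- The curvature tensor `K(w) = -ε(∇w)`, as a function of the second derivatives of `w`. -/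
def curvature (H : Matrix (Fin 2) (Fin 2) ℝ) : Matrix (Fin 2) (Fin 2) ℝ := -strain H

/-- The moment tensor `M(w) = (d³/12) C K(w)`, as a function of the second derivatives of `w`. -/
def Material.moment (mat : Material) (H : Matrix (Fin 2) (Fin 2) ℝ) :
    Matrix (Fin 2) (Fin 2) ℝ :=
  (mat.d ^ 3 / 12) • mat.constRel (curvature H)

/-- The weak second derivatives: the gradient of the vector field `∇v`. -/
def weakHess (Ω : Set Plane) (v : Plane → ℝ) (x : Plane) : Matrix (Fin 2) (Fin 2) ℝ :=
  Matrix.of fun i j => weakDeriv Ω j (weakDeriv Ω i v) x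

/-- The bilinear form `a(w, v) = ∫_Ω M(w) : K(v)`. -/
def Material.bilin (mat : Material) (Ω : Set Plane) (w v : Plane → ℝ) : ℝ :=
  ∫ x in Ω, ∑ i, ∑ j, mat.moment (weakHess Ω w x) i j * curvature (weakHess Ω v x) i j

/-- A finite union of line segments. -/
def IsSegmentUnion (Γ : Set Plane) : Prop :=
  ∃ s : Finset (Plane × Plane), Γ = ⋃ e ∈ s, segment ℝ e.1 e.2

/-- A polygonal plate together with its boundary conditions and its loading. -/
structure Problem where
  /-- the midsurface of the plate -/
  Ω : Set Plane
  /-- the clamped part of the boundary -/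
  Γc : Set Plane
  /-- the simply supported part of the boundary -/
  Γs : Set Plane
  /-- the free part of the boundary -/
  Γf : Set Plane
  /-- the line that carries the line load -/
  S : Set Plane
  /-- the distributed load -/
  f : Plane → ℝ
  /-- the line load -/
  g : Plane → ℝ
  /-- the point at which the point load acts -/
  x₀ : Plane
  /-- the point load -/
  F : ℝ
  isOpen : IsOpen Ω
  isConnected : IsConnected Ω
  isBounded : Bornology.IsBounded Ω
  /-- no slits -/
  interior_closure : interior (closure Ω) = Ω
  clamped_segments : IsSegmentUnion Γc
  supported_segments : IsSegmentUnion Γs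
  free_segments : IsSegmentUnion Γf
  boundary : frontier Ω = Γc ∪ Γs ∪ Γf
  clamped_supported : (μH[1] : Measure Plane) (Γc ∩ Γs) = 0
  clamped_free : (μH[1] : Measure Plane) (Γc ∩ Γf) = 0
  supported_free : (μH[1] : Measure Plane) (Γs ∩ Γf) = 0
  f_mem : MemLp f 2 (volume.restrict Ω)
  g_mem : MemLp g 2 (arc S)
  x₀_mem : x₀ ∈ Ω

/-- The space `V` of kinematically admissible deflections. Every class in `H²(Ω)` has exactly one
representative that is continuous in `Ω`; it is the one that is meant, so that point values and
values on lines in `Ω` make sense. -/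
def Problem.V (P : Problem) : Set (Plane → ℝ) :=
  {v | ContinuousOn v P.Ω ∧ MemH2 P.Ω v ∧ HasTrace P.Ω v (P.Γc ∪ P.Γs) 0 ∧
    ∃ t : Fin 2 → Plane → ℝ, (∀ i, HasTrace P.Ω (weakDeriv P.Ω i v) P.Γc (t i)) ∧
      ∀ᵐ x ∂(arc P.Γc), ∀ n, IsOuterNormalAt P.Ω x n → ∑ i, t i x * n i = 0}

/-- The load functional `l(v)`. -/
def Problem.load (P : Problem) (v : Plane → ℝ) : ℝ :=
  (∫ x in P.Ω, P.f x * v x) + (∫ x, P.g x * v x ∂(arc P.S)) + P.F * v P.x₀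

/-- `u ∈ V` is the deflection of the plate: `a(u, v) = l(v)` for all `v ∈ V`. -/
def Problem.IsSolution (P : Problem) (mat : Material) (u : Plane → ℝ) : Prop :=
  u ∈ P.V ∧ ∀ v ∈ P.V, mat.bilin P.Ω u v = P.load v

/-- `u_h` is the Galerkin solution in the space `V_h`. -/
def Problem.IsDiscreteSolution (P : Problem) (mat : Material) (Vh : Submodule ℝ (Plane → ℝ))
    (uh : Plane → ℝ) : Prop :=
  uh ∈ Vh ∧ ∀ v ∈ Vh, mat.bilin P.Ω uh v = P.load v

/-! ### Pointwise quantities of a smooth function -/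

/-- The plate operator `A(w) = D Δ² w`. -/
def Material.plateOp (mat : Material) (w : Plane → ℝ) (x : Plane) : ℝ :=
  mat.D * Laplacian.laplacian (Laplacian.laplacian w) x

/-- The moment tensor `M(w)`. -/
def Material.M (mat : Material) (w : Plane → ℝ) (x : Plane) : Matrix (Fin 2) (Fin 2) ℝ :=
  mat.moment (Matrix.of fun i j => pd j (pd i w) x)

/-- The shear force `Q(w) = Div M(w)`. -/
def Material.Q (mat : Material) (w : Plane → ℝ) (x : Plane) (i : Fin 2) : ℝ :=
  ∑ j, pd j (fun y => mat.M w y i j) x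

/-- The unit tangent `s` that belongs to the unit normal `n`. -/
def tangent (n : Plane) : Plane := !₂[-n 1, n 0]

/-- The normal shear force `Q_n(w) = Q(w) · n`. -/
def Material.Qn (mat : Material) (w : Plane → ℝ) (n x : Plane) : ℝ :=
  ∑ i, mat.Q w x i * n i

/-- The normal moment `M_nn(w) = n · M(w) n`. -/
def Material.Mnn (mat : Material) (w : Plane → ℝ) (n x : Plane) : ℝ :=
  ∑ i, ∑ j, n i * mat.M w x i j * n j

/-- The twisting moment `M_ns(w) = s · M(w) n`. -/
def Material.Mns (mat : Material) (w : Plane → ℝ) (n x : Plane) : ℝ :=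
  ∑ i, ∑ j, tangent n i * mat.M w x i j * n j

/-- The Kirchhoff shear force `V_n(w) = Q_n(w) + ∂M_ns(w)/∂s`. -/
def Material.Vn (mat : Material) (w : Plane → ℝ) (n x : Plane) : ℝ :=
  mat.Qn w n x + fderiv ℝ (mat.Mns w n) x (tangent n)

/-! ### Triangulations -/

/-- The closed simplex (triangle, edge) with the given vertices. -/
abbrev hull (s : Finset Plane) : Set Plane := convexHull ℝ (s : Set Plane)

/-- The diameter `h_K` of a triangle, or the length `h_E` of an edge. -/
def size (s : Finset Plane) : ℝ := Metric.diam (hull s)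

/-- A conforming triangulation of the closure of `Ω`; a triangle is given by its set of vertices. -/
structure Triangulation (Ω : Set Plane) where
  tri : Finset (Finset Plane)
  card_eq : ∀ K ∈ tri, K.card = 3
  indep : ∀ K ∈ tri, AffineIndependent ℝ ((↑) : K → Plane)
  conforming : ∀ K ∈ tri, ∀ L ∈ tri, hull K ∩ hull L = convexHull ℝ ((K : Set Plane) ∩ L)
  cover : ⋃ K ∈ tri, hull K = closure Ω

namespace Triangulation

variable {Ω : Set Plane}

/-- The nodes of the mesh. -/
def nodes (T : Triangulation Ω) : Set Plane := ⋃ K ∈ T.tri, (K : Set Plane)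

open Classical in
/-- All edges; an edge is given by its two end points. -/
def edges (T : Triangulation Ω) : Finset (Finset Plane) :=
  T.tri.biUnion fun K => K.powersetCard 2

open Classical in
/-- The edges on the part `Γ` of the boundary. -/
def boundaryEdges (T : Triangulation Ω) (Γ : Set Plane) : Finset (Finset Plane) :=
  T.edges.filter fun E => hull E ⊆ frontier Ω ∧ hull E ⊆ Γ

open Classical in
/-- The edges in the interior. -/
def interiorEdges (T : Triangulation Ω) : Finset (Finset Plane) :=
  T.edges.filter fun E => ¬ hull E ⊆ frontier Ω

open Classical in
/-- The interior edges on the line `S`. -/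
def lineEdges (T : Triangulation Ω) (S : Set Plane) : Finset (Finset Plane) :=
  T.interiorEdges.filter fun E => hull E ⊆ S

/-- A triangle that has `E` as an edge. -/
def tri₁ (T : Triangulation Ω) (E : Finset Plane) : Finset Plane :=
  Classical.epsilon fun K => K ∈ T.tri ∧ E ⊆ K

/-- The other triangle that has the interior edge `E` as an edge. -/
def tri₂ (T : Triangulation Ω) (E : Finset Plane) : Finset Plane :=
  Classical.epsilon fun K => K ∈ T.tri ∧ E ⊆ K ∧ K ≠ T.tri₁ E

/-- Shape regularity: every triangle contains a disc of radius at least `h_K / κ`. -/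
def ShapeRegular (T : Triangulation Ω) (κ : ℝ) : Prop :=
  ∀ K ∈ T.tri, ∃ c : Plane, ∃ ρ : ℝ, 0 < ρ ∧ Metric.closedBall c ρ ⊆ hull K ∧ size K ≤ κ * ρ

/-- `v` is a polynomial of degree at most `k` on every triangle. -/
def IsPiecewisePoly (T : Triangulation Ω) (k : ℕ) (v : Plane → ℝ) : Prop :=
  ∀ K ∈ T.tri, ∃ p : MvPolynomial (Fin 2) ℝ, p.totalDegree ≤ k ∧
    ∀ x ∈ hull K, v x = p.eval x

end Triangulation

/-- The mesh fits the problem: every boundary edge lies in one of the three parts of the boundary,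
the line load acts on interior edges, and the point load, if there is one, on a node. -/
structure Problem.Fits (P : Problem) (T : Triangulation P.Ω) : Prop where
  boundary : ∀ E ∈ T.edges, hull E ⊆ frontier P.Ω →
    hull E ⊆ P.Γc ∨ hull E ⊆ P.Γs ∨ hull E ⊆ P.Γf
  line : P.S = ⋃ E ∈ T.lineEdges P.S, hull E
  point : P.F ≠ 0 → P.x₀ ∈ T.nodes

/-- The polynomial function on the plane that coincides with the piecewise polynomial `v` on the
triangle `K`. -/
def onElement (K : Finset Plane) (v : Plane → ℝ) (x : Plane) : ℝ :=
  (Classical.epsilon fun p : MvPolynomial (Fin 2) ℝ => ∀ y ∈ hull K, v y = p.eval y).eval x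

/-- `n` is the outer unit normal of the triangle `K` on its edge `E`. -/
def IsOuterNormal (K E : Finset Plane) (n : Plane) : Prop :=
  ‖n‖ = 1 ∧ ∀ a ∈ E, ∀ y ∈ K, ⟪y - a, n⟫ ≤ 0

/-- The outer unit normal of the triangle `K` on its edge `E`. -/
def outerNormal (K E : Finset Plane) : Plane := Classical.epsilon (IsOuterNormal K E)

/-- `M_nn(v)` on the edge `E` of `K`, evaluated from inside `K` with the outer normal of `K`. -/
def Material.edgeMnn (mat : Material) (K E : Finset Plane) (v : Plane → ℝ) (x : Plane) : ℝ :=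
  mat.Mnn (onElement K v) (outerNormal K E) x

/-- `V_n(v)` on the edge `E` of `K`, evaluated from inside `K` with the outer normal of `K`. -/
def Material.edgeVn (mat : Material) (K E : Finset Plane) (v : Plane → ℝ) (x : Plane) : ℝ :=
  mat.Vn (onElement K v) (outerNormal K E) x

/-- The jump of the normal moment over an interior edge (its sign depends on the numbering of the
two triangles, its absolute value does not). -/
def Material.jumpMnn (mat : Material) {Ω : Set Plane} (T : Triangulation Ω) (E : Finset Plane)
    (v : Plane → ℝ) (x : Plane) : ℝ :=
  mat.edgeMnn (T.tri₁ E) E v x - mat.edgeMnn (T.tri₂ E) E v x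

/-- The jump of the Kirchhoff shear force over an interior edge. -/
def Material.jumpVn (mat : Material) {Ω : Set Plane} (T : Triangulation Ω) (E : Finset Plane)
    (v : Plane → ℝ) (x : Plane) : ℝ :=
  mat.edgeVn (T.tri₁ E) E v x + mat.edgeVn (T.tri₂ E) E v x

/-! ### The estimator and the oscillations -/

open Classical in
/-- The global error estimator `η`. -/
def Problem.estimator (P : Problem) (mat : Material) (T : Triangulation P.Ω)
    (uh : Plane → ℝ) : ℝ :=
  √((∑ K ∈ T.tri, size K ^ 4 *
        normL2 (volume.restrict (hull K)) (fun x => mat.plateOp (onElement K uh) x - P.f x) ^ 2)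
    + (∑ E ∈ T.lineEdges P.S, size E ^ 3 *
        normL2 (arc (hull E)) (fun x => mat.jumpVn T E uh x - P.g x) ^ 2)
    + (∑ E ∈ T.interiorEdges \ T.lineEdges P.S, size E ^ 3 *
        normL2 (arc (hull E)) (mat.jumpVn T E uh) ^ 2)
    + (∑ E ∈ T.interiorEdges, size E * normL2 (arc (hull E)) (mat.jumpMnn T E uh) ^ 2)
    + (∑ E ∈ T.boundaryEdges P.Γf, size E ^ 3 *
        normL2 (arc (hull E)) (mat.edgeVn (T.tri₁ E) E uh) ^ 2)
    + (∑ E ∈ T.boundaryEdges P.Γf ∪ T.boundaryEdges P.Γs, size E *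
        normL2 (arc (hull E)) (mat.edgeMnn (T.tri₁ E) E uh) ^ 2))

/-- `osc_K(f)` for the polynomial approximation `q` of `f` on `K`. -/
def oscElement (K : Finset Plane) (f : Plane → ℝ) (q : MvPolynomial (Fin 2) ℝ) : ℝ :=
  size K ^ 2 * normL2 (volume.restrict (hull K)) (fun x => f x - q.eval x)

/-- `osc_E(g)` for the polynomial approximation `q` of `g` on `E`. -/
def oscEdge (E : Finset Plane) (g : Plane → ℝ) (q : MvPolynomial (Fin 2) ℝ) : ℝ :=
  size E ^ (3 / 2 : ℝ) * normL2 (arc (hull E)) (fun x => g x - q.eval x)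

/-- `osc(f)` for the approximation of `f` by the polynomials `fh K`, `K ∈ T`. -/
def Problem.oscF (P : Problem) (T : Triangulation P.Ω)
    (fh : Finset Plane → MvPolynomial (Fin 2) ℝ) : ℝ :=
  √(∑ K ∈ T.tri, oscElement K P.f (fh K) ^ 2)

/-- `osc(g)` for the approximation of `g` by the polynomials `gh E`, `E` an edge on `S`. -/
def Problem.oscG (P : Problem) (T : Triangulation P.Ω)
    (gh : Finset Plane → MvPolynomial (Fin 2) ℝ) : ℝ :=
  √(∑ E ∈ T.lineEdges P.S, oscEdge E P.g (gh E) ^ 2)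

end Kirchhoff

end

/-!
The proof follows Verfürth's bubble function technique. Let `φ` be a smooth function with support
in a small disc, and let `s` be the set of all triangles that have a given edge (or a single triangle
as their common face). If the disc meets the triangles in `s` only away from their other faces, then
cutting `φ` off outside the union of `s` creates no jump inside the domain, because a conforming mesh
has no other triangles there (`Triangulation.locallyClopen`). So the cut-off function is admissible
once it satisfies the essential boundary conditions (`Problem.indicator_mem_V`), and the variational
equation of `u` turns `a(u - uh, φ)` into a functional of `uh` and the loads
(`Problem.error_equation`).

Integration by parts on the triangles writes this functional as a sum of the residuals which the
estimator measures. Only discs around an inner point of a triangle or around the midpoint of an edge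
are used. There a triangle coincides with the whole plane or with a half plane, and the Green formula
of the plate operator is needed on half planes only (`Material.setIntegral_halfPlane_density`,
`IsHalfDisc`), so that the corner forces never occur. Shape regularity makes the radius of the disc
comparable to the size of the triangle or the edge (`Triangulation.isHalfDisc`), and the
Cauchy-Schwarz inequality gives `IsApproximation.abs_residual_le`: the residuals, tested with `φ`, are
bounded by the second derivatives of `u - uh` on the triangles in `s`.

The test functions are products of a fixed bump function and monomials, transported by a similarity
from a reference plane. On the finite-dimensional space of polynomials of bounded degree, the `L²`
norm weighted with the bump function controls all coefficients (`exists_coercive`), and thus the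
values in the larger disc of the same centre that contains the whole triangle or edge. The three
kinds of residuals are treated in turn.

* The element residual `A(uh) - fh` is tested with its own multiple of the bump function
  (`exists_element_bound`).
* The moment residual of an edge is tested with functions that vanish on the edge and have a
  prescribed normal derivative there (`exists_moment_bound`). They see neither the shear forces
  nor the line load, and they are admissible on simply supported edges as well.
* The shear force residual is tested with functions whose normal derivative vanishes on the edge
  (`exists_shear_bound`), so that the moments drop out.

The patches of interior and of boundary edges are treated alike (`IsEdgePatch`). Each triangle
belongs to at most three of them, which allows the local bounds to be summed
(`exists_estimator_bound`). All constants come from the material, from the shape constant, and from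
norm equivalences that depend on the polynomial degrees only.
-/

noncomputable section

namespace Kirchhoff

/-! ### Weak derivatives of functions that are cut off -/

lemma contDiff_pd {i : Fin 2} {φ : Plane → ℝ} (h : ContDiff ℝ ∞ φ) : ContDiff ℝ ∞ (pd i φ) := by
  have := h.fderiv_right (m := ∞) (by simp)
  exact this.clm_apply contDiff_const

lemma tsupport_pd_subset (i : Fin 2) (φ : Plane → ℝ) : tsupport (pd i φ) ⊆ tsupport φ := by
  refine (closure_mono ?_).trans (tsupport_fderiv_subset ℝ (f := φ))
  intro x hx
  simp only [Function.mem_support, pd] at hx ⊢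
  rintro h
  simp [h] at hx

lemma hasCompactSupport_pd {i : Fin 2} {φ : Plane → ℝ} (h : HasCompactSupport φ) :
    HasCompactSupport (pd i φ) :=
  h.of_isClosed_subset (isClosed_tsupport _) (tsupport_pd_subset i φ)

lemma integral_pd_eq_zero {i : Fin 2} {g : Plane → ℝ} (hd : Differentiable ℝ g)
    (hg : Integrable g) (hg' : Integrable (pd i g)) : ∫ x, pd i g x = 0 := by
  have h := integral_mul_fderiv_eq_neg_fderiv_mul_of_integrable (μ := (volume : Measure Plane))
    (f := fun _ : Plane => (1 : ℝ)) (g := g) (v := EuclideanSpace.single i 1)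
    (by simp) (by simp only [one_mul]; exact hg') (by simpa using hg) (by fun_prop)
    (fun x _ => hd x)
  simpa [pd] using h

/-- `A` is relatively open and closed in `X` near every point of `D`. -/
def LocallyClopen (X A D : Set Plane) : Prop :=
  ∀ x ∈ X, x ∈ D → A ∈ 𝓝[X] x ∨ Aᶜ ∈ 𝓝[X] x

lemma LocallyClopen.mono {X Y A D D' : Set Plane} (h : LocallyClopen X A D) (hY : Y ⊆ X)
    (hD : D' ⊆ D) : LocallyClopen Y A D' := fun x hx hxD =>
  (h x (hY hx) (hD hxD)).imp (fun h => nhdsWithin_mono x hY h) (fun h => nhdsWithin_mono x hY h)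

lemma LocallyClopen.indicator_pd {Ω A : Set Plane} (hΩ : IsOpen Ω) {φ : Plane → ℝ}
    (hA : LocallyClopen Ω A (tsupport φ)) (hφ : ContDiff ℝ ∞ φ) {x : Plane} (hx : x ∈ Ω)
    (i : Fin 2) :
    DifferentiableAt ℝ (A.indicator φ) x ∧ pd i (A.indicator φ) x = A.indicator (pd i φ) x := by
  have hd : DifferentiableAt ℝ φ x := hφ.differentiable (by simp) x
  by_cases hxs : x ∈ tsupport φ
  · have hn := hA x hx hxs
    rw [hΩ.nhdsWithin_eq hx] at hn
    rcases hn with h | h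
    · have he : A.indicator φ =ᶠ[𝓝 x] φ := by
        filter_upwards [h] with y hy using Set.indicator_of_mem hy _
      refine ⟨he.differentiableAt_iff.mpr hd, ?_⟩
      rw [Set.indicator_of_mem (mem_of_mem_nhds h), pd, pd, he.fderiv_eq]
    · have he : A.indicator φ =ᶠ[𝓝 x] fun _ => 0 := by
        filter_upwards [h] with y hy using Set.indicator_of_notMem hy _
      refine ⟨he.differentiableAt_iff.mpr (by fun_prop), ?_⟩
      rw [Set.indicator_of_notMem (mem_of_mem_nhds h), pd, he.fderiv_eq]
      simp
  · have h0 : φ =ᶠ[𝓝 x] fun _ => 0 := notMem_tsupport_iff_eventuallyEq.mp hxs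
    have he : A.indicator φ =ᶠ[𝓝 x] fun _ => 0 := by
      filter_upwards [h0] with y hy
      simp [hy]
    refine ⟨he.differentiableAt_iff.mpr (by fun_prop), ?_⟩
    have hz : pd i φ x = 0 := by simp [pd, h0.fderiv_eq]
    rw [pd, he.fderiv_eq]
    by_cases hxA : x ∈ A <;> simp [hxA, hz]

lemma pd_mul {i : Fin 2} {f g : Plane → ℝ} {x : Plane} (hf : DifferentiableAt ℝ f x)
    (hg : DifferentiableAt ℝ g x) :
    pd i (fun y => f y * g y) x = pd i f x * g x + f x * pd i g x := by
  simp only [pd]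
  rw [fderiv_fun_mul hf hg]
  simp
  ring

lemma locallyIntegrable_indicator {A : Set Plane} (hAm : MeasurableSet A) {φ : Plane → ℝ}
    (hφ : Continuous φ) : LocallyIntegrable (A.indicator φ) := by
  intro x
  obtain ⟨U, hU, h⟩ := hφ.locallyIntegrable (μ := (volume : Measure Plane)) x
  exact ⟨U, hU, h.indicator hAm⟩

/-- Cutting a smooth function off along a set that is locally relatively clopen in `Ω` on the
support commutes with weak differentiation. -/
lemma LocallyClopen.isWeakDeriv {Ω A : Set Plane} (hΩ : IsOpen Ω) {φ : Plane → ℝ}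
    (hA : LocallyClopen Ω A (tsupport φ)) (hAm : MeasurableSet A) (hφ : ContDiff ℝ ∞ φ)
    (i : Fin 2) : IsWeakDeriv Ω i (A.indicator φ) (A.indicator (pd i φ)) := by
  refine ⟨(locallyIntegrable_indicator hAm hφ.continuous).locallyIntegrableOn _,
    (locallyIntegrable_indicator hAm (contDiff_pd hφ).continuous).locallyIntegrableOn _, ?_⟩
  intro ψ hψ hψc hψΩ
  have hzero : ∀ x, x ∉ Ω → ψ x = 0 ∧ pd i ψ x = 0 := fun x hx =>
    ⟨image_eq_zero_of_notMem_tsupport fun h => hx (hψΩ h),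
      image_eq_zero_of_notMem_tsupport fun h => hx (hψΩ (tsupport_pd_subset i ψ h))⟩
  rw [setIntegral_eq_integral_of_forall_compl_eq_zero (fun x hx => by simp [(hzero x hx).2]),
    setIntegral_eq_integral_of_forall_compl_eq_zero (fun x hx => by simp [(hzero x hx).1])]
  have hψd : Differentiable ℝ ψ := hψ.differentiable (by simp)
  have key : ∀ x, DifferentiableAt ℝ (fun y => A.indicator φ y * ψ y) x ∧
      pd i (fun y => A.indicator φ y * ψ y) x
        = A.indicator (pd i φ) x * ψ x + A.indicator φ x * pd i ψ x := by
    intro x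
    by_cases hx : x ∈ tsupport ψ
    · obtain ⟨h1, h2⟩ := hA.indicator_pd hΩ hφ (hψΩ hx) i
      exact ⟨h1.mul (hψd x), by rw [pd_mul h1 (hψd x), h2]⟩
    · have h0 : ψ =ᶠ[𝓝 x] fun _ => 0 := notMem_tsupport_iff_eventuallyEq.mp hx
      have he : (fun y => A.indicator φ y * ψ y) =ᶠ[𝓝 x] fun _ => 0 := by
        filter_upwards [h0] with y hy
        simp [hy]
      refine ⟨he.differentiableAt_iff.mpr (by fun_prop), ?_⟩
      rw [pd, he.fderiv_eq, image_eq_zero_of_notMem_tsupport hx,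
        image_eq_zero_of_notMem_tsupport fun h => hx (tsupport_pd_subset i ψ h)]
      simp
  have hI : ∀ {a b : Plane → ℝ}, Continuous a → Continuous b → HasCompactSupport b →
      Integrable (fun x => A.indicator a x * b x) := by
    intro a b ha hb hbc
    have : (fun x => A.indicator a x * b x) = A.indicator (fun x => a x * b x) := by
      ext x
      by_cases hx : x ∈ A <;> simp [hx]
    rw [this]
    exact ((ha.mul hb).integrable_of_hasCompactSupport hbc.mul_left).indicator hAm
  have hI1 := hI hφ.continuous (contDiff_pd (i := i) hψ).continuous (hasCompactSupport_pd hψc)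
  have hI2 := hI (contDiff_pd (i := i) hφ).continuous hψ.continuous hψc
  have hI3 := hI hφ.continuous hψ.continuous hψc
  have hpd : pd i (fun y => A.indicator φ y * ψ y)
      = fun x => A.indicator (pd i φ) x * ψ x + A.indicator φ x * pd i ψ x :=
    funext fun x => (key x).2
  have h := integral_pd_eq_zero (i := i) (fun x => (key x).1) hI3 (by rw [hpd]; exact hI2.add hI1)
  rw [hpd, integral_add hI2 hI1] at h
  linarith

lemma isWeakDeriv_of_contDiff {Ω : Set Plane} (hΩ : IsOpen Ω) {φ : Plane → ℝ}
    (hφ : ContDiff ℝ ∞ φ) (i : Fin 2) : IsWeakDeriv Ω i φ (pd i φ) := by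
  have h : LocallyClopen Ω Set.univ (tsupport φ) := fun x _ _ => Or.inl univ_mem
  simpa using h.isWeakDeriv hΩ MeasurableSet.univ hφ i

lemma IsWeakDeriv.congr {Ω : Set Plane} {i : Fin 2} {v v' w w' : Plane → ℝ}
    (h : IsWeakDeriv Ω i v w) (hv : v =ᵐ[volume.restrict Ω] v')
    (hw : w =ᵐ[volume.restrict Ω] w') : IsWeakDeriv Ω i v' w' := by
  refine ⟨h.1.congr hv, h.2.1.congr hw, ?_⟩
  intro ψ h1 h2 h3
  have := h.2.2 ψ h1 h2 h3
  rw [← integral_congr_ae (f := fun x => v x * pd i ψ x), this,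
    integral_congr_ae (f := fun x => w x * ψ x)]
  · filter_upwards [hw] with x hx using by rw [hx]
  · filter_upwards [hv] with x hx using by rw [hx]

lemma IsWeakDeriv.mono {Ω U : Set Plane} (hΩ : IsOpen Ω) (hU : U ⊆ Ω)
    {i : Fin 2} {v w : Plane → ℝ} (h : IsWeakDeriv Ω i v w) : IsWeakDeriv U i v w := by
  refine ⟨h.1.mono_set hU, h.2.1.mono_set hU, ?_⟩
  intro ψ h1 h2 h3
  have := h.2.2 ψ h1 h2 (h3.trans hU)
  rw [← setIntegral_eq_of_subset_of_forall_sdiff_eq_zero hΩ.measurableSet hU,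
    ← setIntegral_eq_of_subset_of_forall_sdiff_eq_zero hΩ.measurableSet hU, this]
  · intro x hx
    rw [image_eq_zero_of_notMem_tsupport fun h => hx.2 (h3 h), mul_zero]
  · intro x hx
    rw [image_eq_zero_of_notMem_tsupport fun h => hx.2 (h3 (tsupport_pd_subset i ψ h)), mul_zero]

lemma LocallyIntegrableOn.integrable_mul_compactSupport {Ω : Set Plane} (hΩ : IsOpen Ω)
    {v ψ : Plane → ℝ} (hv : LocallyIntegrableOn v Ω) (hψ : Continuous ψ)
    (hc : HasCompactSupport ψ) (hs : tsupport ψ ⊆ Ω) :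
    IntegrableOn (fun x => v x * ψ x) Ω := by
  have h1 : IntegrableOn v (tsupport ψ) := hv.integrableOn_compact_subset hs hc
  have h2 : IntegrableOn (fun x => v x * ψ x) (tsupport ψ) :=
    h1.mul_continuousOn hψ.continuousOn hc
  refine IntegrableOn.of_forall_sdiff_eq_zero h2 hΩ.measurableSet ?_
  intro x hx
  rw [image_eq_zero_of_notMem_tsupport hx.2, mul_zero]

lemma IsWeakDeriv.sub {Ω : Set Plane} (hΩ : IsOpen Ω) {i : Fin 2} {v v' w w' : Plane → ℝ}
    (h : IsWeakDeriv Ω i v w) (h' : IsWeakDeriv Ω i v' w') :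
    IsWeakDeriv Ω i (v - v') (w - w') := by
  refine ⟨h.1.sub h'.1, h.2.1.sub h'.2.1, ?_⟩
  intro ψ h1 h2 h3
  have e1 := h.2.2 ψ h1 h2 h3
  have e2 := h'.2.2 ψ h1 h2 h3
  have hp : ∀ {a}, LocallyIntegrableOn a Ω → IntegrableOn (fun x => a x * pd i ψ x) Ω :=
    fun ha => LocallyIntegrableOn.integrable_mul_compactSupport hΩ ha (contDiff_pd h1).continuous
      (hasCompactSupport_pd h2) ((tsupport_pd_subset i ψ).trans h3)
  have hq : ∀ {a}, LocallyIntegrableOn a Ω → IntegrableOn (fun x => a x * ψ x) Ω :=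
    fun ha => LocallyIntegrableOn.integrable_mul_compactSupport hΩ ha h1.continuous h2 h3
  simp only [Pi.sub_apply, sub_mul]
  rw [integral_sub (hp h.1) (hp h'.1), integral_sub (hq h.2.1) (hq h'.2.1), e1, e2]
  ring

/-- Weak derivatives are unique, by the fundamental lemma of the calculus of variations. -/
lemma IsWeakDeriv.ae_unique {Ω : Set Plane} (hΩ : IsOpen Ω) {i : Fin 2} {v w w' : Plane → ℝ}
    (h : IsWeakDeriv Ω i v w) (h' : IsWeakDeriv Ω i v w') : w =ᵐ[volume.restrict Ω] w' := by
  have hs := h.sub hΩ h'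
  have hz := hΩ.ae_eq_zero_of_integral_contDiff_smul_eq_zero (μ := volume) hs.2.1 (by
    intro ψ h1 h2 h3
    have e := hs.2.2 ψ h1 h2 h3
    simp only [sub_self, Pi.zero_apply, zero_mul, integral_zero] at e
    have e2 : ∫ x in Ω, (w - w') x * ψ x = 0 := by linarith
    rw [setIntegral_eq_integral_of_forall_compl_eq_zero (fun x hx => by
      rw [image_eq_zero_of_notMem_tsupport fun h => hx (h3 h), mul_zero])] at e2
    simpa [mul_comm] using e2)
  rw [Filter.EventuallyEq, ae_restrict_iff' hΩ.measurableSet]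
  filter_upwards [hz] with x hx hxΩ
  have := hx hxΩ
  simp only [Pi.sub_apply] at this
  linarith

lemma weakDeriv_spec {Ω : Set Plane} {i : Fin 2} {v w : Plane → ℝ} (h : IsWeakDeriv Ω i v w) :
    IsWeakDeriv Ω i v (weakDeriv Ω i v) := by
  have hex : ∃ w, IsWeakDeriv Ω i v w := ⟨w, h⟩
  rw [weakDeriv, dif_pos hex]
  exact hex.choose_spec

lemma weakDeriv_ae_eq {Ω : Set Plane} (hΩ : IsOpen Ω) {i : Fin 2} {v w : Plane → ℝ}
    (h : IsWeakDeriv Ω i v w) : weakDeriv Ω i v =ᵐ[volume.restrict Ω] w :=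
  (weakDeriv_spec h).ae_unique hΩ h

lemma weakDeriv_congr {Ω : Set Plane} (hΩ : IsOpen Ω) {i : Fin 2} {v v' w : Plane → ℝ}
    (h : IsWeakDeriv Ω i v w) (hv : v =ᵐ[volume.restrict Ω] v') :
    weakDeriv Ω i v =ᵐ[volume.restrict Ω] weakDeriv Ω i v' :=
  (weakDeriv_ae_eq hΩ h).trans (weakDeriv_ae_eq hΩ (h.congr hv EventuallyEq.rfl)).symm

/-- On an open subset where a function is almost everywhere smooth, its weak derivative is the
classical one. -/
lemma IsWeakDeriv.ae_eq_pd {Ω U : Set Plane} (hΩ : IsOpen Ω) (hU : IsOpen U) (hUΩ : U ⊆ Ω)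
    {i : Fin 2} {v w q : Plane → ℝ} (h : IsWeakDeriv Ω i v w) (hq : ContDiff ℝ ∞ q)
    (hv : v =ᵐ[volume.restrict U] q) : w =ᵐ[volume.restrict U] pd i q :=
  ((h.mono hΩ hUΩ).congr hv EventuallyEq.rfl).ae_unique hU (isWeakDeriv_of_contDiff hU hq i)

/-! ### Admissible cut-off functions -/

lemma memLp_indicator {A : Set Plane} (hAm : MeasurableSet A) {φ : Plane → ℝ}
    (hφ : Continuous φ) (hc : HasCompactSupport φ) (μ : Measure Plane)
    [IsFiniteMeasureOnCompacts μ] : MemLp (A.indicator φ) 2 μ :=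
  (hφ.memLp_of_hasCompactSupport hc).indicator hAm

lemma LocallyClopen.memH1 {Ω A : Set Plane} (hΩ : IsOpen Ω) {φ : Plane → ℝ}
    (hA : LocallyClopen Ω A (tsupport φ)) (hAm : MeasurableSet A) (hφ : ContDiff ℝ ∞ φ)
    (hc : HasCompactSupport φ) : MemH1 Ω (A.indicator φ) :=
  ⟨(memLp_indicator hAm hφ.continuous hc volume).restrict Ω, fun i =>
    ⟨A.indicator (pd i φ), (memLp_indicator hAm (contDiff_pd hφ).continuous
      (hasCompactSupport_pd hc) volume).restrict Ω, hA.isWeakDeriv hΩ hAm hφ i⟩⟩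

lemma LocallyClopen.pd {X A : Set Plane} {φ : Plane → ℝ}
    (hA : LocallyClopen X A (tsupport φ)) (i : Fin 2) :
    LocallyClopen X A (tsupport (pd i φ)) :=
  hA.mono subset_rfl (tsupport_pd_subset i φ)

lemma LocallyClopen.memH2 {Ω A : Set Plane} (hΩ : IsOpen Ω) {φ : Plane → ℝ}
    (hA : LocallyClopen Ω A (tsupport φ)) (hAm : MeasurableSet A) (hφ : ContDiff ℝ ∞ φ)
    (hc : HasCompactSupport φ) : MemH2 Ω (A.indicator φ) :=
  ⟨(memLp_indicator hAm hφ.continuous hc volume).restrict Ω, fun i =>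
    ⟨A.indicator (Kirchhoff.pd i φ), (hA.pd i).memH1 hΩ hAm (contDiff_pd hφ)
      (hasCompactSupport_pd hc), hA.isWeakDeriv hΩ hAm hφ i⟩⟩

lemma LocallyClopen.continuousOn {X A : Set Plane} {φ : Plane → ℝ}
    (hA : LocallyClopen X A (tsupport φ)) (hφ : Continuous φ) :
    ContinuousOn (A.indicator φ) X := by
  intro x hx
  by_cases hxs : x ∈ tsupport φ
  · rcases hA x hx hxs with h | h
    · have he : A.indicator φ =ᶠ[𝓝[X] x] φ := by
        filter_upwards [h] with y hy using Set.indicator_of_mem hy _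
      exact hφ.continuousWithinAt.congr_of_eventuallyEq he
        (Set.indicator_of_mem (mem_of_mem_nhdsWithin hx h) _)
    · have he : A.indicator φ =ᶠ[𝓝[X] x] fun _ => 0 := by
        filter_upwards [h] with y hy using Set.indicator_of_notMem hy _
      exact continuousWithinAt_const.congr_of_eventuallyEq he
        (Set.indicator_of_notMem (mem_of_mem_nhdsWithin hx h) _)
  · have h0 : φ =ᶠ[𝓝 x] fun _ => 0 := notMem_tsupport_iff_eventuallyEq.mp hxs
    have he : A.indicator φ =ᶠ[𝓝 x] fun _ => 0 := by
      filter_upwards [h0] with y hy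
      simp [hy]
    exact (continuousAt_const.congr he.symm).continuousWithinAt

lemma LocallyClopen.weakDeriv_weakDeriv {Ω A : Set Plane} (hΩ : IsOpen Ω) {φ : Plane → ℝ}
    (hA : LocallyClopen Ω A (tsupport φ)) (hAm : MeasurableSet A) (hφ : ContDiff ℝ ∞ φ)
    (i j : Fin 2) : weakDeriv Ω j (weakDeriv Ω i (A.indicator φ)) =ᵐ[volume.restrict Ω]
      A.indicator (Kirchhoff.pd j (Kirchhoff.pd i φ)) := by
  have h1 := weakDeriv_ae_eq hΩ (hA.isWeakDeriv hΩ hAm hφ i)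
  have h2 := (hA.pd i).isWeakDeriv hΩ hAm (contDiff_pd hφ) j
  exact ((weakDeriv_congr hΩ h2 h1.symm).symm).trans (weakDeriv_ae_eq hΩ h2)

/-- A function with a representative that is continuous up to the boundary has zero trace where the
representative vanishes: the approximating sequence in the definition of the trace can be taken
constant. -/
lemma hasTrace_zero_of_ae {Ω Γ : Set Plane} {w φ : Plane → ℝ}
    (hc : ContinuousOn φ (closure Ω)) (hφ : MemH1 Ω φ) (hw : φ =ᵐ[volume.restrict Ω] w)
    (hw' : ∀ i, weakDeriv Ω i φ =ᵐ[volume.restrict Ω] weakDeriv Ω i w)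
    (h0 : ∀ᵐ x ∂(arc Γ), φ x = 0) : HasTrace Ω w Γ 0 := by
  have aux : ∀ {μ : Measure Plane} {a b : Plane → ℝ}, a =ᵐ[μ] b → eLpNorm (a - b) 2 μ = 0 := by
    intro μ a b h
    rw [eLpNorm_congr_ae (g := (0 : Plane → ℝ)), eLpNorm_zero]
    filter_upwards [h] with x hx
    simp [hx]
  refine ⟨MemLp.zero, fun _ => φ, fun _ => ⟨hc, hφ⟩, ?_, fun i => ?_, ?_⟩
  · exact tendsto_const_nhds.congr fun _ => (aux hw).symm
  · exact tendsto_const_nhds.congr fun _ => (aux (hw' i)).symm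
  · exact tendsto_const_nhds.congr fun _ => (aux h0).symm

/-- A smooth compactly supported function, cut off along a locally clopen set, is kinematically
admissible as soon as it satisfies the essential boundary conditions almost everywhere. -/
lemma Problem.indicator_mem_V (P : Problem) {A : Set Plane} {φ : Plane → ℝ}
    (hA : LocallyClopen (closure P.Ω) A (tsupport φ)) (hAm : MeasurableSet A)
    (hφ : ContDiff ℝ ∞ φ) (hc : HasCompactSupport φ)
    (h0 : ∀ᵐ x ∂(arc (P.Γc ∪ P.Γs)), A.indicator φ x = 0)
    (h1 : ∀ i, ∀ᵐ x ∂(arc P.Γc), A.indicator (pd i φ) x = 0) : A.indicator φ ∈ P.V := by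
  have hΩ := P.isOpen
  have hA' := hA.mono subset_closure (D' := tsupport φ) subset_rfl
  refine ⟨hA'.continuousOn hφ.continuous, hA'.memH2 hΩ hAm hφ hc,
    hasTrace_zero_of_ae (hA.continuousOn hφ.continuous) (hA'.memH1 hΩ hAm hφ hc)
      EventuallyEq.rfl (fun _ => EventuallyEq.rfl) h0, fun _ => 0, fun i => ?_, ?_⟩
  · have hw := (weakDeriv_ae_eq hΩ (hA'.isWeakDeriv hΩ hAm hφ i)).symm
    exact hasTrace_zero_of_ae ((hA.pd i).continuousOn (contDiff_pd hφ).continuous)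
      ((hA'.pd i).memH1 hΩ hAm (contDiff_pd hφ) (hasCompactSupport_pd hc)) hw
      (fun j => weakDeriv_congr hΩ ((hA'.pd i).isWeakDeriv hΩ hAm (contDiff_pd hφ) j) hw) (h1 i)
  · exact Eventually.of_forall fun x n _ => by simp

lemma MemH2.weakDeriv_spec {Ω : Set Plane} (hΩ : IsOpen Ω) {v : Plane → ℝ} (h : MemH2 Ω v)
    (i j : Fin 2) : IsWeakDeriv Ω i v (weakDeriv Ω i v) ∧
      IsWeakDeriv Ω j (weakDeriv Ω i v) (weakDeriv Ω j (weakDeriv Ω i v)) ∧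
      MemLp (weakDeriv Ω j (weakDeriv Ω i v)) 2 (volume.restrict Ω) := by
  obtain ⟨w, hw, hvw⟩ := h.2 i
  obtain ⟨z, hz, hwz⟩ := hw.2 j
  have h1 := weakDeriv_ae_eq hΩ hvw
  have h2 := hwz.congr h1.symm EventuallyEq.rfl
  exact ⟨Kirchhoff.weakDeriv_spec hvw, Kirchhoff.weakDeriv_spec h2,
    (memLp_congr_ae (weakDeriv_ae_eq hΩ h2)).mpr hz⟩

lemma MemH2.weakHess_sub {Ω : Set Plane} (hΩ : IsOpen Ω) {v v' : Plane → ℝ} (h : MemH2 Ω v)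
    (h' : MemH2 Ω v') :
    ∀ᵐ x ∂(volume.restrict Ω), weakHess Ω (v - v') x = weakHess Ω v x - weakHess Ω v' x := by
  have key : ∀ i j, weakDeriv Ω j (weakDeriv Ω i (v - v')) =ᵐ[volume.restrict Ω]
      weakDeriv Ω j (weakDeriv Ω i v) - weakDeriv Ω j (weakDeriv Ω i v') := by
    intro i j
    have e1 := weakDeriv_ae_eq hΩ
      ((h.weakDeriv_spec hΩ i j).1.sub hΩ (h'.weakDeriv_spec hΩ i j).1)
    have e2 := (h.weakDeriv_spec hΩ i j).2.1.sub hΩ (h'.weakDeriv_spec hΩ i j).2.1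
    exact (weakDeriv_congr hΩ e2 e1.symm).symm.trans (weakDeriv_ae_eq hΩ e2)
  filter_upwards [key 0 0, key 0 1, key 1 0, key 1 1] with x a b c d
  ext i j
  fin_cases i <;> fin_cases j <;> simpa [weakHess]

/-- Where a function of class `H²` agrees with a smooth function, its weak Hessian is classical. -/
lemma MemH2.weakHess_eq {Ω U : Set Plane} (hΩ : IsOpen Ω) (hU : IsOpen U) (hUΩ : U ⊆ Ω)
    {v q : Plane → ℝ} (h : MemH2 Ω v) (hq : ContDiff ℝ ∞ q) (hv : ∀ x ∈ U, v x = q x) :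
    ∀ᵐ x ∂(volume.restrict U), weakHess Ω v x = Matrix.of fun i j => pd j (pd i q) x := by
  have key : ∀ i j, weakDeriv Ω j (weakDeriv Ω i v) =ᵐ[volume.restrict U] pd j (pd i q) := by
    intro i j
    obtain ⟨h1, h2, -⟩ := h.weakDeriv_spec hΩ i j
    exact h2.ae_eq_pd hΩ hU hUΩ (contDiff_pd hq) (h1.ae_eq_pd hΩ hU hUΩ hq
      ((ae_restrict_iff' hU.measurableSet).mpr (Eventually.of_forall hv)))
  filter_upwards [key 0 0, key 0 1, key 1 0, key 1 1] with x a b c d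
  ext i j
  fin_cases i <;> fin_cases j <;> simpa [weakHess]

lemma normL2_sq (μ : Measure Plane) (w : Plane → ℝ) : normL2 μ w ^ 2 = ∫ x, w x ^ 2 ∂μ :=
  Real.sq_sqrt (integral_nonneg fun _ => sq_nonneg _)

/-- The `H²` norm dominates the `L²` norms of the second derivatives. -/
lemma sum_weakHess_le_normH2 (Ω : Set Plane) (v : Plane → ℝ) :
    ∑ i, ∑ j, ∫ x in Ω, weakHess Ω v x i j ^ 2 ≤ normH2 Ω v ^ 2 := by
  rw [normH2, Real.sq_sqrt (by positivity)]
  simp only [normL2_sq]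
  have h1 : 0 ≤ ∫ x in Ω, v x ^ 2 := integral_nonneg fun _ => sq_nonneg _
  have h2 : 0 ≤ ∑ i, ∫ x in Ω, weakDeriv Ω i v x ^ 2 :=
    Finset.sum_nonneg fun i _ => integral_nonneg fun _ => sq_nonneg _
  simp only [weakHess, Matrix.of_apply]
  linarith

/-! ### The energy density -/

/-- The energy density `M(w) : K(v)` as a function of the Hessians of `w` and `v`. -/
def Material.density (mat : Material) (H G : Matrix (Fin 2) (Fin 2) ℝ) : ℝ :=
  ∑ i, ∑ j, mat.moment H i j * curvature G i j

lemma Material.density_eq (mat : Material) (H G : Matrix (Fin 2) (Fin 2) ℝ) :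
    mat.density H G = mat.d ^ 3 / 12 * (mat.E / (1 + mat.ν)) *
      (H 0 0 * G 0 0 + (H 0 1 + H 1 0) * (G 0 1 + G 1 0) / 2 + H 1 1 * G 1 1
        + mat.ν / (1 - mat.ν) * (H 0 0 + H 1 1) * (G 0 0 + G 1 1)) := by
  simp [density, moment, Material.constRel, curvature, strain, Matrix.trace, Fin.sum_univ_two,
    Matrix.smul_apply]
  ring

lemma Material.density_sub (mat : Material) (H H' G : Matrix (Fin 2) (Fin 2) ℝ) :
    mat.density (H - H') G = mat.density H G - mat.density H' G := by
  simp only [density_eq, Matrix.sub_apply]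
  ring

lemma Material.density_zero (mat : Material) (H : Matrix (Fin 2) (Fin 2) ℝ) :
    mat.density H 0 = 0 := by
  simp [density_eq]

/-- A constant for the pointwise bound of the energy density. -/
def Material.densityBound (mat : Material) : ℝ :=
  |mat.d ^ 3 / 12 * (mat.E / (1 + mat.ν))| * (1 + |mat.ν / (1 - mat.ν)|)

lemma Material.abs_density_le (mat : Material) (H G : Matrix (Fin 2) (Fin 2) ℝ) {W : ℝ}
    (hG : ∀ i j, |G i j| ≤ W) :
    |mat.density H G| ≤ mat.densityBound * (∑ i, ∑ j, |H i j|) * (2 * W) := by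
  have hW : 0 ≤ W := (abs_nonneg _).trans (hG 0 0)
  rw [density_eq, abs_mul, densityBound,
    show ∀ a b c e : ℝ, a * b * c * e = a * (b * (c * e)) by intros; ring]
  refine mul_le_mul_of_nonneg_left ?_ (abs_nonneg _)
  set S := ∑ i, ∑ j, |H i j| with hS
  have hS' : S = |H 0 0| + |H 0 1| + (|H 1 0| + |H 1 1|) := by
    simp [hS, Fin.sum_univ_two]
  have b1 : |H 0 0 * G 0 0| ≤ |H 0 0| * W := by
    rw [abs_mul]; exact mul_le_mul_of_nonneg_left (hG 0 0) (abs_nonneg _)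
  have b2 : |H 1 1 * G 1 1| ≤ |H 1 1| * W := by
    rw [abs_mul]; exact mul_le_mul_of_nonneg_left (hG 1 1) (abs_nonneg _)
  have b3 : |(H 0 1 + H 1 0) * (G 0 1 + G 1 0) / 2| ≤ (|H 0 1| + |H 1 0|) * W := by
    rw [mul_div_assoc, abs_mul]
    refine mul_le_mul (abs_add_le (H 0 1) (H 1 0)) ?_ (abs_nonneg _) (by positivity)
    rw [abs_div, abs_two]
    have := abs_add_le (G 0 1) (G 1 0)
    linarith [hG 0 1, hG 1 0]
  have b4 : |mat.ν / (1 - mat.ν) * (H 0 0 + H 1 1) * (G 0 0 + G 1 1)|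
      ≤ |mat.ν / (1 - mat.ν)| * (S * (2 * W)) := by
    rw [abs_mul, abs_mul, mul_assoc]
    refine mul_le_mul_of_nonneg_left ?_ (abs_nonneg _)
    refine mul_le_mul ?_ ?_ (abs_nonneg _) (by rw [hS']; positivity)
    · have := abs_add_le (H 0 0) (H 1 1)
      rw [hS']
      linarith [abs_nonneg (H 0 1), abs_nonneg (H 1 0)]
    · have := abs_add_le (G 0 0) (G 1 1)
      linarith [hG 0 0, hG 1 1]
  have b5 : 0 ≤ S * W := mul_nonneg (by rw [hS']; positivity) hW
  have b6 : |H 0 0| * W + (|H 0 1| + |H 1 0|) * W + |H 1 1| * W = S * W := by rw [hS']; ring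
  have tri : ∀ a b c d : ℝ, |a + b + c + d| ≤ |a| + |b| + |c| + |d| := fun a b c d =>
    (abs_add_le _ _).trans (add_le_add_left (abs_add_three a b c) _)
  refine (tri _ _ _ _).trans ?_
  nlinarith

/-! ### The divergence theorem on a half plane -/

/-- The straight line through `m` in the direction `v`. -/
def line (m v : Plane) (t : ℝ) : Plane := m + t • v

lemma isometry_line (m : Plane) {v : Plane} (hv : ‖v‖ = 1) : Isometry (line m v) := by
  refine Isometry.of_dist_eq fun a b => ?_
  simp [line, dist_eq_norm, ← sub_smul, norm_smul, hv]

lemma contDiff_line (m v : Plane) : ContDiff ℝ ∞ (line m v) := by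
  unfold line; fun_prop

lemma hasDerivAt_comp_line {G : Plane → ℝ} (hG : Differentiable ℝ G) (m v : Plane) (t : ℝ) :
    HasDerivAt (fun t => G (line m v t)) (fderiv ℝ G (line m v t) v) t := by
  have h1 : HasDerivAt (line m v) v t := by
    have := ((hasDerivAt_id t).smul_const v).const_add m
    rw [one_smul] at this
    exact this
  exact (hG _).hasFDerivAt.comp_hasDerivAt t h1

lemma hasCompactSupport_comp_line {G : Plane → ℝ} (hG : HasCompactSupport G) (m : Plane)
    {v : Plane} (hv : ‖v‖ = 1) : HasCompactSupport fun t => G (line m v t) :=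
  hG.comp_isClosedEmbedding (isometry_line m hv).isClosedEmbedding

lemma integral_deriv_line {G : Plane → ℝ} (hG : ContDiff ℝ ∞ G) (hc : HasCompactSupport G)
    (m : Plane) {v : Plane} (hv : ‖v‖ = 1) :
    ∫ t in Set.Iio (0 : ℝ), fderiv ℝ G (line m v t) v = G m := by
  have hc' := hasCompactSupport_comp_line hc m hv
  have hC : ContDiff ℝ 1 fun t => G (line m v t) :=
    (hG.comp (contDiff_line m v)).of_le (by simp)
  have := hc'.integral_Iic_deriv_eq hC 0
  rw [integral_Iic_eq_integral_Iio] at this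
  simp only [(hasDerivAt_comp_line (hG.differentiable (by simp)) m v _).deriv] at this
  rw [this]
  simp [line]

lemma integral_deriv_line_univ {G : Plane → ℝ} (hG : ContDiff ℝ ∞ G) (hc : HasCompactSupport G)
    (m : Plane) {v : Plane} (hv : ‖v‖ = 1) : ∫ t, fderiv ℝ G (line m v t) v = 0 := by
  have hc' := hasCompactSupport_comp_line hc m hv
  have hC : ContDiff ℝ 1 fun t => G (line m v t) :=
    (hG.comp (contDiff_line m v)).of_le (by simp)
  have h := integral_eq_zero_of_hasDerivAt_of_integrable
    (fun t => hasDerivAt_comp_line (hG.differentiable (by simp)) m v t) ?_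
    (hC.continuous.integrable_of_hasCompactSupport hc')
  · exact h
  · have := (hC.continuous_deriv le_rfl).integrable_of_hasCompactSupport hc'.deriv (μ := volume)
    refine this.congr (Eventually.of_forall fun t => ?_)
    exact (hasDerivAt_comp_line (hG.differentiable (by simp)) m v t).deriv

lemma norm_tangent (n : Plane) : ‖tangent n‖ = ‖n‖ := by
  simp [EuclideanSpace.norm_eq, tangent, Fin.sum_univ_two, add_comm]

lemma inner_eq (x y : Plane) : ⟪x, y⟫ = x 0 * y 0 + x 1 * y 1 := by
  simp [PiLp.inner_apply, Fin.sum_univ_two, mul_comm]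

lemma inner_tangent_self (n : Plane) : ⟪n, tangent n⟫ = 0 := by
  simp [inner_eq, tangent]; ring

lemma sq_add_sq_of_norm {n : Plane} (hn : ‖n‖ = 1) : n 0 * n 0 + n 1 * n 1 = 1 := by
  rw [← inner_eq, real_inner_self_eq_norm_sq, hn]; norm_num

/-- The orthonormal basis consisting of a unit normal and its tangent. -/
def normalBasis (n : Plane) (hn : ‖n‖ = 1) : OrthonormalBasis (Fin 2) ℝ Plane :=
  have ho : Orthonormal ℝ ![n, tangent n] := by
    rw [orthonormal_iff_ite]
    have h3 := inner_tangent_self n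
    have h4 : ⟪tangent n, n⟫ = 0 := by rw [real_inner_comm, h3]
    intro i j
    fin_cases i <;> fin_cases j <;> simp [h3, h4, norm_tangent, hn]
  OrthonormalBasis.mk ho
    (ho.linearIndependent.span_eq_top_of_card_eq_finrank' (by simp)).ge

@[simp] lemma normalBasis_zero (n : Plane) (hn : ‖n‖ = 1) : normalBasis n hn 0 = n := by
  simp [normalBasis]

@[simp] lemma normalBasis_one (n : Plane) (hn : ‖n‖ = 1) : normalBasis n hn 1 = tangent n := by
  simp [normalBasis]

lemma normalBasis_repr (n : Plane) (hn : ‖n‖ = 1) (x : Plane) :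
    (normalBasis n hn).repr x 0 = ⟪n, x⟫ ∧ (normalBasis n hn).repr x 1 = ⟪tangent n, x⟫ := by
  simp [OrthonormalBasis.repr_apply_apply]

lemma normalBasis_repr_symm (n : Plane) (hn : ‖n‖ = 1) (y : Plane) :
    (normalBasis n hn).repr.symm y = y 0 • n + y 1 • tangent n := by
  have := (normalBasis n hn).sum_repr_symm y
  rw [← this]
  simp [Fin.sum_univ_two]

/-- Orthogonal coordinates with respect to a normal and its tangent, as a measurable
equivalence. -/
def frame (m n : Plane) (hn : ‖n‖ = 1) : ℝ × ℝ ≃ᵐ Plane :=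
  (MeasurableEquiv.finTwoArrow.symm.trans (MeasurableEquiv.toLp 2 (Fin 2 → ℝ))).trans
    ((normalBasis n hn).repr.symm.toHomeomorph.toMeasurableEquiv.trans
      (Homeomorph.addLeft m).toMeasurableEquiv)

lemma frame_apply (m n : Plane) (hn : ‖n‖ = 1) (p : ℝ × ℝ) :
    frame m n hn p = m + (p.1 • n + p.2 • tangent n) := by
  change m + (normalBasis n hn).repr.symm (WithLp.toLp 2 _) = _
  rw [normalBasis_repr_symm]
  simp [MeasurableEquiv.finTwoArrow]

lemma measurePreserving_frame (m n : Plane) (hn : ‖n‖ = 1) :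
    MeasurePreserving (frame m n hn) := by
  refine MeasurePreserving.trans (MeasurePreserving.trans
    ((volume_preserving_finTwoArrow ℝ).symm _)
    (PiLp.volume_preserving_toLp (Fin 2))) (MeasurePreserving.trans
      (normalBasis n hn).measurePreserving_repr_symm ?_)
  exact measurePreserving_add_left volume m

/-- The half plane with outer normal `n` whose boundary passes through `m`. -/
def halfPlane (m n : Plane) : Set Plane := {y | ⟪y - m, n⟫ < 0}

lemma isOpen_halfPlane (m n : Plane) : IsOpen (halfPlane m n) :=
  isOpen_lt (by fun_prop) (by fun_prop)

lemma setIntegral_halfPlane (m n : Plane) (hn : ‖n‖ = 1) (F : Plane → ℝ) :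
    ∫ x in halfPlane m n, F x
      = ∫ p : ℝ × ℝ in Set.Iio (0 : ℝ) ×ˢ Set.univ, F (m + (p.1 • n + p.2 • tangent n)) := by
  rw [← (measurePreserving_frame m n hn).setIntegral_preimage_emb
    (frame m n hn).measurableEmbedding]
  simp only [frame_apply]
  congr 2
  ext p
  have h4 : ⟪tangent n, n⟫ = 0 := by rw [real_inner_comm, inner_tangent_self]
  simp [halfPlane, frame_apply, inner_add_left, inner_smul_left, hn, h4]

lemma integrable_comp_frame {F : Plane → ℝ} (m n : Plane) (hn : ‖n‖ = 1) (hF : Integrable F) :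
    Integrable fun p : ℝ × ℝ => F (m + (p.1 • n + p.2 • tangent n)) := by
  have := (measurePreserving_frame m n hn).integrable_comp_of_integrable hF
  simpa [Function.comp_def, frame_apply] using this

/-- The divergence theorem on a half plane, for the derivative in the normal direction. -/
lemma setIntegral_halfPlane_normal {G : Plane → ℝ} (hG : ContDiff ℝ ∞ G)
    (hc : HasCompactSupport G) (m n : Plane) (hn : ‖n‖ = 1) :
    ∫ x in halfPlane m n, fderiv ℝ G x n = ∫ s, G (line m (tangent n) s) := by
  have hI : Integrable fun x => fderiv ℝ G x n := by
    refine Continuous.integrable_of_hasCompactSupport ?_ ?_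
    · exact (hG.continuous_fderiv (by simp)).clm_apply continuous_const
    · exact hc.fderiv_apply (𝕜 := ℝ) n
  rw [setIntegral_halfPlane m n hn, Measure.volume_eq_prod, ← Measure.prod_restrict,
    integral_prod_symm]
  · rw [Measure.restrict_univ]
    refine integral_congr_ae (Eventually.of_forall fun s => ?_)
    have := integral_deriv_line hG hc (line m (tangent n) s) hn
    simp only
    rw [← this]
    refine integral_congr_ae (Eventually.of_forall fun t => ?_)
    simp only [line]
    congr 2
    abel
  · rw [Measure.prod_restrict]
    exact (integrable_comp_frame m n hn hI).integrableOn

/-- The divergence theorem on a half plane, for the derivative in the tangential direction. -/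
lemma setIntegral_halfPlane_tangent {G : Plane → ℝ} (hG : ContDiff ℝ ∞ G)
    (hc : HasCompactSupport G) (m n : Plane) (hn : ‖n‖ = 1) :
    ∫ x in halfPlane m n, fderiv ℝ G x (tangent n) = 0 := by
  have hI : Integrable fun x => fderiv ℝ G x (tangent n) := by
    refine Continuous.integrable_of_hasCompactSupport ?_ ?_
    · exact (hG.continuous_fderiv (by simp)).clm_apply continuous_const
    · exact hc.fderiv_apply (𝕜 := ℝ) (tangent n)
  rw [setIntegral_halfPlane m n hn, Measure.volume_eq_prod, setIntegral_prod]
  · refine (integral_congr_ae (Eventually.of_forall fun t => ?_)).trans (integral_zero' ℝ ℝ)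
    have := integral_deriv_line_univ hG hc (line m n t) (v := tangent n) (by rw [norm_tangent, hn])
    rw [Measure.restrict_univ]
    simp only [Pi.zero_apply]
    rw [← this]
    refine integral_congr_ae (Eventually.of_forall fun s => ?_)
    simp only [line]
    congr 2
    abel
  · exact (integrable_comp_frame m n hn hI).integrableOn

lemma single_eq (i : Fin 2) {n : Plane} (hn : ‖n‖ = 1) :
    (EuclideanSpace.single i 1 : Plane) = n i • n + tangent n i • tangent n := by
  have h := sq_add_sq_of_norm hn
  ext j
  fin_cases i <;> fin_cases j <;> simp [tangent] <;> linarith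

lemma pd_eq (i : Fin 2) {n : Plane} (hn : ‖n‖ = 1) (G : Plane → ℝ) (x : Plane) :
    pd i G x = n i * fderiv ℝ G x n + tangent n i * fderiv ℝ G x (tangent n) := by
  rw [pd, single_eq i hn]
  simp

/-- The divergence theorem on a half plane, for the partial derivatives. As `G` has compact support,
the boundary integral runs over the whole bounding line. -/
lemma setIntegral_halfPlane_pd {G : Plane → ℝ} (hG : ContDiff ℝ ∞ G)
    (hc : HasCompactSupport G) (m n : Plane) (hn : ‖n‖ = 1) (i : Fin 2) :
    ∫ x in halfPlane m n, pd i G x = n i * ∫ s, G (line m (tangent n) s) := by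
  have hI : ∀ v, IntegrableOn (fun x => fderiv ℝ G x v) (halfPlane m n) := fun v => by
    refine (Continuous.integrable_of_hasCompactSupport ?_ ?_).integrableOn
    · exact (hG.continuous_fderiv (by simp)).clm_apply continuous_const
    · exact hc.fderiv_apply (𝕜 := ℝ) v
  simp only [pd_eq i hn]
  rw [integral_add ((hI _).const_mul _) ((hI _).const_mul _), integral_const_mul,
    integral_const_mul, setIntegral_halfPlane_normal hG hc m n hn,
    setIntegral_halfPlane_tangent hG hc m n hn]
  ring

/-! ### The Green formula of the plate operator -/

lemma pd_comm {φ : Plane → ℝ} (h : ContDiff ℝ ∞ φ) (i j : Fin 2) :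
    pd i (pd j φ) = pd j (pd i φ) := by
  have key : ∀ (i j : Fin 2) x, pd i (pd j φ) x
      = fderiv ℝ (fderiv ℝ φ) x (EuclideanSpace.single i 1) (EuclideanSpace.single j 1) := by
    intro i j x
    have hd : DifferentiableAt ℝ (fderiv ℝ φ) x :=
      (h.fderiv_right (m := ∞) (by simp)).differentiable (by simp) x
    change fderiv ℝ (fun y => fderiv ℝ φ y (EuclideanSpace.single j 1)) x _ = _
    rw [fderiv_clm_apply hd (by fun_prop)]
    simp
  ext x
  rw [key, key]
  have : IsSymmSndFDerivAt ℝ φ x := (h.contDiffAt).isSymmSndFDerivAt (by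
    simpa using WithTop.coe_le_coe.mpr (le_top : (2 : ℕ∞) ≤ ⊤))
  exact this.eq _ _

lemma pd_add {i : Fin 2} {f g : Plane → ℝ} (hf : Differentiable ℝ f)
    (hg : Differentiable ℝ g) : pd i (fun y => f y + g y) = fun x => pd i f x + pd i g x := by
  ext x
  simp only [pd]
  rw [fderiv_fun_add (hf x) (hg x)]
  simp

lemma pd_const_mul {i : Fin 2} {f : Plane → ℝ} (hf : Differentiable ℝ f) (c : ℝ) :
    pd i (fun y => c * f y) = fun x => c * pd i f x := by
  ext x
  simp only [pd]
  rw [fderiv_const_mul (hf x)]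
  simp

lemma laplacian_eq_pd {p : Plane → ℝ} (hp : ContDiff ℝ ∞ p) :
    Laplacian.laplacian p = fun x => pd 0 (pd 0 p) x + pd 1 (pd 1 p) x := by
  have h := InnerProductSpace.laplacian_eq_iteratedFDeriv_orthonormalBasis p
    (EuclideanSpace.basisFun (Fin 2) ℝ)
  rw [h]
  have hd : Differentiable ℝ (fderiv ℝ p) :=
      (hp.fderiv_right (m := ∞) (by simp)).differentiable (by simp)
  have key : ∀ (i : Fin 2) x, pd i (pd i p) x
      = fderiv ℝ (fderiv ℝ p) x (EuclideanSpace.single i 1) (EuclideanSpace.single i 1) := by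
    intro i x
    change fderiv ℝ (fun y => fderiv ℝ p y (EuclideanSpace.single i 1)) x _ = _
    rw [fderiv_clm_apply (hd x) (by fun_prop)]
    simp
  ext x
  simp [Fin.sum_univ_two, iteratedFDeriv_two_apply, key]

lemma Material.M_eq (mat : Material) {p : Plane → ℝ} (hp : ContDiff ℝ ∞ p) (i j : Fin 2) :
    (fun x => mat.M p x i j) = fun x =>
      -(mat.d ^ 3 / 12 * (mat.E / (1 + mat.ν))) * (pd j (pd i p) x + mat.ν / (1 - mat.ν) *
        (if i = j then 1 else 0) * (pd 0 (pd 0 p) x + pd 1 (pd 1 p) x)) := by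
  ext x
  have h := congrFun (pd_comm hp 0 1) x
  fin_cases i <;> fin_cases j <;>
  simp [M, moment, Material.constRel, curvature, strain, Matrix.trace, Fin.sum_univ_two,
    Matrix.smul_apply, h] <;> ring

lemma Material.contDiff_M (mat : Material) {p : Plane → ℝ} (hp : ContDiff ℝ ∞ p) (i j : Fin 2) :
    ContDiff ℝ ∞ fun x => mat.M p x i j := by
  rw [mat.M_eq hp]
  have : ∀ i j, ContDiff ℝ ∞ (pd j (pd i p)) := fun i j => contDiff_pd (contDiff_pd hp)
  have h1 := this i j
  have h2 := this 0 0
  have h3 := this 1 1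
  fun_prop

lemma Material.contDiff_Q (mat : Material) {p : Plane → ℝ} (hp : ContDiff ℝ ∞ p) (i : Fin 2) :
    ContDiff ℝ ∞ fun x => mat.Q p x i := by
  unfold Q
  exact ContDiff.sum fun j _ => contDiff_pd (mat.contDiff_M hp i j)

lemma Material.contDiff_Mns (mat : Material) {p : Plane → ℝ} (hp : ContDiff ℝ ∞ p) (n : Plane) :
    ContDiff ℝ ∞ (mat.Mns p n) := by
  unfold Mns
  exact ContDiff.sum fun i _ => ContDiff.sum fun j _ =>
    (contDiff_const.mul (mat.contDiff_M hp i j)).mul contDiff_const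

lemma Material.contDiff_Mnn (mat : Material) {p : Plane → ℝ} (hp : ContDiff ℝ ∞ p) (n : Plane) :
    ContDiff ℝ ∞ (mat.Mnn p n) := by
  unfold Mnn
  exact ContDiff.sum fun i _ => ContDiff.sum fun j _ =>
    (contDiff_const.mul (mat.contDiff_M hp i j)).mul contDiff_const

lemma Material.contDiff_Qn (mat : Material) {p : Plane → ℝ} (hp : ContDiff ℝ ∞ p) (n : Plane) :
    ContDiff ℝ ∞ (mat.Qn p n) := by
  unfold Qn
  exact ContDiff.sum fun i _ => (mat.contDiff_Q hp i).mul contDiff_const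

/-- The shear force is `-D ∇Δp`: the mixed third derivatives in the divergence of the moment tensor
combine to the gradient of the Laplacian. -/
lemma Material.Q_eq (mat : Material) {p : Plane → ℝ} (hp : ContDiff ℝ ∞ p) (i : Fin 2) :
    (fun x => mat.Q p x i) = fun x => -mat.D * pd i (Laplacian.laplacian p) x := by
  have hpp : ∀ i j, Differentiable ℝ (pd j (pd i p)) := fun i j =>
    (contDiff_pd (contDiff_pd hp)).differentiable (by simp)
  have hν1 : (1 + mat.ν) ≠ 0 := by linarith [mat.ν_gt]
  have hν2 : (1 - mat.ν) ≠ 0 := by linarith [mat.ν_lt]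
  have hD : mat.D = mat.d ^ 3 / 12 * (mat.E / (1 + mat.ν)) * (1 + mat.ν / (1 - mat.ν)) := by
    rw [D, show 1 - mat.ν ^ 2 = (1 + mat.ν) * (1 - mat.ν) by ring]
    field_simp
    ring
  have hL : pd i (Laplacian.laplacian p)
      = fun x => pd i (pd 0 (pd 0 p)) x + pd i (pd 1 (pd 1 p)) x := by
    rw [laplacian_eq_pd hp, pd_add (hpp 0 0) (hpp 1 1)]
  have hM : ∀ j, pd j (fun y => mat.M p y i j) = fun x =>
      -(mat.d ^ 3 / 12 * (mat.E / (1 + mat.ν))) * (pd j (pd j (pd i p)) x + mat.ν / (1 - mat.ν) *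
        (if i = j then 1 else 0) * (pd j (pd 0 (pd 0 p)) x + pd j (pd 1 (pd 1 p)) x)) := by
    intro j
    have h0 := hpp i j
    have h1 := hpp 0 0
    have h2 := hpp 1 1
    rw [mat.M_eq hp, pd_const_mul (by fun_prop), pd_add h0 (by fun_prop),
      pd_const_mul (by fun_prop), pd_add h1 h2]
  have c1 : ∀ j, pd j (pd j (pd i p)) = pd i (pd j (pd j p)) := fun j => by
    rw [pd_comm hp j i, pd_comm (contDiff_pd hp) j i]
  ext x
  simp only [Q, hM, hL, c1, hD]
  fin_cases i <;> simp [Fin.sum_univ_two] <;> ring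

/-- The plate operator is the negative divergence of the shear force. -/
lemma Material.plateOp_eq (mat : Material) {p : Plane → ℝ} (hp : ContDiff ℝ ∞ p) (x : Plane) :
    mat.plateOp p x = -∑ i, pd i (fun y => mat.Q p y i) x := by
  have hpp : ∀ i j, ContDiff ℝ ∞ (pd j (pd i p)) := fun i j => contDiff_pd (contDiff_pd hp)
  have hL : ContDiff ℝ ∞ (Laplacian.laplacian p) := by
    rw [laplacian_eq_pd hp]
    exact (hpp 0 0).add (hpp 1 1)
  have : ∀ i, pd i (fun y => mat.Q p y i)
      = fun x => -mat.D * pd i (pd i (Laplacian.laplacian p)) x := fun i => by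
    rw [mat.Q_eq hp, pd_const_mul ((contDiff_pd hL).differentiable (by simp))]
  rw [plateOp, laplacian_eq_pd hL]
  simp only [this, Fin.sum_univ_two]
  ring

lemma Material.contDiff_plateOp (mat : Material) {p : Plane → ℝ} (hp : ContDiff ℝ ∞ p) :
    ContDiff ℝ ∞ (mat.plateOp p) := by
  have : mat.plateOp p = fun x => -∑ i, pd i (fun y => mat.Q p y i) x :=
    funext fun x => mat.plateOp_eq hp x
  rw [this]
  exact (ContDiff.sum fun i _ => contDiff_pd (mat.contDiff_Q hp i)).neg

/-- The curvature enters the energy density through its full Hessian, because the moment tensor is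
symmetric. -/
lemma Material.density_hessian (mat : Material) {p φ : Plane → ℝ} (hp : ContDiff ℝ ∞ p)
    (hφ : ContDiff ℝ ∞ φ) (x : Plane) :
    mat.density (Matrix.of fun i j => pd j (pd i p) x) (Matrix.of fun i j => pd j (pd i φ) x)
      = -∑ i, ∑ j, mat.M p x i j * pd j (pd i φ) x := by
  have h := congrFun (pd_comm hφ 0 1) x
  have h' := congrFun (pd_comm hp 0 1) x
  have hM : mat.M p x 0 1 = mat.M p x 1 0 := by
    have e1 : mat.M p x 0 1 = _ := congrFun (mat.M_eq hp 0 1) x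
    have e2 : mat.M p x 1 0 = _ := congrFun (mat.M_eq hp 1 0) x
    rw [e1, e2, h']
    simp
  change ∑ i, ∑ j, mat.M p x i j * _ = _
  simp only [Fin.sum_univ_two, curvature, strain, hM, Matrix.neg_apply, Matrix.smul_apply,
    Matrix.add_apply, Matrix.transpose_apply, Matrix.of_apply, h, smul_eq_mul]
  ring

/-- Integration by parts on a half plane for the plate bilinear form. -/
theorem Material.setIntegral_halfPlane_density (mat : Material) {p φ : Plane → ℝ}
    (hp : ContDiff ℝ ∞ p) (hφ : ContDiff ℝ ∞ φ) (hc : HasCompactSupport φ) (m n : Plane)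
    (hn : ‖n‖ = 1) :
    ∫ x in halfPlane m n, mat.density (Matrix.of fun i j => pd j (pd i p) x)
        (Matrix.of fun i j => pd j (pd i φ) x)
      = (∫ x in halfPlane m n, mat.plateOp p x * φ x)
        + ∫ s, (mat.Vn p n (line m (tangent n) s) * φ (line m (tangent n) s)
          - mat.Mnn p n (line m (tangent n) s) * fderiv ℝ φ (line m (tangent n) s) n) := by
  have hτ : ‖tangent n‖ = 1 := by rw [norm_tangent, hn]
  set γ := line m (tangent n) with hγ
  have hγi : Isometry γ := isometry_line m hτ
  have hcl : ∀ {F : Plane → ℝ}, Continuous F → HasCompactSupport F →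
      Integrable fun s => F (γ s) := fun hF hFc =>
    (hF.comp hγi.continuous).integrable_of_hasCompactSupport
      (hasCompactSupport_comp_line hFc m hτ)
  have hcH : ∀ {F : Plane → ℝ}, Continuous F → HasCompactSupport F →
      IntegrableOn F (halfPlane m n) := fun hF hFc =>
    (hF.integrable_of_hasCompactSupport hFc).integrableOn
  have hM := mat.contDiff_M hp
  have hQ := mat.contDiff_Q hp
  have hφd := hφ.differentiable (by simp)
  have hpφ : ∀ i, ContDiff ℝ ∞ (pd i φ) := fun i => contDiff_pd hφ
  have hpc : ∀ i, HasCompactSupport (pd i φ) := fun i => hasCompactSupport_pd hc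
  -- the first integration by parts
  have step1 : ∀ i j, ∫ x in halfPlane m n, mat.M p x i j * pd j (pd i φ) x
      = n j * (∫ s, mat.M p (γ s) i j * pd i φ (γ s))
        - ∫ x in halfPlane m n, pd j (fun y => mat.M p y i j) x * pd i φ x := by
    intro i j
    have h := setIntegral_halfPlane_pd (G := fun y => mat.M p y i j * pd i φ y)
      ((hM i j).mul (hpφ i)) (hpc i).mul_left m n hn j
    have e : pd j (fun y => mat.M p y i j * pd i φ y) = fun x =>
        pd j (fun y => mat.M p y i j) x * pd i φ x + mat.M p x i j * pd j (pd i φ) x :=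
      funext fun x => pd_mul ((hM i j).differentiable (by simp) x)
        ((hpφ i).differentiable (by simp) x)
    rw [e, integral_add] at h
    · linarith
    · exact hcH ((contDiff_pd (hM i j)).mul (hpφ i)).continuous (hpc i).mul_left
    · exact hcH ((hM i j).mul (contDiff_pd (hpφ i))).continuous
        (hasCompactSupport_pd (hpc i)).mul_left
  -- the second integration by parts
  have step2 : ∀ i, ∫ x in halfPlane m n, mat.Q p x i * pd i φ x
      = n i * (∫ s, mat.Q p (γ s) i * φ (γ s))
        - ∫ x in halfPlane m n, pd i (fun y => mat.Q p y i) x * φ x := by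
    intro i
    have h := setIntegral_halfPlane_pd (G := fun y => mat.Q p y i * φ y)
      ((hQ i).mul hφ) hc.mul_left m n hn i
    have e : pd i (fun y => mat.Q p y i * φ y) = fun x =>
        pd i (fun y => mat.Q p y i) x * φ x + mat.Q p x i * pd i φ x :=
      funext fun x => pd_mul ((hQ i).differentiable (by simp) x) (hφd x)
    rw [e, integral_add] at h
    · linarith
    · exact hcH ((contDiff_pd (hQ i)).mul hφ).continuous hc.mul_left
    · exact hcH ((hQ i).mul (hpφ i)).continuous (hpc i).mul_left
  have hfd : ∀ v, Continuous fun x => fderiv ℝ φ x v := fun v =>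
    (hφ.continuous_fderiv (by simp)).clm_apply continuous_const
  have hfdc : ∀ v, HasCompactSupport fun x => fderiv ℝ φ x v := fun v =>
    hc.fderiv_apply (𝕜 := ℝ) v
  have hMns := mat.contDiff_Mns hp n
  have hMnsd : Continuous fun x => fderiv ℝ (mat.Mns p n) x (tangent n) :=
    (hMns.continuous_fderiv (by simp)).clm_apply continuous_const
  -- the twisting moment is integrated by parts along the line
  have step3 : ∫ s, mat.Mns p n (γ s) * fderiv ℝ φ (γ s) (tangent n)
      = -∫ s, fderiv ℝ (mat.Mns p n) (γ s) (tangent n) * φ (γ s) :=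
    integral_mul_deriv_eq_deriv_mul_of_integrable
      (fun s _ => hasDerivAt_comp_line (hMns.differentiable (by simp)) m (tangent n) s)
      (fun s _ => hasDerivAt_comp_line hφd m (tangent n) s)
      (hcl (hMns.continuous.mul (hfd _)) (hfdc _).mul_left)
      (hcl (hMnsd.mul hφ.continuous) hc.mul_left)
      (hcl (hMns.continuous.mul hφ.continuous) hc.mul_left)
  have hI : ∀ i j, IntegrableOn (fun x => mat.M p x i j * pd j (pd i φ) x) (halfPlane m n) :=
    fun i j => hcH ((hM i j).mul (contDiff_pd (hpφ i))).continuous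
      (hasCompactSupport_pd (hpc i)).mul_left
  have hsumQ : ∀ i, ∑ j, ∫ x in halfPlane m n, pd j (fun y => mat.M p y i j) x * pd i φ x
      = ∫ x in halfPlane m n, mat.Q p x i * pd i φ x := by
    intro i
    rw [← integral_finsetSum _ fun j _ =>
      hcH ((contDiff_pd (hM i j)).mul (hpφ i)).continuous (hpc i).mul_left]
    simp only [Material.Q, Finset.sum_mul]
  have hsumA : ∑ i, ∫ x in halfPlane m n, pd i (fun y => mat.Q p y i) x * φ x
      = -∫ x in halfPlane m n, mat.plateOp p x * φ x := by
    rw [← integral_finsetSum _ fun i _ =>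
      hcH ((contDiff_pd (hQ i)).mul hφ).continuous hc.mul_left, ← integral_neg]
    simp only [mat.plateOp_eq hp, ← Finset.sum_mul, neg_mul, neg_neg]
  have hb1 : ∑ i, ∑ j, n j * (∫ s, mat.M p (γ s) i j * pd i φ (γ s))
      = (∫ s, mat.Mnn p n (γ s) * fderiv ℝ φ (γ s) n)
        + ∫ s, mat.Mns p n (γ s) * fderiv ℝ φ (γ s) (tangent n) := by
    have hi : ∀ i j, Integrable fun s => n j * (mat.M p (γ s) i j * pd i φ (γ s)) := fun i j =>
      (hcl (F := fun x => mat.M p x i j * pd i φ x) ((hM i j).mul (hpφ i)).continuous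
        (hpc i).mul_left).const_mul _
    simp only [← integral_const_mul]
    rw [← integral_add
      (hcl (F := fun x => mat.Mnn p n x * fderiv ℝ φ x n)
        ((mat.contDiff_Mnn hp n).continuous.mul (hfd _)) (hfdc _).mul_left)
      (hcl (F := fun x => mat.Mns p n x * fderiv ℝ φ x (tangent n))
        (hMns.continuous.mul (hfd _)) (hfdc _).mul_left)]
    rw [Finset.sum_congr rfl fun i _ => (integral_finsetSum _ fun j _ => hi i j).symm,
      ← integral_finsetSum _ fun i _ => integrable_finsetSum _ fun j _ => hi i j]
    congr 1
    ext s
    simp only [pd_eq _ hn, Mnn, Mns, Finset.sum_mul, ← Finset.sum_add_distrib]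
    refine Finset.sum_congr rfl fun i _ => Finset.sum_congr rfl fun j _ => ?_
    ring
  have hb2 : ∑ i, n i * (∫ s, mat.Q p (γ s) i * φ (γ s)) = ∫ s, mat.Qn p n (γ s) * φ (γ s) := by
    simp only [← integral_const_mul]
    rw [← integral_finsetSum _ fun i _ => (hcl (F := fun x => mat.Q p x i * φ x)
      ((hQ i).mul hφ).continuous hc.mul_left).const_mul _]
    congr 1
    ext s
    simp only [Qn, Finset.sum_mul]
    exact Finset.sum_congr rfl fun i _ => by ring
  simp only [mat.density_hessian hp hφ]
  rw [integral_neg, integral_finsetSum _ fun i _ => integrable_finsetSum _ fun j _ => hI i j,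
    Finset.sum_congr rfl fun i _ => integral_finsetSum _ fun j _ => hI i j]
  simp only [step1, Finset.sum_sub_distrib, hsumQ, step2, hb1, hb2, hsumA, step3]
  simp only [Vn, add_mul]
  rw [integral_sub, integral_add]
  · ring
  · exact hcl ((mat.contDiff_Qn hp n).mul hφ).continuous hc.mul_left
  · exact hcl (hMnsd.mul hφ.continuous) hc.mul_left
  · exact (hcl (F := fun x => mat.Qn p n x * φ x) ((mat.contDiff_Qn hp n).mul hφ).continuous
      hc.mul_left).add (hcl (hMnsd.mul hφ.continuous) hc.mul_left)
  · exact hcl ((mat.contDiff_Mnn hp n).continuous.mul (hfd _)) (hfdc _).mul_left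

/-! ### Polynomial functions on the plane -/

/-- Polynomial functions of degree at most `k` on the plane. -/
def IsPoly (k : ℕ) (F : Plane → ℝ) : Prop :=
  ∃ q : MvPolynomial (Fin 2) ℝ, q.totalDegree ≤ k ∧ ∀ x : Plane, F x = q.eval x

lemma IsPoly.mono {k l : ℕ} {F : Plane → ℝ} (h : IsPoly k F) (hkl : k ≤ l) : IsPoly l F :=
  h.imp fun _ hq => ⟨hq.1.trans hkl, hq.2⟩

lemma IsPoly.add {k : ℕ} {F G : Plane → ℝ} (hF : IsPoly k F) (hG : IsPoly k G) :
    IsPoly k fun x => F x + G x := by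
  obtain ⟨p, hp, hp'⟩ := hF
  obtain ⟨q, hq, hq'⟩ := hG
  exact ⟨p + q, (MvPolynomial.totalDegree_add p q).trans (max_le hp hq),
    fun x => by simp [hp', hq']⟩

lemma IsPoly.const_mul {k : ℕ} {F : Plane → ℝ} (hF : IsPoly k F) (c : ℝ) :
    IsPoly k fun x => c * F x := by
  obtain ⟨p, hp, hp'⟩ := hF
  exact ⟨c • p, (MvPolynomial.totalDegree_smul_le c p).trans hp,
    fun x => by simp [hp']⟩

lemma IsPoly.sub {k : ℕ} {F G : Plane → ℝ} (hF : IsPoly k F) (hG : IsPoly k G) :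
    IsPoly k fun x => F x - G x := by
  have := hF.add (hG.const_mul (-1))
  simpa [sub_eq_add_neg] using this

lemma IsPoly.sum {k : ℕ} {ι : Type*} (s : Finset ι) {F : ι → Plane → ℝ}
    (hF : ∀ i ∈ s, IsPoly k (F i)) : IsPoly k fun x => ∑ i ∈ s, F i x := by
  classical
  induction s using Finset.induction_on with
  | empty => exact ⟨0, by simp, by simp⟩
  | insert a s ha ih =>
    simp only [Finset.sum_insert ha]
    exact (hF a (Finset.mem_insert_self a s)).add
      (ih fun i hi => hF i (Finset.mem_insert_of_mem hi))

lemma hasFDerivAt_eval (q : MvPolynomial (Fin 2) ℝ) (x : Plane) :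
    HasFDerivAt (fun x : Plane => q.eval x)
      (∑ i, (MvPolynomial.pderiv i q).eval x • (EuclideanSpace.proj i : Plane →L[ℝ] ℝ)) x := by
  induction q using MvPolynomial.induction_on with
  | C a => simpa using hasFDerivAt_const a x
  | add p q hp hq =>
    simp only [map_add, add_smul, Finset.sum_add_distrib]
    exact hp.add hq
  | mul_X p j hp =>
    have h2 : HasFDerivAt (fun x : Plane => x j) (EuclideanSpace.proj j : Plane →L[ℝ] ℝ) x :=
      (EuclideanSpace.proj j : Plane →L[ℝ] ℝ).hasFDerivAt
    have h := hp.mul h2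
    simp only [map_mul, MvPolynomial.eval_X]
    refine h.congr_fderiv ?_
    ext v
    simp [MvPolynomial.pderiv_X, Fin.sum_univ_two]
    fin_cases j <;> simp <;> ring

lemma totalDegree_pderiv_le (q : MvPolynomial (Fin 2) ℝ) (i : Fin 2) :
    (MvPolynomial.pderiv i q).totalDegree ≤ q.totalDegree := by
  classical
  conv_lhs => rw [q.as_sum, map_sum]
  refine MvPolynomial.totalDegree_finsetSum_le fun d hd => ?_
  rw [MvPolynomial.pderiv_monomial]
  refine (MvPolynomial.totalDegree_monomial_le _ _).trans ?_
  refine le_trans ?_ (MvPolynomial.le_totalDegree hd)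
  have : d - Finsupp.single i 1 ≤ d := tsub_le_self
  rw [Finsupp.sum_fintype _ _ (by simp), Finsupp.sum_fintype _ _ (by simp)]
  exact Finset.sum_le_sum fun j _ => this j

lemma IsPoly.pd {k : ℕ} {F : Plane → ℝ} (hF : IsPoly k F) (i : Fin 2) :
    IsPoly k (pd i F) := by
  obtain ⟨q, hq, hq'⟩ := hF
  obtain rfl : F = fun x : Plane => q.eval x := funext hq'
  refine ⟨MvPolynomial.pderiv i q, (totalDegree_pderiv_le q i).trans hq, fun x => ?_⟩
  rw [Kirchhoff.pd, (hasFDerivAt_eval q x).fderiv]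
  fin_cases i <;> simp [Fin.sum_univ_two]

lemma contDiff_eval (q : MvPolynomial (Fin 2) ℝ) :
    ContDiff ℝ ∞ fun x : Plane => q.eval x := by
  induction q using MvPolynomial.induction_on with
  | C a => simpa using contDiff_const
  | add p q hp hq => simpa using hp.add hq
  | mul_X p j hp =>
    have h2 : ContDiff ℝ ∞ (fun x : Plane => x j) :=
      (EuclideanSpace.proj j : Plane →L[ℝ] ℝ).contDiff
    simpa using hp.mul h2

lemma IsPoly.contDiff {k : ℕ} {F : Plane → ℝ} (hF : IsPoly k F) : ContDiff ℝ ∞ F := by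
  obtain ⟨q, -, hq'⟩ := hF
  obtain rfl : F = fun x : Plane => q.eval x := funext hq'
  exact contDiff_eval q

/-- Expansion of a polynomial in monomials of degree at most `N` in each variable. -/
lemma IsPoly.exists_coeff {k N : ℕ} (hkN : k ≤ N) {F : Plane → ℝ} (hF : IsPoly k F) :
    ∃ v : Fin (N + 1) × Fin (N + 1) → ℝ, ∀ y : Plane,
      F y = ∑ a, v a * (y 0 ^ (a.1 : ℕ) * y 1 ^ (a.2 : ℕ)) := by
  classical
  obtain ⟨q, hq, hq'⟩ := hF
  have hd : ∀ d ∈ q.support, ∀ i, d i ≤ N := fun d hd i => by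
    have h1 := MvPolynomial.le_totalDegree hd
    simp only [Finsupp.sum_fintype, Fin.sum_univ_two, implies_true] at h1
    fin_cases i <;> simp <;> omega
  let e : Fin (N + 1) × Fin (N + 1) → (Fin 2 →₀ ℕ) := fun a =>
    Finsupp.equivFunOnFinite.symm ![a.1, a.2]
  have he : Function.Injective e := by
    intro a b hab
    have := Finsupp.equivFunOnFinite.symm.injective hab
    have h0 := congrFun this 0
    have h1 := congrFun this 1
    simp only [Matrix.cons_val_zero, Matrix.cons_val_one] at h0 h1
    exact Prod.ext (Fin.ext h0) (Fin.ext h1)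
  refine ⟨fun a => q.coeff (e a), fun y => ?_⟩
  rw [hq', MvPolynomial.eval_eq']
  have hsub : q.support ⊆ Finset.univ.image e := by
    intro d hdq
    refine Finset.mem_image.mpr ⟨(⟨d 0, by have := hd d hdq 0; omega⟩,
      ⟨d 1, by have := hd d hdq 1; omega⟩), Finset.mem_univ _, ?_⟩
    ext i
    fin_cases i <;> simp [e]
  rw [Finset.sum_subset hsub fun d _ hd => by
    rw [MvPolynomial.notMem_support_iff.mp hd, zero_mul], Finset.sum_image he.injOn]
  simp [e, Fin.prod_univ_two]

/-- Affine changes of variables do not raise the degree. -/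
lemma IsPoly.comp_affine {k : ℕ} {F : Plane → ℝ} (hF : IsPoly k F) {σ : Plane → Plane}
    (hσ : ∀ i, IsPoly 1 fun y => σ y i) : IsPoly k fun y => F (σ y) := by
  classical
  obtain ⟨q, hq, hq'⟩ := hF
  choose l hl hl' using hσ
  refine ⟨MvPolynomial.bind₁ l q, ?_, fun y => ?_⟩
  · conv_lhs => rw [q.as_sum, map_sum]
    refine MvPolynomial.totalDegree_finsetSum_le fun d hd => ?_
    rw [MvPolynomial.bind₁_monomial]
    refine (MvPolynomial.totalDegree_mul _ _).trans ?_
    rw [MvPolynomial.totalDegree_C, zero_add]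
    refine (MvPolynomial.totalDegree_finsetProd _ _).trans ?_
    refine le_trans ?_ ((MvPolynomial.le_totalDegree hd).trans hq)
    refine Finset.sum_le_sum fun i _ => (MvPolynomial.totalDegree_pow _ _).trans ?_
    exact (Nat.mul_le_mul_left _ (hl i)).trans (by simp)
  · have key : ∀ q : MvPolynomial (Fin 2) ℝ, (MvPolynomial.bind₁ l q).eval y
        = q.eval fun i => (l i).eval y := fun q => by
      induction q using MvPolynomial.induction_on <;> simp_all
    simp only
    rw [hq', key]
    congr 2
    ext i
    exact hl' i y

lemma Material.isPoly_M (mat : Material) {k : ℕ} {p : Plane → ℝ} (hp : IsPoly k p)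
    (i j : Fin 2) : IsPoly k fun x => mat.M p x i j := by
  rw [mat.M_eq hp.contDiff]
  exact ((hp.pd i).pd j |>.add
    ((((hp.pd 0).pd 0).add ((hp.pd 1).pd 1)).const_mul _)).const_mul _

lemma Material.isPoly_Mnn (mat : Material) {k : ℕ} {p : Plane → ℝ} (hp : IsPoly k p)
    (n : Plane) : IsPoly k (mat.Mnn p n) := by
  refine IsPoly.sum _ fun i _ => IsPoly.sum _ fun j _ => ?_
  have := (mat.isPoly_M hp i j).const_mul (n i * n j)
  convert this using 2
  ring

lemma Material.isPoly_Mns (mat : Material) {k : ℕ} {p : Plane → ℝ} (hp : IsPoly k p)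
    (n : Plane) : IsPoly k (mat.Mns p n) := by
  refine IsPoly.sum _ fun i _ => IsPoly.sum _ fun j _ => ?_
  have := (mat.isPoly_M hp i j).const_mul (tangent n i * n j)
  convert this using 2
  ring

lemma Material.isPoly_Q (mat : Material) {k : ℕ} {p : Plane → ℝ} (hp : IsPoly k p)
    (i : Fin 2) : IsPoly k fun x => mat.Q p x i :=
  IsPoly.sum _ fun j _ => (mat.isPoly_M hp i j).pd j

lemma fderiv_eq_sum_pd (F : Plane → ℝ) (x v : Plane) :
    fderiv ℝ F x v = ∑ i, v i * pd i F x := by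
  have hv : v = ∑ i, v i • (EuclideanSpace.single i 1 : Plane) := by
    ext j
    fin_cases j <;> simp [Fin.sum_univ_two]
  conv_lhs => rw [hv]
  simp [pd]

lemma Material.isPoly_Vn (mat : Material) {k : ℕ} {p : Plane → ℝ} (hp : IsPoly k p)
    (n : Plane) : IsPoly k (mat.Vn p n) := by
  refine IsPoly.add (IsPoly.sum _ fun i _ => ?_) ?_
  · have := (mat.isPoly_Q hp i).const_mul (n i)
    convert this using 2
    ring
  · simp only [fderiv_eq_sum_pd]
    exact IsPoly.sum _ fun i _ => ((mat.isPoly_Mns hp n).pd i).const_mul _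

lemma Material.isPoly_plateOp (mat : Material) {k : ℕ} {p : Plane → ℝ} (hp : IsPoly k p) :
    IsPoly k (mat.plateOp p) := by
  have : mat.plateOp p = fun x => -1 * ∑ i, Kirchhoff.pd i (fun y => mat.Q p y i) x :=
    funext fun x => by rw [mat.plateOp_eq hp.contDiff x]; ring
  rw [this]
  exact (IsPoly.sum _ fun i _ => (mat.isPoly_Q hp i).pd i).const_mul _

/-! ### Equivalence of norms on spaces of polynomials -/

/-- A weighted `L²` norm is bounded below by the coefficients with respect to a family of functions,
provided that it vanishes only for the zero combination. -/
lemma exists_coercive {X ι : Type*} [MeasurableSpace X] [Fintype ι] (μ : Measure X)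
    (b : X → ℝ) (e : ι → X → ℝ) (hb : ∀ x, 0 ≤ b x)
    (hI : ∀ i j, Integrable (fun x => b x * (e i x * e j x)) μ)
    (h0 : ∀ v : ι → ℝ, ∫ x, b x * (∑ i, v i * e i x) ^ 2 ∂μ = 0 → v = 0) :
    ∃ c > 0, ∀ v : ι → ℝ, c * (∑ i, |v i|) ^ 2 ≤ ∫ x, b x * (∑ i, v i * e i x) ^ 2 ∂μ := by
  set Q : (ι → ℝ) → ℝ := fun v => ∫ x, b x * (∑ i, v i * e i x) ^ 2 ∂μ with hQ
  have hQe : ∀ v, Q v = ∑ i, ∑ j, v i * v j * ∫ x, b x * (e i x * e j x) ∂μ := by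
    intro v
    have : ∀ x, b x * (∑ i, v i * e i x) ^ 2
        = ∑ i, ∑ j, v i * v j * (b x * (e i x * e j x)) := by
      intro x
      rw [sq, Finset.sum_mul_sum, Finset.mul_sum]
      refine Finset.sum_congr rfl fun i _ => ?_
      rw [Finset.mul_sum]
      exact Finset.sum_congr rfl fun j _ => by ring
    simp only [hQ, this]
    rw [integral_finsetSum _ fun i _ => integrable_finsetSum _ fun j _ => (hI i j).const_mul _]
    refine Finset.sum_congr rfl fun i _ => ?_
    rw [integral_finsetSum _ fun j _ => (hI i j).const_mul _]
    exact Finset.sum_congr rfl fun j _ => integral_const_mul _ _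
  have hQc : Continuous Q := by
    rw [funext hQe]
    fun_prop
  have hQn : ∀ v, 0 ≤ Q v := fun v => integral_nonneg fun x =>
    mul_nonneg (hb x) (sq_nonneg _)
  set S : Set (ι → ℝ) := {v | ∑ i, |v i| = 1} with hS
  have hSc : IsCompact S := by
    refine Metric.isCompact_of_isClosed_isBounded
      (isClosed_eq (by fun_prop) continuous_const) ?_
    refine (Metric.isBounded_closedBall (x := (0 : ι → ℝ)) (r := 1)).subset fun v hv => ?_
    rw [mem_closedBall_zero_iff, pi_norm_le_iff_of_nonneg zero_le_one]
    intro i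
    refine le_trans ?_ (show ∑ i, |v i| = 1 from hv).le
    exact Finset.single_le_sum (f := fun i => |v i|) (fun _ _ => abs_nonneg _) (Finset.mem_univ i)
  have hc : ∃ c > 0, ∀ v ∈ S, c ≤ Q v := by
    rcases S.eq_empty_or_nonempty with h | h
    · exact ⟨1, one_pos, by simp [h]⟩
    · obtain ⟨v, hv, hmin⟩ := hSc.exists_isMinOn h hQc.continuousOn
      refine ⟨Q v, lt_of_le_of_ne (hQn v) fun h => ?_, fun w hw => hmin hw⟩
      have := h0 v h.symm
      rw [hS, Set.mem_ofPred_eq, this] at hv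
      simp at hv
  obtain ⟨c, hc0, hc⟩ := hc
  refine ⟨c, hc0, fun v => ?_⟩
  by_cases hv : ∑ i, |v i| = 0
  · rw [hv]
    simpa using hQn v
  · set t := ∑ i, |v i| with ht
    have ht0 : 0 < t := lt_of_le_of_ne (Finset.sum_nonneg fun _ _ => abs_nonneg _) (Ne.symm hv)
    have h1 := hc (fun i => t⁻¹ * v i) (by
      simp only [hS, Set.mem_ofPred_eq, abs_mul, ← Finset.mul_sum, ← ht]
      rw [abs_of_pos (inv_pos.mpr ht0), inv_mul_cancel₀ hv])
    have h2 : Q (fun i => t⁻¹ * v i) = t⁻¹ ^ 2 * Q v := by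
      simp only [hQ, mul_assoc, ← Finset.mul_sum, mul_pow]
      rw [← integral_const_mul]
      refine integral_congr_ae (Eventually.of_forall fun x => ?_)
      simp only
      ring
    rw [h2] at h1
    calc c * t ^ 2 ≤ (t⁻¹ ^ 2 * Q v) * t ^ 2 := mul_le_mul_of_nonneg_right h1 (sq_nonneg _)
      _ = Q v := by field_simp

/-- A fixed smooth bump function on the line, equal to `1` near `0` and supported in
`[-1/2, 1/2]`. -/
def bump : ContDiffBump (0 : ℝ) := ⟨1 / 4, 1 / 2, by norm_num, by norm_num⟩

lemma bump_pos {t : ℝ} (ht : |t| < 1 / 2) : 0 < bump t :=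
  bump.pos_of_mem_ball (by simpa [bump] using ht)

lemma bump_eq_zero {t : ℝ} (ht : 1 / 2 ≤ |t|) : bump t = 0 :=
  bump.zero_of_le_dist (by simpa [bump] using ht)

lemma bump_zero : bump 0 = 1 := bump.one_of_mem_closedBall (by simp [bump])

lemma deriv_bump_zero : deriv bump 0 = 0 := by
  have : (bump : ℝ → ℝ) =ᶠ[𝓝 0] fun _ => 1 := bump.eventuallyEq_one
  rw [this.deriv_eq]
  simp

lemma sum_pow_eq_zero {N : ℕ} {v : Fin (N + 1) → ℝ}
    (h : ∀ s : ℝ, |s| < 1 / 2 → ∑ b, v b * s ^ (b : ℕ) = 0) : v = 0 := by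
  set p : Polynomial ℝ := ∑ b, Polynomial.C (v b) * Polynomial.X ^ (b : ℕ) with hp
  have hp0 : p = 0 := by
    refine Polynomial.eq_zero_of_infinite_isRoot p
      (Set.Infinite.mono (s := Set.Ioo (0 : ℝ) (1 / 2)) ?_ (Set.Ioo_infinite (by norm_num)))
    intro s hs
    have := h s (by rw [abs_of_pos hs.1]; exact hs.2)
    simpa [hp, Polynomial.eval_finsetSum, Polynomial.IsRoot] using this
  ext b
  have := congrArg (fun q => Polynomial.coeff q b) hp0
  simpa [hp, Polynomial.finsetSum_coeff, Polynomial.coeff_C_mul, Polynomial.coeff_X_pow,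
    ← Fin.ext_iff] using this

lemma eq_zero_of_integral_eq_zero {X : Type*} [TopologicalSpace X] [MeasurableSpace X]
    [OpensMeasurableSpace X] {μ : Measure X} [μ.IsOpenPosMeasure] {F : X → ℝ}
    (hF : Continuous F) (h0 : ∀ x, 0 ≤ F x) (hi : Integrable F μ) (h : ∫ x, F x ∂μ = 0) (x : X) :
    F x = 0 := by
  have := (integral_eq_zero_iff_of_nonneg h0 hi).mp h
  exact congrFun ((Continuous.ae_eq_iff_eq μ hF continuous_zero).mp this) x

lemma exists_coercive_line (N : ℕ) : ∃ c > 0, ∀ v : Fin (N + 1) → ℝ,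
    c * (∑ b, |v b|) ^ 2 ≤ ∫ s, bump s * (∑ b, v b * s ^ (b : ℕ)) ^ 2 := by
  have hc : ∀ {G : ℝ → ℝ}, Continuous G → Integrable fun s => bump s * G s := fun hG =>
    (bump.continuous.mul hG).integrable_of_hasCompactSupport bump.hasCompactSupport.mul_right
  refine exists_coercive volume _ (fun (b : Fin (N + 1)) s => s ^ (b : ℕ))
    (fun s => bump.nonneg) (fun i j => hc (by fun_prop)) fun v hv => ?_
  refine sum_pow_eq_zero fun s hs => ?_
  have := eq_zero_of_integral_eq_zero (bump.continuous.mul (by fun_prop))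
    (fun s => mul_nonneg bump.nonneg (sq_nonneg _)) (hc (by fun_prop)) hv s
  simpa [(bump_pos hs).ne'] using this

/-- The product bump function on the reference plane. -/
def bump₂ (y : Plane) : ℝ := bump (y 0) * bump (y 1)

lemma bump₂_nonneg (y : Plane) : 0 ≤ bump₂ y := mul_nonneg bump.nonneg bump.nonneg

lemma contDiff_bump₂ : ContDiff ℝ ∞ bump₂ := by
  have h : ∀ i : Fin 2, ContDiff ℝ ∞ fun y : Plane => bump (y i) := fun i =>
    bump.contDiff.comp (EuclideanSpace.proj i : Plane →L[ℝ] ℝ).contDiff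
  exact (h 0).mul (h 1)

lemma norm_sq_plane (y : Plane) : ‖y‖ ^ 2 = y 0 ^ 2 + y 1 ^ 2 := by
  simp [EuclideanSpace.norm_sq_eq, Fin.sum_univ_two]

lemma tsupport_bump₂ : tsupport bump₂ ⊆ Metric.closedBall 0 (3 / 4) := by
  refine closure_minimal (fun y hy => ?_) Metric.isClosed_closedBall
  have h : ∀ i, |y i| < 1 / 2 := by
    intro i
    by_contra h
    have := bump_eq_zero (not_lt.mp h)
    fin_cases i <;> simp_all [bump₂]
  rw [mem_closedBall_zero_iff]
  have h0 := abs_lt.mp (h 0)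
  have h1 := abs_lt.mp (h 1)
  have := norm_sq_plane y
  nlinarith [norm_nonneg y]

lemma hasCompactSupport_bump₂ : HasCompactSupport bump₂ :=
  (isCompact_closedBall _ _).of_isClosed_subset (isClosed_tsupport _) tsupport_bump₂

/-- The monomials on the reference plane. -/
def monom (a b : ℕ) (y : Plane) : ℝ := y 0 ^ a * y 1 ^ b

lemma contDiff_monom (a b : ℕ) : ContDiff ℝ ∞ (monom a b) := by
  have h : ∀ i : Fin 2, ContDiff ℝ ∞ fun y : Plane => y i := fun i =>
    (EuclideanSpace.proj i : Plane →L[ℝ] ℝ).contDiff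
  exact ((h 0).pow a).mul ((h 1).pow b)

lemma exists_coercive_plane (N : ℕ) : ∃ c > 0, ∀ v : Fin (N + 1) × Fin (N + 1) → ℝ,
    c * (∑ a, |v a|) ^ 2 ≤ ∫ y, bump₂ y * (∑ a, v a * monom a.1 a.2 y) ^ 2 := by
  have hm : ∀ a b, Continuous (monom a b) := fun a b => (contDiff_monom a b).continuous
  have hb := contDiff_bump₂.continuous
  have hc : ∀ {G : Plane → ℝ}, Continuous G → Integrable fun s => bump₂ s * G s := fun hG =>
    (hb.mul hG).integrable_of_hasCompactSupport hasCompactSupport_bump₂.mul_right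
  refine exists_coercive volume _ (fun (a : Fin (N + 1) × Fin (N + 1)) => monom a.1 a.2)
    bump₂_nonneg (fun i j => hc (by fun_prop)) fun v hv => ?_
  have h0 : ∀ t s : ℝ, |t| < 1 / 2 → |s| < 1 / 2 →
      ∑ a : Fin (N + 1), (∑ b : Fin (N + 1), v (a, b) * s ^ (b : ℕ)) * t ^ (a : ℕ) = 0 := by
    intro t s ht hs
    have := eq_zero_of_integral_eq_zero (hb.mul (by fun_prop))
      (fun s => mul_nonneg (bump₂_nonneg s) (sq_nonneg _)) (hc (by fun_prop)) hv !₂[t, s]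
    have hpos : bump₂ !₂[t, s] ≠ 0 := by
      simpa [bump₂] using ⟨(bump_pos ht).ne', (bump_pos hs).ne'⟩
    have h2 := pow_eq_zero_iff (two_ne_zero) |>.mp ((mul_eq_zero.mp this).resolve_left hpos)
    rw [Fintype.sum_prod_type] at h2
    rw [← h2]
    refine Finset.sum_congr rfl fun a _ => ?_
    rw [Finset.sum_mul]
    refine Finset.sum_congr rfl fun b _ => ?_
    simp [monom]
    ring
  have h1 : ∀ s : ℝ, |s| < 1 / 2 → ∀ a, ∑ b : Fin (N + 1), v (a, b) * s ^ (b : ℕ) = 0 :=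
    fun s hs a => congrFun (sum_pow_eq_zero
      (v := fun a => ∑ b : Fin (N + 1), v (a, b) * s ^ (b : ℕ)) fun t ht => h0 t s ht hs) a
  ext ⟨a, b⟩
  exact congrFun (sum_pow_eq_zero (v := fun b => v (a, b)) fun s hs => h1 s hs a) b

/-- The reference bubble functions. -/
def bubble (a b : ℕ) (y : Plane) : ℝ := bump₂ y * monom a b y

lemma contDiff_bubble (a b : ℕ) : ContDiff ℝ ∞ (bubble a b) :=
  contDiff_bump₂.mul (contDiff_monom a b)

lemma tsupport_bubble (a b : ℕ) : tsupport (bubble a b) ⊆ Metric.closedBall 0 (3 / 4) :=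
  (tsupport_mul_subset_left (f := bump₂) (g := monom a b)).trans tsupport_bump₂

/-- The reference bubble functions of bounded degree and their second derivatives have a common
bound. -/
lemma exists_bubble_bound (N : ℕ) : ∃ W > 0, ∀ a ≤ N, ∀ b ≤ N, ∀ y,
    |bubble a b y| ≤ W ∧ ∀ i j, |pd j (pd i (bubble a b)) y| ≤ W := by
  have hbd : ∀ {G : Plane → ℝ}, Continuous G → HasCompactSupport G →
      ∃ C, 0 ≤ C ∧ ∀ y, |G y| ≤ C := fun {G} hG hc => by
    obtain ⟨C, hC⟩ := hG.bounded_above_of_compact_support hc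
    exact ⟨C, (norm_nonneg _).trans (hC 0), hC⟩
  have hbc : ∀ a b, HasCompactSupport (bubble a b) := fun a b =>
    (isCompact_closedBall _ _).of_isClosed_subset (isClosed_tsupport _) (tsupport_bubble a b)
  have h1 : ∀ a b, ∃ C, 0 ≤ C ∧ ∀ y, |bubble a b y| ≤ C := fun a b =>
    hbd (contDiff_bubble a b).continuous (hbc a b)
  have h2 : ∀ a b i j, ∃ C, 0 ≤ C ∧ ∀ y, |pd j (pd i (bubble a b)) y| ≤ C := fun a b i j =>
    hbd (contDiff_pd (contDiff_pd (contDiff_bubble a b))).continuous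
      (hasCompactSupport_pd (hasCompactSupport_pd (hbc a b)))
  choose C₁ hC₁ hC₁' using h1
  choose C₂ hC₂ hC₂' using h2
  have hR : ∀ {a b}, a ≤ N → b ≤ N → ∀ {f : ℕ → ℕ → ℝ}, (∀ a b, 0 ≤ f a b) →
      f a b ≤ ∑ a ∈ Finset.range (N + 1), ∑ b ∈ Finset.range (N + 1), f a b := by
    intro a b ha hb f hf
    refine (Finset.single_le_sum (f := fun b => f a b) (fun b _ => hf a b)
      (Finset.mem_range.mpr (Nat.lt_succ_of_le hb))).trans ?_
    exact Finset.single_le_sum (f := fun a => ∑ b ∈ Finset.range (N + 1), f a b)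
      (fun a _ => Finset.sum_nonneg fun b _ => hf a b)
      (Finset.mem_range.mpr (Nat.lt_succ_of_le ha))
  set f : ℕ → ℕ → ℝ := fun a b => C₁ a b + ∑ i, ∑ j, C₂ a b i j with hf
  have hs : ∀ a b, 0 ≤ ∑ i, ∑ j, C₂ a b i j := fun a b =>
    Finset.sum_nonneg fun i _ => Finset.sum_nonneg fun j _ => hC₂ a b i j
  have hf0 : ∀ a b, 0 ≤ f a b := fun a b => add_nonneg (hC₁ a b) (hs a b)
  refine ⟨1 + ∑ a ∈ Finset.range (N + 1), ∑ b ∈ Finset.range (N + 1), f a b,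
    add_pos_of_pos_of_nonneg one_pos (Finset.sum_nonneg fun _ _ => Finset.sum_nonneg
      fun _ _ => hf0 _ _), fun a ha b hb y => ⟨?_, fun i j => ?_⟩⟩
  · linarith [hC₁' a b y, hR ha hb hf0, hs a b]
  · have h3 : C₂ a b i j ≤ ∑ i, ∑ j, C₂ a b i j :=
      (Finset.single_le_sum (f := fun j => C₂ a b i j) (fun j _ => hC₂ a b i j)
        (Finset.mem_univ j)).trans (Finset.single_le_sum (f := fun i => ∑ j, C₂ a b i j)
          (fun i _ => Finset.sum_nonneg fun j _ => hC₂ a b i j) (Finset.mem_univ i))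
    linarith [hC₂' a b i j y, hR ha hb hf0, hC₁ a b]

/-! ### Scaling from a reference plane -/

/-- The affine similarity that maps the reference plane to the frame with origin `c`, axes `n` and
`tangent n`, and unit of length `r`. -/
def fromRef (c n : Plane) (r : ℝ) (y : Plane) : Plane := c + r • (y 0 • n + y 1 • tangent n)

/-- The inverse of `fromRef`. -/
def toRef (c n : Plane) (r : ℝ) (x : Plane) : Plane :=
  r⁻¹ • !₂[⟪n, x - c⟫, ⟪tangent n, x - c⟫]

lemma toRef_eq (c n : Plane) (hn : ‖n‖ = 1) (r : ℝ) (x : Plane) :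
    toRef c n r x = r⁻¹ • (normalBasis n hn).repr (x - c) := by
  obtain ⟨h0, h1⟩ := normalBasis_repr n hn (x - c)
  rw [toRef]
  congr 1
  ext i
  fin_cases i
  exacts [h0.symm, h1.symm]

lemma fromRef_eq (c n : Plane) (hn : ‖n‖ = 1) (r : ℝ) (y : Plane) :
    fromRef c n r y = c + r • (normalBasis n hn).repr.symm y := by
  rw [normalBasis_repr_symm, fromRef]

lemma toRef_fromRef (c n : Plane) (hn : ‖n‖ = 1) {r : ℝ} (hr : 0 < r) (y : Plane) :
    toRef c n r (fromRef c n r y) = y := by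
  rw [toRef_eq c n hn, fromRef_eq c n hn]
  simp [smul_smul, hr.ne']

lemma fromRef_toRef (c n : Plane) (hn : ‖n‖ = 1) {r : ℝ} (hr : 0 < r) (x : Plane) :
    fromRef c n r (toRef c n r x) = x := by
  rw [toRef_eq c n hn, fromRef_eq c n hn]
  simp [smul_smul, hr.ne']

lemma norm_toRef (c n : Plane) (hn : ‖n‖ = 1) {r : ℝ} (hr : 0 < r) (x : Plane) :
    ‖toRef c n r x‖ = r⁻¹ * dist x c := by
  rw [toRef_eq c n hn, norm_smul, LinearIsometryEquiv.norm_map, dist_eq_norm, norm_inv,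
    Real.norm_eq_abs, abs_of_pos hr]

lemma fromRef_line (c n : Plane) (r s : ℝ) :
    fromRef c n r !₂[0, s] = line c (tangent n) (r * s) := by
  simp [fromRef, line, smul_smul]

lemma isPoly_const (c : ℝ) : IsPoly 0 fun _ => c := ⟨MvPolynomial.C c, by simp, by simp⟩

lemma isPoly_coord (i : Fin 2) : IsPoly 1 fun y => y i :=
  ⟨MvPolynomial.X i, by simp, by simp⟩

lemma isPoly_fromRef {k : ℕ} {F : Plane → ℝ} (hF : IsPoly k F) (c n : Plane) (r : ℝ) :
    IsPoly k fun y => F (fromRef c n r y) := by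
  refine hF.comp_affine fun i => ?_
  have := ((isPoly_const (c i)).mono zero_le_one).add
    (((isPoly_coord 0).const_mul (r * n i)).add ((isPoly_coord 1).const_mul (r * tangent n i)))
  convert this using 2
  simp [fromRef]
  ring

lemma integral_fromRef (c n : Plane) (hn : ‖n‖ = 1) {r : ℝ} (hr : 0 < r) (F : Plane → ℝ) :
    ∫ x, F x = r ^ 2 * ∫ y, F (fromRef c n r y) := by
  have h1 : ∫ y, F (fromRef c n r y) = ∫ y, F (c + r • y) := by
    have := ((normalBasis n hn).measurePreserving_repr_symm).integral_comp
      (normalBasis n hn).repr.symm.toHomeomorph.measurableEmbedding (fun y => F (c + r • y))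
    rw [← this]
    simp only [fromRef_eq c n hn]
  have h2 := Measure.integral_comp_smul (volume : Measure Plane) (fun y => F (c + y)) r
  rw [h1, h2, integral_add_left_eq_self (fun y => F y) c]
  simp only [finrank_euclideanSpace, Fintype.card_fin, smul_eq_mul]
  rw [abs_of_pos (by positivity)]
  field_simp

lemma integral_line_scale (c n : Plane) {r : ℝ} (hr : 0 < r) (F : Plane → ℝ) :
    ∫ s, F (line c (tangent n) s) = r * ∫ s, F (fromRef c n r !₂[0, s]) := by
  simp only [fromRef_line]
  rw [Measure.integral_comp_mul_left (fun s => F (line c (tangent n) s)) r]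
  simp only [smul_eq_mul]
  rw [abs_of_pos (by positivity)]
  field_simp

lemma hasFDerivAt_comp_toRef {g : Plane → ℝ} (hg : Differentiable ℝ g) (c n : Plane)
    (hn : ‖n‖ = 1) (r : ℝ) (x v : Plane) :
    DifferentiableAt ℝ (fun x => g (toRef c n r x)) x ∧
    fderiv ℝ (fun x => g (toRef c n r x)) x v
      = r⁻¹ * ∑ k, (normalBasis n hn).repr v k * pd k g (toRef c n r x) := by
  have h1 : HasFDerivAt (toRef c n r)
      (r⁻¹ • ((normalBasis n hn).repr.toContinuousLinearEquiv : Plane →L[ℝ] Plane)) x := by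
    rw [funext (toRef_eq c n hn r)]
    have h2 : HasFDerivAt (fun x => (normalBasis n hn).repr (x - c))
        ((normalBasis n hn).repr.toContinuousLinearEquiv : Plane →L[ℝ] Plane) x := by
      have := ((normalBasis n hn).repr.toContinuousLinearEquiv : Plane →L[ℝ] Plane).hasFDerivAt
        (x := x - c)
      exact this.comp x ((hasFDerivAt_id x).sub_const c)
    exact h2.const_smul r⁻¹
  have h3 := (hg (toRef c n r x)).hasFDerivAt.comp x h1
  refine ⟨h3.differentiableAt, ?_⟩
  change fderiv ℝ (g ∘ toRef c n r) x v = _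
  rw [h3.fderiv]
  simp only [ContinuousLinearMap.comp_apply, smul_apply, map_smul, smul_eq_mul]
  congr 1
  exact fderiv_eq_sum_pd g _ _

lemma contDiff_comp_toRef {g : Plane → ℝ} (hg : ContDiff ℝ ∞ g) (c n : Plane) (r : ℝ) :
    ContDiff ℝ ∞ fun x => g (toRef c n r x) := by
  refine hg.comp ?_
  have h : toRef c n r = fun x => r⁻¹ • (⟪n, x - c⟫ • (EuclideanSpace.single 0 1 : Plane)
      + ⟪tangent n, x - c⟫ • (EuclideanSpace.single 1 1 : Plane)) := by
    ext x i
    fin_cases i <;> simp [toRef]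
  have hi : ∀ v : Plane, ContDiff ℝ ∞ fun x => ⟪v, x - c⟫ := fun v =>
    contDiff_const.inner ℝ (contDiff_id.sub contDiff_const)
  rw [h]
  have h0 := hi n
  have h1 := hi (tangent n)
  fun_prop

lemma tsupport_comp_toRef {g : Plane → ℝ} (hg : tsupport g ⊆ Metric.closedBall 0 (3 / 4))
    (c n : Plane) (hn : ‖n‖ = 1) {r : ℝ} (hr : 0 < r) :
    tsupport (fun x => g (toRef c n r x)) ⊆ Metric.closedBall c (3 / 4 * r) := by
  refine closure_minimal (fun x hx => ?_) Metric.isClosed_closedBall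
  have := hg (subset_tsupport _ (show toRef c n r x ∈ Function.support g from hx))
  rw [mem_closedBall_zero_iff, norm_toRef c n hn hr] at this
  rw [Metric.mem_closedBall]
  calc dist x c = r * (r⁻¹ * dist x c) := by field_simp
    _ ≤ r * (3 / 4) := mul_le_mul_of_nonneg_left this hr.le
    _ = _ := by ring

lemma abs_repr_single_le (n : Plane) (hn : ‖n‖ = 1) (i k : Fin 2) :
    |(normalBasis n hn).repr (EuclideanSpace.single i 1) k| ≤ 1 := by
  refine (PiLp.norm_apply_le ((normalBasis n hn).repr (EuclideanSpace.single i 1)) k).trans ?_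
  simp

/-- Second derivatives scale like the inverse square of the radius. -/
lemma abs_pd_pd_comp_toRef_le {g : Plane → ℝ} (hg : ContDiff ℝ ∞ g) (c n : Plane) (hn : ‖n‖ = 1)
    {r W : ℝ} (hr : 0 < r) (hW : ∀ y i j, |pd j (pd i g) y| ≤ W) (x : Plane) (i j : Fin 2) :
    |pd j (pd i fun x => g (toRef c n r x)) x| ≤ 4 * W / r ^ 2 := by
  set R := (normalBasis n hn).repr with hR
  have hd : ∀ k, Differentiable ℝ (pd k g) := fun k => (contDiff_pd hg).differentiable (by simp)
  have h1 : (pd i fun x => g (toRef c n r x)) = fun x =>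
      r⁻¹ * (R (EuclideanSpace.single i 1) 0 * pd 0 g (toRef c n r x)
        + R (EuclideanSpace.single i 1) 1 * pd 1 g (toRef c n r x)) := by
    ext x
    rw [pd, (hasFDerivAt_comp_toRef (hg.differentiable (by simp)) c n hn r x _).2,
      Fin.sum_univ_two]
  have hD : ∀ k, Differentiable ℝ fun x => pd k g (toRef c n r x) := fun k x =>
    (hasFDerivAt_comp_toRef (hd k) c n hn r x 0).1
  have h2 : ∀ k, pd j (fun x => pd k g (toRef c n r x)) x
      = r⁻¹ * (R (EuclideanSpace.single j 1) 0 * pd 0 (pd k g) (toRef c n r x)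
        + R (EuclideanSpace.single j 1) 1 * pd 1 (pd k g) (toRef c n r x)) := fun k => by
    rw [pd, (hasFDerivAt_comp_toRef (hd k) c n hn r x _).2, Fin.sum_univ_two]
  have hD0 := hD 0
  have hD1 := hD 1
  rw [h1, pd_const_mul (by fun_prop), pd_add (by fun_prop) (by fun_prop),
    pd_const_mul (hD 0), pd_const_mul (hD 1)]
  simp only [h2]
  have hW0 : 0 ≤ W := (abs_nonneg _).trans (hW 0 0 0)
  have ha : ∀ i k, |R (EuclideanSpace.single i 1) k| ≤ 1 := abs_repr_single_le n hn
  have hb : ∀ k, |R (EuclideanSpace.single j 1) 0 * pd 0 (pd k g) (toRef c n r x)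
        + R (EuclideanSpace.single j 1) 1 * pd 1 (pd k g) (toRef c n r x)| ≤ 2 * W := fun k => by
    refine (abs_add_le _ _).trans ?_
    rw [abs_mul, abs_mul]
    have e1 := mul_le_mul (ha j 0) (hW (toRef c n r x) k 0) (abs_nonneg _) zero_le_one
    have e2 := mul_le_mul (ha j 1) (hW (toRef c n r x) k 1) (abs_nonneg _) zero_le_one
    linarith
  have hri : |r⁻¹| = r⁻¹ := abs_of_pos (inv_pos.mpr hr)
  have hc : ∀ k, |R (EuclideanSpace.single i 1) k * (r⁻¹ *
      (R (EuclideanSpace.single j 1) 0 * pd 0 (pd k g) (toRef c n r x)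
        + R (EuclideanSpace.single j 1) 1 * pd 1 (pd k g) (toRef c n r x)))|
      ≤ r⁻¹ * (2 * W) := fun k => by
    rw [abs_mul, abs_mul, hri]
    have e1 := mul_le_mul_of_nonneg_left (hb k) (inv_pos.mpr hr).le
    have e2 := mul_le_mul (ha i k) e1 (by positivity) zero_le_one
    linarith
  rw [abs_mul, hri]
  calc _ ≤ r⁻¹ * (r⁻¹ * (2 * W) + r⁻¹ * (2 * W)) :=
        mul_le_mul_of_nonneg_left ((abs_add_le _ _).trans (add_le_add (hc 0) (hc 1)))
          (inv_pos.mpr hr).le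
    _ = _ := by field_simp; ring

lemma fderiv_comp_toRef_normal {g : Plane → ℝ} (hg : Differentiable ℝ g) (c n : Plane)
    (hn : ‖n‖ = 1) (r : ℝ) (x : Plane) :
    fderiv ℝ (fun x => g (toRef c n r x)) x n = r⁻¹ * pd 0 g (toRef c n r x) := by
  rw [(hasFDerivAt_comp_toRef hg c n hn r x n).2]
  have := (normalBasis n hn).repr_self 0
  rw [normalBasis_zero] at this
  simp [this]

/-- Since `bump` is constant near `0`, on the line `y 0 = 0` only the bubbles that are linear in
`y 0` have a normal derivative, and by `bubble_zero_line` only those without a factor `y 0` have a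
value. -/
lemma pd_zero_bubble (a b : ℕ) (s : ℝ) :
    pd 0 (bubble a b) !₂[0, s] = if a = 1 then bump s * s ^ b else 0 := by
  have h : pd 0 (bubble a b) !₂[0, s]
      = deriv (fun t : ℝ => bump t * t ^ a) 0 * (bump s * s ^ b) := by
    have h1 : HasDerivAt (fun t : ℝ => bubble a b (line !₂[0, s] (EuclideanSpace.single 0 1) t))
        (pd 0 (bubble a b) !₂[0, s]) 0 := by
      have := hasDerivAt_comp_line ((contDiff_bubble a b).differentiable (by simp)) !₂[0, s]
        (EuclideanSpace.single 0 1) 0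
      simpa [line, pd] using this
    have h2 : (fun t : ℝ => bubble a b (line !₂[0, s] (EuclideanSpace.single 0 1) t))
        = fun t => (bump t * t ^ a) * (bump s * s ^ b) := by
      ext t
      simp [bubble, bump₂, monom, line]
      ring
    rw [← h1.deriv, h2, deriv_mul_const]
    exact ((bump.contDiff (n := 1)).differentiable (by simp) 0).mul (by fun_prop)
  rw [h, deriv_fun_mul ((bump.contDiff (n := 1)).differentiable (by simp) 0) (by fun_prop),
    deriv_bump_zero, bump_zero]
  rcases a with _ | _ | a <;> simp

lemma bubble_zero_line (a b : ℕ) (s : ℝ) :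
    bubble a b !₂[0, s] = if a = 0 then bump s * s ^ b else 0 := by
  rcases a with _ | a <;> simp [bubble, bump₂, monom, bump_zero]

/-! ### Triangles in barycentric coordinates -/

/-- Barycentric coordinates of a triangle. -/
lemma exists_barycentric {K : Finset Plane} (hK : K.card = 3)
    (hi : AffineIndependent ℝ ((↑) : K → Plane)) :
    ∃ l : Plane → Plane →ᵃ[ℝ] ℝ, (∀ v ∈ K, l v v = 1) ∧
      (∀ v ∈ K, ∀ w ∈ K, v ≠ w → l v w = 0) ∧
      (∀ x, x ∈ hull K ↔ ∀ v ∈ K, 0 ≤ l v x) ∧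
      (∀ x, x ∈ interior (hull K) ↔ ∀ v ∈ K, 0 < l v x) ∧
      (∀ x, ∑ v ∈ K, l v x = 1) ∧ (∀ x, ∑ v ∈ K, l v x • v = x) := by
  classical
  have htop : affineSpan ℝ (Set.range ((↑) : K → Plane)) = ⊤ := by
    rw [hi.affineSpan_eq_top_iff_card_eq_finrank_add_one]
    simp [hK]
  let b : AffineBasis K ℝ Plane := ⟨(↑), hi, htop⟩
  have hr : Set.range b = (K : Set Plane) := Subtype.range_coe
  refine ⟨fun v => if h : v ∈ K then b.coord ⟨v, h⟩ else 0, fun v hv => ?_, fun v hv w hw hvw => ?_,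
    fun x => ?_, fun x => ?_, fun x => ?_, fun x => ?_⟩
  · simp only [hv, dif_pos]
    exact b.coord_apply_eq ⟨v, hv⟩
  · simp only [hv, dif_pos]
    exact b.coord_apply_ne (i := ⟨v, hv⟩) (j := ⟨w, hw⟩) (by simpa using hvw)
  · rw [hull, ← hr, b.convexHull_eq_nonneg_coord]
    constructor
    · intro h v hv
      simpa [hv] using h ⟨v, hv⟩
    · intro h i
      simpa using h i i.2
  · rw [hull, ← hr, b.interior_convexHull]
    constructor
    · intro h v hv
      simpa [hv] using h ⟨v, hv⟩
    · intro h i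
      simpa using h i i.2
  · rw [← Finset.sum_coe_sort K]
    simpa using b.sum_coord_apply_eq_one x
  · rw [← Finset.sum_coe_sort K]
    have hb : ∀ i, b i = (i : Plane) := fun _ => rfl
    simpa [hb] using b.linear_combination_coord_eq_self x

/-- Barycentric coordinates vary slowly if the triangle contains a large disc. -/
lemma abs_sub_le_of_closedBall {l : Plane →ᵃ[ℝ] ℝ} {c : Plane} {ρ : ℝ} (hρ : 0 < ρ)
    (h0 : ∀ x ∈ Metric.closedBall c ρ, 0 ≤ l x) (h1 : ∀ x ∈ Metric.closedBall c ρ, l x ≤ 1)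
    (x y : Plane) : |l x - l y| ≤ dist x y / (2 * ρ) := by
  have hlin : ∀ u : Plane, ‖u‖ = 1 → l.linear u ≤ 1 / (2 * ρ) := by
    intro u hu
    have e : ∀ t : ℝ, l (c + t • u) = l c + t * l.linear u := fun t => by
      have := l.map_vadd c (t • u)
      simp only [vadd_eq_add, map_smul, smul_eq_mul] at this
      rw [add_comm c, this, add_comm]
    have m1 : c + ρ • u ∈ Metric.closedBall c ρ := by
      simp [norm_smul, hu, abs_of_pos hρ]
    have m2 : c + (-ρ) • u ∈ Metric.closedBall c ρ := by
      rw [Metric.mem_closedBall, dist_eq_norm]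
      simp [norm_smul, hu, abs_of_pos hρ]
    have a1 := h1 _ m1
    have a2 := h0 _ m2
    rw [e] at a1 a2
    rw [le_div_iff₀ (by positivity)]
    linarith
  have hlin' : ∀ w : Plane, l.linear w ≤ ‖w‖ / (2 * ρ) := by
    intro w
    by_cases hw : w = 0
    · simp [hw]
    · have hw' : ‖w‖ ≠ 0 := norm_ne_zero_iff.mpr hw
      have := hlin (‖w‖⁻¹ • w) (by rw [norm_smul, norm_inv, norm_norm, inv_mul_cancel₀ hw'])
      rw [map_smul, smul_eq_mul] at this
      calc l.linear w = ‖w‖ * (‖w‖⁻¹ * l.linear w) := by field_simp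
        _ ≤ ‖w‖ * (1 / (2 * ρ)) := mul_le_mul_of_nonneg_left this (norm_nonneg _)
        _ = _ := by ring
  have hs : ∀ x y, l x - l y = l.linear (x - y) := fun x y => by
    have := l.linearMap_vsub x y
    simpa using this.symm
  rw [abs_le]
  constructor
  · have := hlin' (y - x)
    rw [← hs, ← dist_eq_norm, dist_comm] at this
    linarith
  · have := hlin' (x - y)
    rwa [← hs, ← dist_eq_norm] at this

/-- The points of the simplex `K` that do not lie on a face opposite to a vertex of `F`. -/
def openStar (F K : Finset Plane) : Set Plane :=
  {x | x ∈ hull K ∧ ∀ v ∈ F, x ∉ convexHull ℝ ((K : Set Plane) \ {v})}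

lemma mem_openStar_of_pos {F K : Finset Plane} (hF : F ⊆ K) {l : Plane → Plane →ᵃ[ℝ] ℝ}
    (hl : ∀ v ∈ K, ∀ w ∈ K, v ≠ w → l v w = 0) {x : Plane} (hx : x ∈ hull K)
    (hpos : ∀ v ∈ F, 0 < l v x) : x ∈ openStar F K := by
  refine ⟨hx, fun v hv hxv => (hpos v hv).ne' ?_⟩
  have hc : Convex ℝ {y | l v y = 0} := by
    have : {y | l v y = 0} = l v ⁻¹' {0} := rfl
    rw [this]
    exact (convex_singleton (0 : ℝ)).affine_preimage (l v)
  have hsub : (K : Set Plane) \ {v} ⊆ {y | l v y = 0} := fun w hw =>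
    hl v (hF hv) w hw.1 fun h => hw.2 h.symm
  exact convexHull_min hsub hc hxv

/-- In a conforming triangulation, a face that meets the open star of `F` contains `F`. -/
lemma Triangulation.subset_of_mem_openStar {Ω : Set Plane} (T : Triangulation Ω)
    {F K L E : Finset Plane} (hK : K ∈ T.tri) (hL : L ∈ T.tri) (hE : E ⊆ L) {x : Plane}
    (hx : x ∈ openStar F K) (hxE : x ∈ hull E) : F ⊆ E := by
  intro v hv
  by_contra hvE
  have hxL : x ∈ hull L := convexHull_mono (by exact_mod_cast hE) hxE
  have h1 : x ∈ convexHull ℝ ((K : Set Plane) ∩ L) := by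
    rw [← T.conforming K hK L hL]
    exact ⟨hx.1, hxL⟩
  have h2 : x ∈ convexHull ℝ (((K : Set Plane) ∩ L) ∩ E) := by
    classical
    have hi := T.indep L hL
    have := hi.convexHull_inter (t₁ := K ∩ L) (t₂ := E) Finset.inter_subset_right hE
    rw [Finset.coe_inter] at this
    rw [this]
    exact ⟨h1, hxE⟩
  refine hx.2 v hv (convexHull_mono ?_ h2)
  rintro w ⟨⟨hwK, -⟩, hwE⟩
  exact ⟨hwK, fun h => hvE (by rw [← h]; exact hwE)⟩

lemma isCompact_hull (K : Finset Plane) : IsCompact (hull K) :=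
  K.finite_toSet.isCompact_convexHull ℝ

lemma isClosed_hull (K : Finset Plane) : IsClosed (hull K) := (isCompact_hull K).isClosed

lemma isClosed_biUnion_hull (s : Finset (Finset Plane)) : IsClosed (⋃ K ∈ s, hull K) :=
  isClosed_biUnion_finset fun K _ => isClosed_hull K

lemma Triangulation.hull_subset_closure {Ω : Set Plane} (T : Triangulation Ω) {K : Finset Plane}
    (hK : K ∈ T.tri) : hull K ⊆ closure Ω := by
  rw [← T.cover]
  exact Set.subset_biUnion_of_mem hK

/-- The union of a set of triangles that contains all triangles with face `F` is relatively clopen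
near the open star of `F`. -/
lemma Triangulation.locallyClopen {Ω : Set Plane} (T : Triangulation Ω) {F : Finset Plane}
    {s : Finset (Finset Plane)} (hs : s ⊆ T.tri) (hF : ∀ L ∈ T.tri, F ⊆ L → L ∈ s) {D : Set Plane}
    (hD : ∀ L ∈ s, ∀ x ∈ D, x ∈ hull L → x ∈ openStar F L) :
    LocallyClopen (closure Ω) (⋃ L ∈ s, hull L) D := by
  classical
  intro x hx hxD
  by_cases hxA : x ∈ ⋃ L ∈ s, hull L
  · left
    obtain ⟨L, hL, hxL⟩ := Set.mem_iUnion₂.mp hxA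
    have hxs := hD L hL x hxD hxL
    have hU : (⋃ L ∈ T.tri \ s, hull L)ᶜ ∈ 𝓝 x := by
      refine (isClosed_biUnion_hull _).isOpen_compl.mem_nhds fun h => ?_
      obtain ⟨L', hL', hxL'⟩ := Set.mem_iUnion₂.mp h
      rw [Finset.mem_sdiff] at hL'
      exact hL'.2 (hF L' hL'.1
        (T.subset_of_mem_openStar (hs hL) hL'.1 subset_rfl hxs hxL'))
    filter_upwards [self_mem_nhdsWithin, mem_nhdsWithin_of_mem_nhds hU] with y hy hyU
    rw [← T.cover] at hy
    obtain ⟨L', hL', hyL'⟩ := Set.mem_iUnion₂.mp hy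
    by_cases h : L' ∈ s
    · exact Set.mem_biUnion h hyL'
    · exact absurd (Set.mem_biUnion (by simp [hL', h]) hyL') hyU
  · right
    exact mem_nhdsWithin_of_mem_nhds
      ((isClosed_biUnion_hull _).isOpen_compl.mem_nhds hxA)

/-- No node lies in the open star of an edge or a triangle. -/
lemma Triangulation.notMem_nodes {Ω : Set Plane} (T : Triangulation Ω) {F K : Finset Plane}
    (hK : K ∈ T.tri) (hF : 2 ≤ F.card) {x : Plane} (hx : x ∈ openStar F K) : x ∉ T.nodes := by
  intro h
  obtain ⟨L, hL, hxL⟩ := Set.mem_iUnion₂.mp h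
  have hxx : x ∈ hull {x} := subset_convexHull ℝ _ (by simp)
  have := Finset.card_le_card
    (T.subset_of_mem_openStar hK hL (E := {x}) (by simpa using hxL) hx hxx)
  simp at this
  omega

/-- An edge that meets the open star of a face with at least two vertices is that face. -/
lemma Triangulation.eq_of_mem_openStar {Ω : Set Plane} (T : Triangulation Ω)
    {F K E : Finset Plane} (hK : K ∈ T.tri) (hF : 2 ≤ F.card) (hE : E ∈ T.edges) {x : Plane}
    (hx : x ∈ openStar F K) (hxE : x ∈ hull E) : F = E := by
  classical
  obtain ⟨L, hL, hEL⟩ := Finset.mem_biUnion.mp hE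
  rw [Finset.mem_powersetCard] at hEL
  exact Finset.eq_of_subset_of_card_le (T.subset_of_mem_openStar hK hL hEL.1 hx hxE)
    (by rw [hEL.2]; exact hF)

/-- The inner part of a triangle. -/
def innerPart (K : Finset Plane) : Set Plane := interior (hull K)

lemma Problem.innerPart_subset (P : Problem) (T : Triangulation P.Ω) {K : Finset Plane}
    (hK : K ∈ T.tri) : innerPart K ⊆ P.Ω := by
  rw [← P.interior_closure]
  exact interior_mono (T.hull_subset_closure hK)

/-- The boundary of a convex set is a null set. -/
lemma innerPart_ae_eq_hull (K : Finset Plane) : innerPart K =ᵐ[volume] hull K := by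
  have h : volume (frontier (hull K)) = 0 := (convex_convexHull ℝ _).addHaar_frontier volume
  exact interior_ae_eq_of_null_frontier h

lemma Triangulation.disjoint_innerPart {Ω : Set Plane} (T : Triangulation Ω) {K L : Finset Plane}
    (hK : K ∈ T.tri) (hL : L ∈ T.tri) (hne : K ≠ L) : Disjoint (innerPart K) (innerPart L) := by
  rw [Set.disjoint_left]
  intro x hxK hxL
  obtain ⟨l, -, hl0, -, hl, -⟩ := exists_barycentric (T.card_eq K hK) (T.indep K hK)
  have hx : x ∈ openStar K K := mem_openStar_of_pos subset_rfl hl0 (interior_subset hxK)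
    ((hl x).mp hxK)
  have := T.subset_of_mem_openStar hK hL subset_rfl hx (interior_subset hxL)
  exact hne (Finset.eq_of_subset_of_card_le this (by rw [T.card_eq K hK, T.card_eq L hL]))

lemma Triangulation.mem_openStar_self {Ω : Set Plane} (T : Triangulation Ω) {K : Finset Plane}
    (hK : K ∈ T.tri) {x : Plane} (hx : x ∈ innerPart K) : x ∈ openStar K K := by
  obtain ⟨l, -, hl0, -, hl, -⟩ := exists_barycentric (T.card_eq K hK) (T.indep K hK)
  exact mem_openStar_of_pos subset_rfl hl0 (interior_subset hx) ((hl x).mp hx)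

/-! ### A half disc at the midpoint of an edge -/

lemma size_pair (a b : Plane) : size {a, b} = dist a b := by
  simp [size, convexHull_diam, Metric.diam_pair]

lemma size_mono {E K : Finset Plane} (h : E ⊆ K) : size E ≤ size K :=
  Metric.diam_mono (convexHull_mono (by exact_mod_cast h)) (isCompact_hull K).isBounded

lemma eq_smul_tangent {n w : Plane} (hn : ‖n‖ = 1) (h : ⟪w, n⟫ = 0) :
    w = ⟪tangent n, w⟫ • tangent n := by
  have := (normalBasis n hn).sum_repr w
  rw [Fin.sum_univ_two, (normalBasis_repr n hn w).1, (normalBasis_repr n hn w).2,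
    normalBasis_zero, normalBasis_one, real_inner_comm, h, zero_smul, zero_add] at this
  exact this.symm

lemma abs_inner_tangent {n w : Plane} (hn : ‖n‖ = 1) (h : ⟪w, n⟫ = 0) :
    |⟪tangent n, w⟫| = ‖w‖ := by
  conv_rhs => rw [eq_smul_tangent hn h]
  rw [norm_smul, norm_tangent, hn, mul_one, Real.norm_eq_abs]

lemma hull_pair_eq {a b n : Plane} (hn : ‖n‖ = 1) (h : ⟪b - a, n⟫ = 0) :
    hull {a, b} = line (midpoint ℝ a b) (tangent n) ''
      Set.Icc (-(dist a b / 2)) (dist a b / 2) := by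
  have hd : |⟪tangent n, b - a⟫| = dist a b := by
    rw [abs_inner_tangent hn h, dist_comm, dist_eq_norm]
  set e := ⟪tangent n, b - a⟫ with he
  have hba : b - a = e • tangent n := eq_smul_tangent hn h
  have hm : midpoint ℝ a b = a + (e / 2) • tangent n := by
    rw [midpoint_eq_smul_add, show b = a + e • tangent n by rw [← hba]; abel]
    simp only [invOf_eq_inv]
    module
  have hhull : hull {a, b} = segment ℝ a b := by simp [hull]
  rw [hhull, segment_eq_image', hba, hm]
  ext x
  simp only [Set.mem_image, line]
  constructor
  · rintro ⟨t, ⟨ht0, ht1⟩, rfl⟩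
    refine ⟨(t - 1 / 2) * e, ?_, by module⟩
    rw [Set.mem_Icc, ← abs_le, abs_mul, hd]
    have : |t - 1 / 2| ≤ 1 / 2 := abs_le.mpr ⟨by linarith, by linarith⟩
    nlinarith [dist_nonneg (x := a) (y := b)]
  · rintro ⟨s, hs, rfl⟩
    by_cases he0 : e = 0
    · have : dist a b = 0 := by rw [← hd, he0, abs_zero]
      have hs0 : s = 0 := by rw [this] at hs; simpa using hs
      exact ⟨0, by simp, by simp [he0, hs0]⟩
    · refine ⟨s / e + 1 / 2, ?_, ?_⟩
      · have : |s / e| ≤ 1 / 2 := by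
          rw [abs_div, hd, div_le_iff₀ (by rw [← hd]; exact abs_pos.mpr he0)]
          have := abs_le.mpr hs
          linarith
        have := abs_le.mp this
        exact ⟨by linarith, by linarith⟩
      · rw [smul_smul, show (s / e + 1 / 2) * e = e / 2 + s by field_simp; ring, add_smul,
          add_assoc]

lemma arc_hull_pair {a b n : Plane} (hn : ‖n‖ = 1) (h : ⟪b - a, n⟫ = 0) :
    arc (hull {a, b}) = (volume.restrict (Set.Icc (-(dist a b / 2)) (dist a b / 2))).map
      (line (midpoint ℝ a b) (tangent n)) := by
  have hiso := isometry_line (midpoint ℝ a b) (v := tangent n) (by rw [norm_tangent, hn])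
  have hemb := hiso.isClosedEmbedding.measurableEmbedding
  have hmap := hiso.map_hausdorffMeasure (d := 1) (Or.inl zero_le_one)
  rw [hausdorffMeasure_real] at hmap
  rw [arc, hull_pair_eq hn h]
  set I := Set.Icc (-(dist a b / 2)) (dist a b / 2)
  set f := line (midpoint ℝ a b) (tangent n)
  have hI : f ⁻¹' (f '' I) = I := Set.preimage_image_eq I hiso.injective
  conv_rhs => rw [← hI]
  rw [← hemb.restrict_map, hmap, Measure.restrict_restrict_of_subset (Set.image_subset_range f I)]

lemma integral_arc_hull_pair {a b n : Plane} (hn : ‖n‖ = 1) (h : ⟪b - a, n⟫ = 0) (F : Plane → ℝ) :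
    ∫ x, F x ∂(arc (hull {a, b})) = ∫ s in Set.Icc (-(dist a b / 2)) (dist a b / 2),
      F (line (midpoint ℝ a b) (tangent n) s) := by
  have hiso := isometry_line (midpoint ℝ a b) (v := tangent n) (by rw [norm_tangent, hn])
  rw [arc_hull_pair hn h, hiso.isClosedEmbedding.measurableEmbedding.integral_map]

lemma arc_hull_pair_univ {a b n : Plane} (hn : ‖n‖ = 1) (h : ⟪b - a, n⟫ = 0) :
    arc (hull {a, b}) Set.univ = ENNReal.ofReal (dist a b) := by
  have hiso := isometry_line (midpoint ℝ a b) (v := tangent n) (by rw [norm_tangent, hn])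
  rw [arc_hull_pair hn h, hiso.isClosedEmbedding.measurableEmbedding.map_apply]
  simp

/-- The triangle `K` looks like a half plane with outer normal `n` within distance `ρ` of the
midpoint of its edge `{a, b}`. -/
structure IsHalfDisc (K : Finset Plane) (a b n : Plane) (ρ : ℝ) : Prop where
  norm_eq : ‖n‖ = 1
  perp : ⟪b - a, n⟫ = 0
  inner_le : ∀ y ∈ hull K, ⟪y - midpoint ℝ a b, n⟫ ≤ 0
  mem_hull : ∀ y ∈ Metric.ball (midpoint ℝ a b) ρ, ⟪y - midpoint ℝ a b, n⟫ ≤ 0 → y ∈ hull K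
  mem_openStar : ∀ y ∈ Metric.ball (midpoint ℝ a b) ρ, y ∈ hull K → y ∈ openStar {a, b} K

lemma inner_sub_left_eq (x y n : Plane) : ⟪x - y, n⟫ = ⟪x, n⟫ - ⟪y, n⟫ := inner_sub_left x y n

lemma inner_midpoint {a b n : Plane} (h : ⟪b - a, n⟫ = 0) :
    ⟪midpoint ℝ a b, n⟫ = ⟪a, n⟫ := by
  rw [inner_sub_left_eq] at h
  rw [midpoint_eq_smul_add, inner_smul_left, inner_add_left]
  simp
  linarith

lemma IsOuterNormal.isHalfDisc {K : Finset Plane} (hK : K.card = 3)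
    (hi : AffineIndependent ℝ ((↑) : K → Plane)) {a b n : Plane} (hab : a ≠ b)
    (hE : ({a, b} : Finset Plane) ⊆ K) (hn : IsOuterNormal K {a, b} n) {c : Plane} {ρ : ℝ}
    (hρ : 0 < ρ) (hball : Metric.closedBall c ρ ⊆ hull K) : IsHalfDisc K a b n ρ := by
  classical
  have haK : a ∈ K := hE (by simp)
  have hbK : b ∈ K := hE (by simp)
  have hp : ⟪b - a, n⟫ = 0 := by
    have h1 := hn.2 a (by simp) b hbK
    have h2 := hn.2 b (by simp) a haK
    rw [inner_sub_left_eq] at h1 h2 ⊢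
    linarith
  have hm : ∀ y : Plane, ⟪y - midpoint ℝ a b, n⟫ = ⟪y - a, n⟫ := fun y => by
    rw [inner_sub_left_eq, inner_sub_left_eq, inner_midpoint hp]
  have hle : ∀ y ∈ hull K, ⟪y - midpoint ℝ a b, n⟫ ≤ 0 := by
    intro y hy
    have hc : Convex ℝ {y : Plane | ⟪y, n⟫ ≤ ⟪a, n⟫} := by
      simp only [fun y : Plane => real_inner_comm n y]
      exact convex_halfSpace_le (innerₗ Plane n).isLinear _
    have hsub : (K : Set Plane) ⊆ {y : Plane | ⟪y, n⟫ ≤ ⟪a, n⟫} := fun y hy => by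
      have := hn.2 a (by simp) y hy
      rw [inner_sub_left_eq] at this
      simpa using this
    have := convexHull_min hsub hc hy
    rw [hm, inner_sub_left_eq]
    have h' : ⟪y, n⟫ ≤ ⟪a, n⟫ := this
    linarith
  obtain ⟨l, hl1, hl0, hlh, -, hls, hlx⟩ := exists_barycentric hK hi
  have hl_le : ∀ v ∈ K, ∀ x ∈ hull K, l v x ≤ 1 := fun v hv x hx => by
    rw [← hls x]
    exact Finset.single_le_sum (f := fun v => l v x) (fun w hw => (hlh x).mp hx w hw) hv
  have hlip : ∀ v ∈ K, ∀ x y, |l v x - l v y| ≤ dist x y / (2 * ρ) := fun v hv =>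
    abs_sub_le_of_closedBall hρ (fun x hx => (hlh x).mp (hball hx) v hv)
      (fun x hx => hl_le v hv x (hball hx))
  have hla : l a (midpoint ℝ a b) = 1 / 2 := by
    rw [AffineMap.map_midpoint, hl1 a haK, hl0 a haK b hbK hab, midpoint_eq_smul_add]
    simp
  have hlb : l b (midpoint ℝ a b) = 1 / 2 := by
    rw [AffineMap.map_midpoint, hl1 b hbK, hl0 b hbK a haK hab.symm, midpoint_eq_smul_add]
    simp
  have hpos : ∀ y ∈ Metric.ball (midpoint ℝ a b) ρ, ∀ v ∈ ({a, b} : Finset Plane), 0 < l v y := by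
    intro y hy v hv
    have h1 : l v (midpoint ℝ a b) = 1 / 2 := by
      rcases Finset.mem_insert.mp hv with rfl | hv
      · exact hla
      · rw [Finset.mem_singleton.mp hv]; exact hlb
    have h2 := hlip v (hE hv) y (midpoint ℝ a b)
    have h3 : dist y (midpoint ℝ a b) / (2 * ρ) < 1 / 2 := by
      rw [div_lt_iff₀ (by positivity)]
      have := Metric.mem_ball.mp hy
      linarith
    have := (abs_le.mp h2).1
    linarith
  have hstar : ∀ y ∈ Metric.ball (midpoint ℝ a b) ρ, y ∈ hull K → y ∈ openStar {a, b} K :=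
    fun y hy hyK => mem_openStar_of_pos hE hl0 hyK (hpos y hy)
  refine ⟨hn.1, hp, hle, fun y hy hyn => ?_, hstar⟩
  -- the coordinate of the third vertex is a multiple of the distance to the edge
  have hcard : (K \ {a, b}).card = 1 := by
    rw [Finset.card_sdiff_of_subset hE, hK, Finset.card_pair hab]
  obtain ⟨z, hz⟩ := Finset.card_eq_one.mp hcard
  have hzK : z ∈ K \ {a, b} := by rw [hz]; simp
  have hsum : ∀ f : Plane → ℝ, ∑ v ∈ K, f v = f z + (f a + f b) := fun f => by
    rw [← Finset.sum_sdiff hE, hz, Finset.sum_singleton, Finset.sum_pair hab]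
  have hin : ∀ y, ⟪y - a, n⟫ = l z y * ⟪z - a, n⟫ := by
    intro y
    have h1 : ⟪y, n⟫ = ∑ v ∈ K, l v y * ⟪v, n⟫ := by
      conv_lhs => rw [← hlx y]
      rw [sum_inner]
      simp [inner_smul_left]
    have h2 := hls y
    rw [hsum] at h1 h2
    have h3 : ⟪b, n⟫ = ⟪a, n⟫ := by rw [inner_sub_left_eq] at hp; linarith
    rw [inner_sub_left_eq, inner_sub_left_eq, h1, h3]
    linear_combination ⟪a, n⟫ * h2
  have hzn : ⟪z - a, n⟫ < 0 := by
    refine lt_of_le_of_ne (hn.2 a (by simp) z (Finset.mem_sdiff.mp hzK).1) fun h => ?_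
    have h1 := hin c
    have h2 := hin (c + n)
    rw [h, mul_zero] at h1 h2
    rw [inner_sub_left_eq] at h1 h2
    rw [inner_add_left, real_inner_self_eq_norm_sq, hn.1] at h2
    linarith
  refine (hlh y).mpr fun v hv => ?_
  by_cases hvE : v ∈ ({a, b} : Finset Plane)
  · exact (hpos y hy v hvE).le
  · have : v ∈ K \ {a, b} := Finset.mem_sdiff.mpr ⟨hv, hvE⟩
    rw [hz, Finset.mem_singleton] at this
    rw [this]
    rw [hm, hin] at hyn
    by_contra hneg
    nlinarith [not_le.mp hneg]

lemma exists_isOuterNormal {K : Finset Plane} (hK : K.card = 3) {a b : Plane} (hab : a ≠ b)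
    (hE : ({a, b} : Finset Plane) ⊆ K) : ∃ n, IsOuterNormal K {a, b} n := by
  classical
  have hcard : (K \ {a, b}).card = 1 := by
    rw [Finset.card_sdiff_of_subset hE, hK, Finset.card_pair hab]
  obtain ⟨z, hz⟩ := Finset.card_eq_one.mp hcard
  have hKz : ∀ y ∈ K, y = a ∨ y = b ∨ y = z := fun y hy => by
    by_cases h : y ∈ ({a, b} : Finset Plane)
    · rcases Finset.mem_insert.mp h with h | h
      · exact Or.inl h
      · exact Or.inr (Or.inl (Finset.mem_singleton.mp h))
    · have : y ∈ K \ {a, b} := Finset.mem_sdiff.mpr ⟨hy, h⟩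
      rw [hz, Finset.mem_singleton] at this
      exact Or.inr (Or.inr this)
  have key : ∀ n : Plane, ‖n‖ = 1 → ⟪b - a, n⟫ = 0 → ⟪z - a, n⟫ ≤ 0 →
      IsOuterNormal K {a, b} n := by
    intro n hn hp hzn
    have hp' : ⟪b, n⟫ = ⟪a, n⟫ := by rw [inner_sub_left_eq] at hp; linarith
    rw [inner_sub_left_eq] at hzn
    refine ⟨hn, fun e he y hy => ?_⟩
    have he' : ⟪e, n⟫ = ⟪a, n⟫ := by
      rcases Finset.mem_insert.mp he with rfl | h
      · rfl
      · rw [Finset.mem_singleton.mp h, hp']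
    rw [inner_sub_left_eq, he']
    rcases hKz y hy with rfl | rfl | rfl <;> linarith
  have hba : ‖b - a‖ ≠ 0 := norm_ne_zero_iff.mpr (sub_ne_zero.mpr hab.symm)
  set n₀ := ‖b - a‖⁻¹ • tangent (b - a) with hn₀
  have hn1 : ‖n₀‖ = 1 := by
    rw [hn₀, norm_smul, norm_tangent, norm_inv, norm_norm, inv_mul_cancel₀ hba]
  have hp : ⟪b - a, n₀⟫ = 0 := by
    rw [hn₀, inner_smul_right, inner_tangent_self, mul_zero]
  rcases le_total ⟪z - a, n₀⟫ 0 with h | h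
  · exact ⟨n₀, key n₀ hn1 hp h⟩
  · exact ⟨-n₀, key (-n₀) (by rw [norm_neg, hn1]) (by rw [inner_neg_right, hp, neg_zero])
      (by rw [inner_neg_right]; linarith)⟩

lemma isOuterNormal_outerNormal {K : Finset Plane} (hK : K.card = 3) {a b : Plane} (hab : a ≠ b)
    (hE : ({a, b} : Finset Plane) ⊆ K) : IsOuterNormal K {a, b} (outerNormal K {a, b}) :=
  Classical.epsilon_spec (exists_isOuterNormal hK hab hE)

lemma IsHalfDisc.mono {K : Finset Plane} {a b n : Plane} {ρ r : ℝ} (h : IsHalfDisc K a b n ρ)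
    (hr : r ≤ ρ) : IsHalfDisc K a b n r :=
  ⟨h.norm_eq, h.perp, h.inner_le, fun y hy => h.mem_hull y (Metric.ball_subset_ball hr hy),
    fun y hy => h.mem_openStar y (Metric.ball_subset_ball hr hy)⟩

lemma IsHalfDisc.innerPart_inter_ball {K : Finset Plane} {a b n : Plane} {ρ : ℝ}
    (h : IsHalfDisc K a b n ρ) {y : Plane} (hy : y ∈ Metric.ball (midpoint ℝ a b) ρ) :
    y ∈ innerPart K ↔ y ∈ halfPlane (midpoint ℝ a b) n := by
  constructor
  · intro hyK
    refine lt_of_le_of_ne (h.inner_le y (interior_subset hyK)) fun h0 => ?_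
    -- a small step in the direction of the outer normal leaves the triangle
    obtain ⟨ε, hε, hsub⟩ := Metric.isOpen_iff.mp isOpen_interior y hyK
    have hmem : y + (ε / 2) • n ∈ Metric.ball y ε := by
      rw [Metric.mem_ball, dist_eq_norm]
      simp [norm_smul, h.norm_eq, abs_of_pos hε]
      exact hε
    have := h.inner_le _ (interior_subset (hsub hmem))
    rw [add_sub_right_comm, inner_add_left, h0, inner_smul_left, real_inner_self_eq_norm_sq,
      h.norm_eq] at this
    simp at this
    linarith
  · intro hyn
    have hopen : IsOpen (Metric.ball (midpoint ℝ a b) ρ ∩ halfPlane (midpoint ℝ a b) n) :=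
      Metric.isOpen_ball.inter (isOpen_halfPlane _ _)
    exact interior_maximal (fun x hx => h.mem_hull x hx.1 (le_of_lt hx.2)) hopen ⟨hy, hyn⟩

/-- Two different triangles of a conforming mesh lie on different sides of a common edge. -/
lemma Triangulation.normal_eq_neg {Ω : Set Plane} (T : Triangulation Ω) {K L : Finset Plane}
    (hK : K ∈ T.tri) (hL : L ∈ T.tri) (hne : K ≠ L) {a b n n' : Plane} (hab : a ≠ b)
    {ρ ρ' : ℝ} (hρ : 0 < ρ) (hρ' : 0 < ρ') (h : IsHalfDisc K a b n ρ)
    (h' : IsHalfDisc L a b n' ρ') : n' = -n := by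
  have hdis := T.disjoint_innerPart hK hL hne
  have hnn : ⟪n', n⟫ * ⟪n', n⟫ = 1 := by
    have e1 := eq_smul_tangent h.norm_eq h.perp
    have hz : ⟪tangent n, b - a⟫ ≠ 0 := fun h0 => by
      rw [h0, zero_smul] at e1
      exact hab (sub_eq_zero.mp e1).symm
    have h2 : ⟪n', tangent n⟫ = 0 := by
      have := h'.perp
      rw [e1, inner_smul_left] at this
      simpa [hz, real_inner_comm] using this
    have hsq := sq_add_sq_of_norm h.norm_eq
    have hsq' := sq_add_sq_of_norm h'.norm_eq
    rw [inner_eq] at h2 ⊢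
    simp only [tangent, PiLp.toLp_apply, Matrix.cons_val_zero, Matrix.cons_val_one] at h2
    linear_combination (n' 0 * n' 0 + n' 1 * n' 1) * hsq + hsq'
      - (n' 0 * (-n 1) + n' 1 * n 0) * h2
  have hfalse : ¬ 0 < ⟪n', n⟫ := by
    intro hpos
    set ε := min ρ ρ' / 2 with hε
    have hm : 0 < min ρ ρ' := lt_min hρ hρ'
    have hε0 : 0 < ε := by positivity
    have hερ : ε < ρ := by have := min_le_left ρ ρ'; linarith
    have hερ' : ε < ρ' := by have := min_le_right ρ ρ'; linarith
    set y := midpoint ℝ a b + (-ε) • n with hy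
    have hd : dist y (midpoint ℝ a b) = ε := by
      rw [dist_eq_norm, hy, add_sub_cancel_left, norm_smul, h.norm_eq, norm_neg, mul_one,
        Real.norm_eq_abs, abs_of_pos hε0]
    have i1 : ⟪y - midpoint ℝ a b, n⟫ < 0 := by
      rw [hy, add_sub_cancel_left, inner_smul_left, real_inner_self_eq_norm_sq, h.norm_eq]
      simpa using hε0
    have i2 : ⟪y - midpoint ℝ a b, n'⟫ < 0 := by
      rw [hy, add_sub_cancel_left, inner_smul_left, real_inner_comm]
      simpa using mul_pos hε0 hpos
    have b1 : y ∈ innerPart K :=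
      (h.innerPart_inter_ball (by rw [Metric.mem_ball, hd]; exact hερ)).mpr i1
    have b2 : y ∈ innerPart L :=
      (h'.innerPart_inter_ball (by rw [Metric.mem_ball, hd]; exact hερ')).mpr i2
    exact Set.disjoint_left.mp hdis b1 b2
  have hm1 : ⟪n', n⟫ = -1 := by nlinarith
  have h0 : ‖n' + n‖ ^ 2 = 0 := by
    rw [norm_add_sq_real, h.norm_eq, h'.norm_eq, hm1]
    norm_num
  exact eq_neg_of_add_eq_zero_left (norm_eq_zero.mp (pow_eq_zero_iff two_ne_zero |>.mp h0))

lemma IsHalfDisc.ball_subset {K L : Finset Plane} {a b n : Plane} {ρ : ℝ}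
    (h : IsHalfDisc K a b n ρ) (h' : IsHalfDisc L a b (-n) ρ) :
    Metric.ball (midpoint ℝ a b) ρ ⊆ hull K ∪ hull L := by
  intro y hy
  rcases le_total ⟪y - midpoint ℝ a b, n⟫ 0 with hl | hl
  · exact Or.inl (h.mem_hull y hy hl)
  · exact Or.inr (h'.mem_hull y hy (by rw [inner_neg_right]; linarith))

/-- The half disc at the midpoint of an edge of a shape regular triangulation has a radius
comparable to the length of the edge. -/
lemma Triangulation.isHalfDisc {Ω : Set Plane} (T : Triangulation Ω) {κ : ℝ} (hκ : 0 < κ)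
    (hT : T.ShapeRegular κ) {K : Finset Plane} (hK : K ∈ T.tri) {a b : Plane} (hab : a ≠ b)
    (hE : ({a, b} : Finset Plane) ⊆ K) :
    IsHalfDisc K a b (outerNormal K {a, b}) (dist a b / (2 * (κ + 1))) := by
  obtain ⟨c, ρ, hρ, hball, hsize⟩ := hT K hK
  refine ((isOuterNormal_outerNormal (T.card_eq K hK) hab hE).isHalfDisc (T.card_eq K hK)
    (T.indep K hK) hab hE hρ hball).mono ?_
  have h1 := size_mono hE
  rw [size_pair] at h1
  rw [div_le_iff₀ (by positivity)]
  nlinarith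

lemma Triangulation.exists_pair {Ω : Set Plane} (T : Triangulation Ω) {E : Finset Plane}
    (hE : E ∈ T.edges) : ∃ a b : Plane, a ≠ b ∧ E = {a, b} := by
  classical
  obtain ⟨K, -, hEK⟩ := Finset.mem_biUnion.mp hE
  exact Finset.card_eq_two.mp (Finset.mem_powersetCard.mp hEK).2

/-- The first triangle of an edge is chosen by `Classical.epsilon`; the choice is meaningful for the
edges of the mesh. -/
lemma Triangulation.tri₁_spec {Ω : Set Plane} (T : Triangulation Ω) {E : Finset Plane}
    (hE : E ∈ T.edges) : T.tri₁ E ∈ T.tri ∧ E ⊆ T.tri₁ E := by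
  classical
  obtain ⟨K, hK, hEK⟩ := Finset.mem_biUnion.mp hE
  exact Classical.epsilon_spec (p := fun K => K ∈ T.tri ∧ E ⊆ K)
    ⟨K, hK, (Finset.mem_powersetCard.mp hEK).1⟩

/-- An edge that belongs to only one triangle lies on the boundary. -/
lemma Triangulation.subset_frontier {Ω : Set Plane} (hΩ : IsOpen Ω) (T : Triangulation Ω)
    {K : Finset Plane} (hK : K ∈ T.tri) {a b n : Plane} {ρ : ℝ}
    (hab : a ≠ b) (hE : ({a, b} : Finset Plane) ⊆ K) (h : IsHalfDisc K a b n ρ)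
    (huniq : ∀ L ∈ T.tri, {a, b} ⊆ L → L = K) : hull {a, b} ⊆ frontier Ω := by
  classical
  have haK : a ∈ K := hE (by simp)
  have hbK : b ∈ K := hE (by simp)
  obtain ⟨l, hl1, hl0, hlh, -, -, -⟩ := exists_barycentric (T.card_eq K hK) (T.indep K hK)
  have hopen : openSegment ℝ a b ⊆ frontier Ω := by
    intro y hy
    have hyE : y ∈ hull {a, b} := by
      simpa [hull] using openSegment_subset_segment ℝ a b hy
    have hyK : y ∈ hull K := convexHull_mono (by exact_mod_cast hE) hyE
    have hstar : y ∈ openStar {a, b} K := by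
      rw [openSegment_eq_image_lineMap] at hy
      obtain ⟨t, ⟨ht0, ht1⟩, rfl⟩ := hy
      refine mem_openStar_of_pos hE hl0 hyK fun v hv => ?_
      rw [AffineMap.apply_lineMap]
      rcases Finset.mem_insert.mp hv with rfl | hv
      · rw [hl1 v haK, hl0 v haK b hbK hab, AffineMap.lineMap_apply_module]
        simpa using ht1
      · rw [Finset.mem_singleton.mp hv, hl1 b hbK, hl0 b hbK a haK hab.symm,
          AffineMap.lineMap_apply_module]
        simpa using ht0
    have hyn : ⟪y - midpoint ℝ a b, n⟫ = 0 := by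
      rw [hull_pair_eq h.norm_eq h.perp] at hyE
      obtain ⟨s, -, rfl⟩ := hyE
      rw [line, add_sub_cancel_left, inner_smul_left, real_inner_comm, inner_tangent_self, mul_zero]
    refine ⟨T.hull_subset_closure hK hyK, fun hyΩ => ?_⟩
    rw [hΩ.interior_eq] at hyΩ
    -- near `y` the domain is covered by `K` alone, which lies on one side of the edge
    have hU : Ω ∩ (⋃ L ∈ T.tri.erase K, hull L)ᶜ ∈ 𝓝 y := by
      refine (hΩ.inter (isClosed_biUnion_hull _).isOpen_compl).mem_nhds ⟨hyΩ, fun hmem => ?_⟩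
      obtain ⟨L, hL, hyL⟩ := Set.mem_iUnion₂.mp hmem
      rw [Finset.mem_erase] at hL
      exact hL.1 (huniq L hL.2 (T.subset_of_mem_openStar hK hL.2 subset_rfl hstar hyL))
    obtain ⟨ε, hε, hsub⟩ := Metric.mem_nhds_iff.mp hU
    have hz : y + (ε / 2) • n ∈ Metric.ball y ε := by
      rw [Metric.mem_ball, dist_eq_norm]
      simp [norm_smul, h.norm_eq, abs_of_pos hε]
      exact hε
    obtain ⟨hzΩ, hzL⟩ := hsub hz
    have hzc := subset_closure hzΩ
    rw [← T.cover] at hzc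
    obtain ⟨L, hL, hzL'⟩ := Set.mem_iUnion₂.mp hzc
    by_cases hLK : L = K
    · rw [hLK] at hzL'
      have := h.inner_le _ hzL'
      rw [add_sub_right_comm, inner_add_left, hyn, inner_smul_left, real_inner_self_eq_norm_sq,
        h.norm_eq] at this
      simp at this
      linarith
    · exact hzL (Set.mem_biUnion (Finset.mem_erase.mpr ⟨hLK, hL⟩) hzL')
  have := closure_mono hopen
  rw [closure_openSegment, isClosed_frontier.closure_eq] at this
  simpa [hull] using this

/-- A boundary edge belongs to only one triangle. -/
lemma Problem.eq_of_subset_frontier (P : Problem) (T : Triangulation P.Ω) {κ : ℝ} (hκ : 0 < κ)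
    (hT : T.ShapeRegular κ) {K L : Finset Plane} (hK : K ∈ T.tri) (hL : L ∈ T.tri) {a b : Plane}
    (hab : a ≠ b) (hEK : ({a, b} : Finset Plane) ⊆ K) (hEL : ({a, b} : Finset Plane) ⊆ L)
    (hE : hull {a, b} ⊆ frontier P.Ω) : L = K := by
  by_contra hne
  have hr : 0 < dist a b / (2 * (κ + 1)) := div_pos (dist_pos.mpr hab) (by positivity)
  have hK' := T.isHalfDisc hκ hT hK hab hEK
  have hL' := T.isHalfDisc hκ hT hL hab hEL
  rw [T.normal_eq_neg hK hL (Ne.symm hne) hab hr hr hK' hL'] at hL'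
  have hsub : Metric.ball (midpoint ℝ a b) (dist a b / (2 * (κ + 1))) ⊆ P.Ω := by
    rw [← P.interior_closure]
    exact interior_maximal ((hK'.ball_subset hL').trans (Set.union_subset
      (T.hull_subset_closure hK) (T.hull_subset_closure hL))) Metric.isOpen_ball
  have hm : midpoint ℝ a b ∈ frontier P.Ω := hE (by
    simpa [hull] using midpoint_mem_segment (𝕜 := ℝ) a b)
  exact hm.2 (by rw [P.isOpen.interior_eq]; exact hsub (Metric.mem_ball_self hr))

lemma Triangulation.tri₂_spec {Ω : Set Plane} (hΩ : IsOpen Ω) (T : Triangulation Ω) {κ : ℝ}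
    (hκ : 0 < κ) (hT : T.ShapeRegular κ) {E : Finset Plane} (hE : E ∈ T.interiorEdges) :
    T.tri₂ E ∈ T.tri ∧ E ⊆ T.tri₂ E ∧ T.tri₂ E ≠ T.tri₁ E := by
  classical
  obtain ⟨hE, hEf⟩ := Finset.mem_filter.mp hE
  refine Classical.epsilon_spec (p := fun K => K ∈ T.tri ∧ E ⊆ K ∧ K ≠ T.tri₁ E) ?_
  by_contra hno
  push Not at hno
  obtain ⟨a, b, hab, rfl⟩ := T.exists_pair hE
  obtain ⟨h1, h2⟩ := T.tri₁_spec hE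
  exact hEf (T.subset_frontier hΩ h1 hab h2 (T.isHalfDisc hκ hT h1 hab h2) hno)

/-- At most two triangles share an edge. -/
lemma Triangulation.eq_or_eq {Ω : Set Plane} (T : Triangulation Ω) {κ : ℝ} (hκ : 0 < κ)
    (hT : T.ShapeRegular κ) {K K' L : Finset Plane} (hK : K ∈ T.tri) (hK' : K' ∈ T.tri)
    (hL : L ∈ T.tri) {a b : Plane} (hab : a ≠ b) (hEK : ({a, b} : Finset Plane) ⊆ K)
    (hEK' : ({a, b} : Finset Plane) ⊆ K') (hEL : ({a, b} : Finset Plane) ⊆ L) (hne : K ≠ K') :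
    L = K ∨ L = K' := by
  by_contra hno
  push Not at hno
  have hr : 0 < dist a b / (2 * (κ + 1)) := div_pos (dist_pos.mpr hab) (by positivity)
  have d := T.isHalfDisc hκ hT hK hab hEK
  have d' := T.isHalfDisc hκ hT hK' hab hEK'
  have dL := T.isHalfDisc hκ hT hL hab hEL
  have e1 := T.normal_eq_neg hK hK' hne hab hr hr d d'
  have e2 := T.normal_eq_neg hK hL (Ne.symm hno.1) hab hr hr d dL
  have e3 := T.normal_eq_neg hK' hL (Ne.symm hno.2) hab hr hr d' dL
  rw [e2, e1, neg_neg] at e3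
  have h0 : outerNormal K {a, b} = 0 := by
    have : (2 : ℝ) • outerNormal K {a, b} = 0 := by
      rw [two_smul]
      nth_rewrite 1 [← e3]
      exact neg_add_cancel _
    simpa using this
  have := d.norm_eq
  rw [h0, norm_zero] at this
  exact zero_ne_one this

/-! ### The error equation -/

lemma setIntegral_indicator_biUnion_hull (P : Problem) (T : Triangulation P.Ω)
    {s : Finset (Finset Plane)} (hs : s ⊆ T.tri) {G : Plane → ℝ}
    (hG : IntegrableOn G P.Ω) :
    ∫ x in P.Ω, (⋃ L ∈ s, hull L).indicator G x = ∑ L ∈ s, ∫ x in innerPart L, G x := by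
  have hA := (isClosed_biUnion_hull s).measurableSet
  have hae : (P.Ω ∩ ⋃ L ∈ s, hull L : Set Plane) =ᵐ[volume] (⋃ L ∈ s, innerPart L : Set Plane) := by
    have h1 : (⋃ L ∈ s, innerPart L : Set Plane) =ᵐ[volume] (⋃ L ∈ s, hull L : Set Plane) :=
      Filter.EventuallyEq.countable_bUnion s.countable_toSet fun L _ => innerPart_ae_eq_hull L
    have h2 := (ae_eq_refl P.Ω (μ := volume)).inter h1
    have h3 : P.Ω ∩ ⋃ L ∈ s, innerPart L = ⋃ L ∈ s, innerPart L :=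
      Set.inter_eq_right.mpr (Set.iUnion₂_subset fun L hL => P.innerPart_subset T (hs hL))
    rw [h3] at h2
    exact h2.symm
  rw [setIntegral_indicator hA, setIntegral_congr_set hae, integral_biUnion_finset]
  · exact fun L _ => isOpen_interior.measurableSet
  · exact fun L hL L' hL' hne => T.disjoint_innerPart (hs hL) (hs hL') hne
  · exact fun L hL => hG.mono_set (P.innerPart_subset T (hs hL))

lemma Material.integrable_density (mat : Material) {μ : Measure Plane}
    {H G : Plane → Matrix (Fin 2) (Fin 2) ℝ} (hH : ∀ i j, MemLp (fun x => H x i j) 2 μ)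
    (hG : ∀ i j, MemLp (fun x => G x i j) 2 μ) :
    Integrable (fun x => mat.density (H x) (G x)) μ := by
  have hp : ∀ {f g : Plane → ℝ}, MemLp f 2 μ → MemLp g 2 μ → Integrable (fun x => f x * g x) μ :=
    fun hf hg => hf.integrable_mul hg
  simp only [density_eq]
  refine Integrable.const_mul ?_ _
  refine (((hp (hH 0 0) (hG 0 0)).add ?_).add (hp (hH 1 1) (hG 1 1))).add ?_
  · exact (hp ((hH 0 1).add (hH 1 0)) ((hG 0 1).add (hG 1 0))).div_const 2
  · have := (hp ((hH 0 0).add (hH 1 1)) ((hG 0 0).add (hG 1 1))).const_mul (mat.ν / (1 - mat.ν))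
    refine this.congr (Eventually.of_forall fun x => ?_)
    simp only [Pi.add_apply]
    ring

/-- The Hessian of a smooth function. -/
def hess (φ : Plane → ℝ) (x : Plane) : Matrix (Fin 2) (Fin 2) ℝ :=
  Matrix.of fun i j => pd j (pd i φ) x

lemma memLp_hess {φ : Plane → ℝ} (hφ : ContDiff ℝ ∞ φ) (hc : HasCompactSupport φ)
    (μ : Measure Plane) [IsFiniteMeasureOnCompacts μ] (i j : Fin 2) :
    MemLp (fun x => hess φ x i j) 2 μ :=
  (contDiff_pd (contDiff_pd hφ)).continuous.memLp_of_hasCompactSupport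
    (hasCompactSupport_pd (hasCompactSupport_pd hc))

/-- On the support of a cut-off test function, the bilinear form sees only the triangles to which the
function is cut off, and there the weak Hessian of the test function is its classical one. -/
lemma Problem.bilin_indicator (P : Problem) (mat : Material) (T : Triangulation P.Ω)
    {s : Finset (Finset Plane)} (hs : s ⊆ T.tri) {u φ : Plane → ℝ} (hu : MemH2 P.Ω u)
    (hA : LocallyClopen P.Ω (⋃ L ∈ s, hull L) (tsupport φ)) (hφ : ContDiff ℝ ∞ φ)
    (hc : HasCompactSupport φ) :
    mat.bilin P.Ω u ((⋃ L ∈ s, hull L).indicator φ)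
      = ∑ L ∈ s, ∫ x in innerPart L, mat.density (weakHess P.Ω u x) (hess φ x) := by
  set A : Set Plane := ⋃ L ∈ s, hull L with hAd
  have hAm : MeasurableSet A := (isClosed_biUnion_hull s).measurableSet
  have hw : ∀ᵐ x ∂(volume.restrict P.Ω), weakHess P.Ω (A.indicator φ) x
      = A.indicator (hess φ) x := by
    have key := fun i j => hA.weakDeriv_weakDeriv P.isOpen hAm hφ i j
    filter_upwards [key 0 0, key 0 1, key 1 0, key 1 1] with x a b c d
    by_cases hx : x ∈ A
    · simp only [hx, Set.indicator_of_mem] at a b c d ⊢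
      ext i j
      fin_cases i <;> fin_cases j <;> simpa [weakHess, hess]
    · simp only [hx, not_false_eq_true, Set.indicator_of_notMem] at a b c d ⊢
      ext i j
      fin_cases i <;> fin_cases j <;> simpa [weakHess]
  have hI : IntegrableOn (fun x => mat.density (weakHess P.Ω u x) (hess φ x)) P.Ω :=
    mat.integrable_density (fun i j => (hu.weakDeriv_spec P.isOpen i j).2.2)
      (memLp_hess hφ hc _)
  rw [← setIntegral_indicator_biUnion_hull P T hs hI]
  refine integral_congr_ae ?_
  filter_upwards [hw] with x hx
  change mat.density (weakHess P.Ω u x) (weakHess P.Ω (A.indicator φ) x) = _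
  rw [hx]
  by_cases hxA : x ∈ A
  · rw [Set.indicator_of_mem hxA, Set.indicator_of_mem hxA]
  · rw [Set.indicator_of_notMem hxA, Set.indicator_of_notMem hxA, mat.density_zero]

/-- A piecewise polynomial function is represented by its local polynomials. -/
lemma Triangulation.IsPiecewisePoly.onElement {Ω : Set Plane} {T : Triangulation Ω} {k : ℕ}
    {v : Plane → ℝ} (hv : T.IsPiecewisePoly k v) {K : Finset Plane} (hK : K ∈ T.tri)
    (hint : (innerPart K).Nonempty) :
    IsPoly k (onElement K v) ∧ ∀ x ∈ hull K, v x = onElement K v x := by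
  obtain ⟨q, hq, hqv⟩ := hv K hK
  have hspec : ∀ y ∈ hull K, v y = (Classical.epsilon fun p : MvPolynomial (Fin 2) ℝ =>
      ∀ y ∈ hull K, v y = p.eval y).eval y :=
    Classical.epsilon_spec (p := fun p : MvPolynomial (Fin 2) ℝ => ∀ y ∈ hull K, v y = p.eval y)
      ⟨q, hqv⟩
  refine ⟨?_, hspec⟩
  set p := Classical.epsilon fun p : MvPolynomial (Fin 2) ℝ => ∀ y ∈ hull K, v y = p.eval y
    with hp
  have hpq : p = q := by
    obtain ⟨c, hc⟩ := hint
    obtain ⟨ε, hε, hsub⟩ := Metric.isOpen_iff.mp isOpen_interior c hc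
    have hinf : ∀ i, (Set.Ioo (c i) (c i + ε / 2)).Infinite := fun i =>
      Set.Ioo_infinite (by linarith)
    refine MvPolynomial.funext_set (fun i => Set.Ioo (c i) (c i + ε / 2)) hinf fun x hx => ?_
    have hxK : (WithLp.toLp 2 x : Plane) ∈ hull K := by
      refine interior_subset (hsub ?_)
      rw [Metric.mem_ball, dist_eq_norm]
      have h2 := norm_sq_plane (WithLp.toLp 2 x - c)
      have h0 := hx 0 (Set.mem_univ _)
      have h1 := hx 1 (Set.mem_univ _)
      simp only [PiLp.sub_apply, Set.mem_Ioo] at h0 h1 h2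
      have : ‖WithLp.toLp 2 x - c‖ ^ 2 < ε ^ 2 := by
        rw [h2]
        nlinarith
      exact lt_of_pow_lt_pow_left₀ 2 hε.le this
    have e1 := hspec _ hxK
    have e2 := hqv _ hxK
    exact e1.symm.trans e2
  exact ⟨p, hpq ▸ hq, fun x => rfl⟩

/-- The error equation for a test function `φ` supported near a face `F` of the triangulation. The
set `s` has to contain all triangles with the face `F`. A point load does not contribute, because it
acts at a node, and `F` has at least two vertices. -/
lemma Problem.error_equation (P : Problem) (mat : Material) (T : Triangulation P.Ω)
    (hfit : P.Fits T) {k : ℕ} {u uh : Plane → ℝ} (hu : P.IsSolution mat u) (huh : uh ∈ P.V)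
    (hpw : T.IsPiecewisePoly k uh) (hint : ∀ K ∈ T.tri, (innerPart K).Nonempty)
    {F : Finset Plane} (hF : 2 ≤ F.card) {s : Finset (Finset Plane)} (hs : s ⊆ T.tri)
    (hsF : ∀ L ∈ T.tri, F ⊆ L → L ∈ s) {φ : Plane → ℝ} (hφ : ContDiff ℝ ∞ φ)
    (hc : HasCompactSupport φ)
    (hD : ∀ L ∈ s, ∀ x ∈ tsupport φ, x ∈ hull L → x ∈ openStar F L)
    (h0 : ∀ᵐ x ∂(arc (P.Γc ∪ P.Γs)), (⋃ L ∈ s, hull L).indicator φ x = 0)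
    (h1 : ∀ i, ∀ᵐ x ∂(arc P.Γc), (⋃ L ∈ s, hull L).indicator (pd i φ) x = 0) :
    ∑ L ∈ s, ∫ x in innerPart L, mat.density (weakHess P.Ω (u - uh) x) (hess φ x)
      = (∑ L ∈ s, ∫ x in innerPart L, P.f x * φ x)
        + (∫ x, P.g x * (⋃ L ∈ s, hull L).indicator φ x ∂(arc P.S))
        - ∑ L ∈ s, ∫ x in innerPart L, mat.density (hess (onElement L uh) x) (hess φ x) := by
  set A : Set Plane := ⋃ L ∈ s, hull L with hAd
  have hA : LocallyClopen (closure P.Ω) A (tsupport φ) := T.locallyClopen hs hsF hD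
  have hAm : MeasurableSet A := (isClosed_biUnion_hull s).measurableSet
  have hV : A.indicator φ ∈ P.V := P.indicator_mem_V hA hAm hφ hc h0 h1
  have hA' : LocallyClopen P.Ω A (tsupport φ) := hA.mono subset_closure subset_rfl
  have huH : MemH2 P.Ω u := hu.1.2.1
  have huhH : MemH2 P.Ω uh := huh.2.1
  have heq := hu.2 _ hV
  rw [P.bilin_indicator mat T hs huH hA' hφ hc, Problem.load] at heq
  have hpoint : P.F * A.indicator φ P.x₀ = 0 := by
    by_cases hF0 : P.F = 0
    · rw [hF0, zero_mul]
    · have hn := hfit.point hF0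
      by_cases hxA : P.x₀ ∈ A
      · obtain ⟨L, hL, hxL⟩ := Set.mem_iUnion₂.mp hxA
        have hz : φ P.x₀ = 0 := image_eq_zero_of_notMem_tsupport fun hx =>
          T.notMem_nodes (hs hL) hF (hD L hL _ hx hxL) hn
        rw [Set.indicator_of_mem hxA, hz, mul_zero]
      · rw [Set.indicator_of_notMem hxA, mul_zero]
  have hload : ∫ x in P.Ω, P.f x * A.indicator φ x = ∑ L ∈ s, ∫ x in innerPart L, P.f x * φ x := by
    have hφL : MemLp φ 2 (volume.restrict P.Ω) :=
      hφ.continuous.memLp_of_hasCompactSupport hc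
    have hI : IntegrableOn (fun x => P.f x * φ x) P.Ω := P.f_mem.integrable_mul hφL
    rw [← setIntegral_indicator_biUnion_hull P T hs hI]
    refine integral_congr_ae (Eventually.of_forall fun x => ?_)
    by_cases hx : x ∈ A
    · simp only [← hAd, hx, Set.indicator_of_mem]
    · simp only [← hAd, hx, not_false_eq_true, Set.indicator_of_notMem, mul_zero]
  rw [hpoint, add_zero, hload] at heq
  rw [← heq, ← Finset.sum_sub_distrib]
  refine Finset.sum_congr rfl fun L hL => ?_
  obtain ⟨hp, hpv⟩ := hpw.onElement (hs hL) (hint L (hs hL))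
  have hLΩ := P.innerPart_subset T (hs hL)
  have e1 := ae_restrict_of_ae_restrict_of_subset hLΩ (huH.weakHess_sub P.isOpen huhH)
  have e2 := huhH.weakHess_eq P.isOpen isOpen_interior hLΩ hp.contDiff
    fun x hx => hpv x (interior_subset hx)
  have hm : ∀ {v : Plane → ℝ}, MemH2 P.Ω v →
      IntegrableOn (fun x => mat.density (weakHess P.Ω v x) (hess φ x)) (innerPart L) := fun hv =>
    mat.integrable_density
      (fun i j => ((hv.weakDeriv_spec P.isOpen i j).2.2).mono_measure
        (Measure.restrict_mono hLΩ le_rfl)) (memLp_hess hφ hc _)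
  have e3 : ∫ x in innerPart L, mat.density (hess (onElement L uh) x) (hess φ x)
      = ∫ x in innerPart L, mat.density (weakHess P.Ω uh x) (hess φ x) := by
    refine integral_congr_ae ?_
    filter_upwards [e2] with x hx
    rw [hx]
    rfl
  rw [e3, ← integral_sub (hm huH) (hm huhH)]
  refine integral_congr_ae ?_
  filter_upwards [e1] with x hx
  rw [hx, mat.density_sub]

/-! ### Cauchy-Schwarz estimates for scaled test functions -/

/-- The Cauchy-Schwarz inequality on a set of measure at most `R ^ 2`. -/
lemma setIntegral_abs_le {μ : Measure Plane} {h : Plane → ℝ} (hh : MemLp h 2 μ) {D : Set Plane}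
    (hD : MeasurableSet D) {R : ℝ} (hR : 0 ≤ R) (hμ : μ D ≤ ENNReal.ofReal (R ^ 2)) :
    ∫ x in D, |h x| ∂μ ≤ R * √(∫ x, h x ^ 2 ∂μ) := by
  have hfin : μ D ≠ ⊤ := ne_top_of_le_ne_top ENNReal.ofReal_ne_top hμ
  have hone : MemLp (D.indicator fun _ => (1 : ℝ)) (ENNReal.ofReal 2) μ :=
    memLp_indicator_const _ hD _ (Or.inr hfin)
  have h2 : MemLp h (ENNReal.ofReal 2) μ := by simpa using hh
  have key := integral_mul_norm_le_Lp_mul_Lq Real.HolderConjugate.two_two hone h2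
  have e1 : ∫ x, ‖D.indicator (fun _ => (1 : ℝ)) x‖ * ‖h x‖ ∂μ = ∫ x in D, |h x| ∂μ := by
    rw [← integral_indicator hD]
    refine integral_congr_ae (Eventually.of_forall fun x => ?_)
    by_cases hx : x ∈ D <;> simp [hx]
  have e2 : ∫ x, ‖D.indicator (fun _ => (1 : ℝ)) x‖ ^ (2 : ℝ) ∂μ = μ.real D := by
    rw [← integral_indicator_one hD]
    refine integral_congr_ae (Eventually.of_forall fun x => ?_)
    by_cases hx : x ∈ D <;> simp [hx]
  have e3 : ∫ x, ‖h x‖ ^ (2 : ℝ) ∂μ = ∫ x, h x ^ 2 ∂μ :=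
    integral_congr_ae (Eventually.of_forall fun x => by simp)
  rw [e1, e2, e3, ← Real.sqrt_eq_rpow, ← Real.sqrt_eq_rpow] at key
  refine key.trans (mul_le_mul_of_nonneg_right ?_ (Real.sqrt_nonneg _))
  refine Real.sqrt_le_iff.mpr ⟨hR, ?_⟩
  exact ENNReal.toReal_le_of_le_ofReal (sq_nonneg R) hμ

lemma abs_integral_mul_le {μ : Measure Plane} {h φ : Plane → ℝ} (hh : MemLp h 2 μ) {D : Set Plane}
    (hD : MeasurableSet D) {B R : ℝ} (hB : 0 ≤ B) (hR : 0 ≤ R)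
    (hμ : μ D ≤ ENNReal.ofReal (R ^ 2)) (hφ : ∀ x, |φ x| ≤ B) (h0 : ∀ x ∉ D, φ x = 0) :
    |∫ x, h x * φ x ∂μ| ≤ B * R * √(∫ x, h x ^ 2 ∂μ) := by
  have hfin : IsFiniteMeasure (μ.restrict D) :=
    ⟨by rw [Measure.restrict_apply_univ]; exact lt_of_le_of_lt hμ ENNReal.ofReal_lt_top⟩
  have hint : IntegrableOn (fun x => |h x|) D μ :=
    ((hh.restrict D).integrable (by norm_num)).abs
  have hbound : ‖∫ x, h x * φ x ∂μ‖ ≤ ∫ x, D.indicator (fun x => B * |h x|) x ∂μ := by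
    refine norm_integral_le_of_norm_le ((integrable_indicator_iff hD).mpr (hint.const_mul B))
      (Eventually.of_forall fun x => ?_)
    by_cases hx : x ∈ D
    · rw [Set.indicator_of_mem hx, Real.norm_eq_abs, abs_mul, mul_comm]
      exact mul_le_mul_of_nonneg_right (hφ x) (abs_nonneg _)
    · rw [Set.indicator_of_notMem hx, h0 x hx, mul_zero, norm_zero]
  rw [Real.norm_eq_abs, integral_indicator hD, integral_const_mul] at hbound
  refine hbound.trans ?_
  rw [mul_assoc]
  exact mul_le_mul_of_nonneg_left (setIntegral_abs_le hh hD hR hμ) hB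

lemma volume_closedBall_le (c : Plane) {r : ℝ} (hr : 0 ≤ r) :
    volume (Metric.closedBall c r) ≤ ENNReal.ofReal ((2 * r) ^ 2) := by
  rw [EuclideanSpace.volume_closedBall_fin_two c r, ← ENNReal.ofReal_pow hr,
    ← ENNReal.ofReal_mul (by positivity)]
  refine ENNReal.ofReal_le_ofReal ?_
  nlinarith [Real.pi_le_four, sq_nonneg r]

/-- `φ` is a smooth function supported in the interior of the disc of radius `r` around `c` that is,
together with its second derivatives, bounded as a function of height `B` at length scale `r`. -/
structure IsTestFunction (c : Plane) (r B : ℝ) (φ : Plane → ℝ) : Prop where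
  contDiff : ContDiff ℝ ∞ φ
  tsupport_subset : tsupport φ ⊆ Metric.closedBall c (3 / 4 * r)
  abs_le : ∀ x, |φ x| ≤ B
  abs_pd_le : ∀ x i j, |pd j (pd i φ) x| ≤ B / r ^ 2

namespace IsTestFunction

variable {c : Plane} {r B : ℝ} {φ : Plane → ℝ}

lemma hasCompactSupport (h : IsTestFunction c r B φ) : HasCompactSupport φ :=
  (isCompact_closedBall c _).of_isClosed_subset (isClosed_tsupport φ) h.tsupport_subset

lemma nonneg (h : IsTestFunction c r B φ) : 0 ≤ B := (abs_nonneg _).trans (h.abs_le c)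

lemma tsupport_subset_ball (h : IsTestFunction c r B φ) (hr : 0 < r) :
    tsupport φ ⊆ Metric.ball c r :=
  h.tsupport_subset.trans (Metric.closedBall_subset_ball (by linarith))

lemma abs_setIntegral_mul_le (h : IsTestFunction c r B φ) (hr : 0 < r) {U : Set Plane}
    {f : Plane → ℝ} (hf : MemLp f 2 (volume.restrict U)) :
    |∫ x in U, f x * φ x| ≤ 2 * r * B * √(∫ x in U, f x ^ 2) := by
  have := abs_integral_mul_le hf Metric.isClosed_closedBall.measurableSet h.nonneg
    (by positivity : 0 ≤ 2 * r)
    ((Measure.restrict_apply_le _ _).trans (volume_closedBall_le c hr.le)) h.abs_le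
    fun x hx => image_eq_zero_of_notMem_tsupport fun hx' =>
      hx (Metric.ball_subset_closedBall (h.tsupport_subset_ball hr hx'))
  linarith

lemma hess_eq_zero (h : IsTestFunction c r B φ) (hr : 0 < r) {x : Plane}
    (hx : x ∉ Metric.closedBall c r) : hess φ x = 0 := by
  have h' : x ∉ tsupport φ := fun hx' =>
    hx (Metric.ball_subset_closedBall (h.tsupport_subset_ball hr hx'))
  ext i j
  change pd j (pd i φ) x = 0
  exact image_eq_zero_of_notMem_tsupport fun hx' =>
    h' (tsupport_pd_subset _ _ (tsupport_pd_subset _ _ hx'))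

/-- The factor `B / r` arises from the second derivatives of size `B / r ^ 2` and the square root of
the area of the disc. -/
lemma abs_setIntegral_density_le (h : IsTestFunction c r B φ) (hr : 0 < r) (mat : Material)
    {U : Set Plane} {H : Plane → Matrix (Fin 2) (Fin 2) ℝ}
    (hH : ∀ i j, MemLp (fun x => H x i j) 2 (volume.restrict U)) :
    |∫ x in U, mat.density (H x) (hess φ x)|
      ≤ 16 * mat.densityBound * (B / r) * √(∑ i, ∑ j, ∫ x in U, H x i j ^ 2) := by
  set D := Metric.closedBall c r with hDd
  have hD : MeasurableSet D := Metric.isClosed_closedBall.measurableSet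
  set e := ∑ i, ∑ j, ∫ x in U, H x i j ^ 2 with he
  have hvol : (volume.restrict U) D ≤ ENNReal.ofReal ((2 * r) ^ 2) :=
    (Measure.restrict_apply_le _ _).trans (volume_closedBall_le c hr.le)
  have hfin : IsFiniteMeasure ((volume.restrict U).restrict D) :=
    ⟨by rw [Measure.restrict_apply_univ]; exact lt_of_le_of_lt hvol ENNReal.ofReal_lt_top⟩
  have hint : ∀ i j, Integrable (fun x => |H x i j|) ((volume.restrict U).restrict D) := fun i j =>
    (((hH i j).restrict D).integrable (by norm_num)).abs
  have hsum : Integrable (fun x => ∑ i, ∑ j, |H x i j|) ((volume.restrict U).restrict D) :=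
    integrable_finsetSum _ fun i _ => integrable_finsetSum _ fun j _ => hint i j
  have hb0 : 0 ≤ mat.densityBound := by
    rw [Material.densityBound]
    positivity
  have hbound : ‖∫ x in U, mat.density (H x) (hess φ x)‖ ≤ ∫ x in U,
      D.indicator (fun x => mat.densityBound * (2 * (B / r ^ 2)) * ∑ i, ∑ j, |H x i j|) x := by
    refine norm_integral_le_of_norm_le ((integrable_indicator_iff hD).mpr (hsum.const_mul _))
      (Eventually.of_forall fun x => ?_)
    by_cases hx : x ∈ D
    · rw [Set.indicator_of_mem hx, Real.norm_eq_abs]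
      have := mat.abs_density_le (H x) (hess φ x) (fun i j => h.abs_pd_le x i j)
      linarith
    · rw [Set.indicator_of_notMem hx, h.hess_eq_zero hr hx, mat.density_zero, norm_zero]
  rw [Real.norm_eq_abs, integral_indicator hD, integral_const_mul,
    integral_finsetSum _ fun i _ => integrable_finsetSum _ fun j _ => hint i j] at hbound
  have hterm : ∀ i j, ∫ x in D, |H x i j| ∂(volume.restrict U) ≤ 2 * r * √e := by
    intro i j
    refine (setIntegral_abs_le (hH i j) hD (by positivity) hvol).trans ?_
    refine mul_le_mul_of_nonneg_left (Real.sqrt_le_sqrt ?_) (by positivity)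
    have hnn : ∀ i j, 0 ≤ ∫ x in U, H x i j ^ 2 := fun i j =>
      integral_nonneg fun x => sq_nonneg _
    calc ∫ x in U, H x i j ^ 2 ≤ ∑ j, ∫ x in U, H x i j ^ 2 :=
          Finset.single_le_sum (f := fun j => ∫ x in U, H x i j ^ 2) (fun j _ => hnn i j)
            (Finset.mem_univ j)
      _ ≤ e := Finset.single_le_sum (f := fun i => ∑ j, ∫ x in U, H x i j ^ 2)
            (fun i _ => Finset.sum_nonneg fun j _ => hnn i j) (Finset.mem_univ i)
  have hB := h.nonneg
  refine hbound.trans ?_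
  have h4 : ∑ i, ∫ x in D, ∑ j, |H x i j| ∂(volume.restrict U) ≤ 4 * (2 * r * √e) := by
    have : ∀ i, ∫ x in D, ∑ j, |H x i j| ∂(volume.restrict U) ≤ 2 * (2 * r * √e) := by
      intro i
      rw [integral_finsetSum _ fun j _ => hint i j, Fin.sum_univ_two]
      linarith [hterm i 0, hterm i 1]
    rw [Fin.sum_univ_two]
    linarith [this 0, this 1]
  calc _ ≤ mat.densityBound * (2 * (B / r ^ 2)) * (4 * (2 * r * √e)) :=
        mul_le_mul_of_nonneg_left h4 (by positivity)
    _ = _ := by field_simp; ring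

end IsTestFunction

lemma pd_sum {ι : Type*} [Fintype ι] {k : Fin 2} (v : ι → ℝ) {f : ι → Plane → ℝ}
    (hf : ∀ i, Differentiable ℝ (f i)) :
    pd k (fun x => ∑ i, v i * f i x) = fun x => ∑ i, v i * pd k (f i) x := by
  ext x
  simp only [pd]
  rw [fderiv_fun_sum fun i _ => (hf i x).const_mul (v i), sum_apply]
  refine Finset.sum_congr rfl fun i _ => ?_
  rw [fderiv_const_mul (hf i x), smul_apply, smul_eq_mul]

/-- Scaled bubble functions are test functions. -/
lemma isTestFunction_sum {N : ℕ} {W : ℝ} (hW : ∀ a ≤ N, ∀ b ≤ N, ∀ y,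
    |bubble a b y| ≤ W ∧ ∀ i j, |pd j (pd i (bubble a b)) y| ≤ W) {c n : Plane} (hn : ‖n‖ = 1)
    {r : ℝ} (hr : 0 < r) {ι : Type*} [Fintype ι] (α β : ι → ℕ) (hα : ∀ i, α i ≤ N)
    (hβ : ∀ i, β i ≤ N) (v : ι → ℝ) :
    IsTestFunction c r (4 * W * ∑ i, |v i|)
      fun x => ∑ i, v i * bubble (α i) (β i) (toRef c n r x) := by
  have hsm : ∀ i, ContDiff ℝ ∞ fun x => bubble (α i) (β i) (toRef c n r x) := fun i =>
    contDiff_comp_toRef (contDiff_bubble _ _) c n r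
  have hts : ∀ i, tsupport (fun x => bubble (α i) (β i) (toRef c n r x))
      ⊆ Metric.closedBall c (3 / 4 * r) := fun i =>
    tsupport_comp_toRef (tsupport_bubble _ _) c n hn hr
  have hpd : ∀ x k l, pd l (pd k fun x => ∑ i, v i * bubble (α i) (β i) (toRef c n r x)) x
      = ∑ i, v i * pd l (pd k fun x => bubble (α i) (β i) (toRef c n r x)) x := fun x k l => by
    rw [pd_sum v fun i => (hsm i).differentiable (by simp),
      pd_sum v fun i => (contDiff_pd (hsm i)).differentiable (by simp)]
  have hW0 : 0 ≤ W := (abs_nonneg _).trans (hW 0 (Nat.zero_le _) 0 (Nat.zero_le _) 0).1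
  refine ⟨ContDiff.sum fun i _ => contDiff_const.mul (hsm i), ?_, fun x => ?_, fun x k l => ?_⟩
  · refine closure_minimal (fun x hx => ?_) Metric.isClosed_closedBall
    by_contra hxc
    refine hx (Finset.sum_eq_zero fun i _ => ?_)
    rw [image_eq_zero_of_notMem_tsupport (f := fun x => bubble (α i) (β i) (toRef c n r x))
      (fun h => hxc (hts i h)), mul_zero]
  · refine (Finset.abs_sum_le_sum_abs _ _).trans ?_
    rw [Finset.mul_sum]
    refine Finset.sum_le_sum fun i _ => ?_
    rw [abs_mul]
    nlinarith [(hW (α i) (hα i) (β i) (hβ i) (toRef c n r x)).1, abs_nonneg (v i),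
      mul_nonneg hW0 (abs_nonneg (v i))]
  · rw [hpd]
    refine (Finset.abs_sum_le_sum_abs _ _).trans ?_
    rw [Finset.mul_sum, Finset.sum_div]
    refine Finset.sum_le_sum fun i _ => ?_
    rw [abs_mul]
    have := abs_pd_pd_comp_toRef_le (contDiff_bubble (α i) (β i)) c n hn hr
      (fun y => (hW (α i) (hα i) (β i) (hβ i) y).2) x k l
    calc _ ≤ |v i| * (4 * W / r ^ 2) := mul_le_mul_of_nonneg_left this (abs_nonneg _)
      _ = _ := by ring

/-! ### The residual of the discrete solution -/

/-- The boundary terms in the second Green formula on a half plane that is bounded by the line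
through `m` with outer unit normal `n`. -/
def Material.lineTerm (mat : Material) (p φ : Plane → ℝ) (m n : Plane) : ℝ :=
  ∫ s, (mat.Vn p n (line m (tangent n) s) * φ (line m (tangent n) s)
    - mat.Mnn p n (line m (tangent n) s) * fderiv ℝ φ (line m (tangent n) s) n)

lemma setIntegral_eq_of_ball {U U' : Set Plane} (hU : MeasurableSet U) (hU' : MeasurableSet U')
    {F : Plane → ℝ} {c : Plane} {r : ℝ} (hF : ∀ x ∉ Metric.ball c r, F x = 0)
    (h : ∀ x ∈ Metric.ball c r, x ∈ U ↔ x ∈ U') : ∫ x in U, F x = ∫ x in U', F x := by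
  rw [← integral_indicator hU, ← integral_indicator hU']
  congr 1
  ext x
  classical
  rw [Set.indicator_apply, Set.indicator_apply]
  by_cases hx : x ∈ Metric.ball c r
  · simp only [h x hx]
  · rw [hF x hx, ite_self, ite_self]

lemma IsTestFunction.eq_zero {c : Plane} {r B : ℝ} {φ : Plane → ℝ} (h : IsTestFunction c r B φ)
    (hr : 0 < r) {x : Plane} (hx : x ∉ Metric.ball c r) : φ x = 0 :=
  image_eq_zero_of_notMem_tsupport fun hx' => hx (h.tsupport_subset_ball hr hx')

lemma Material.setIntegral_innerPart_density (mat : Material) {p φ : Plane → ℝ}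
    (hp : ContDiff ℝ ∞ p) {c : Plane} {r B : ℝ} (hr : 0 < r) (hφ : IsTestFunction c r B φ)
    {m n : Plane} (hn : ‖n‖ = 1) {L : Finset Plane}
    (hL : ∀ y ∈ Metric.ball c r, y ∈ innerPart L ↔ y ∈ halfPlane m n) :
    ∫ x in innerPart L, mat.density (hess p x) (hess φ x)
      = (∫ x in innerPart L, mat.plateOp p x * φ x) + mat.lineTerm p φ m n := by
  have hLm : MeasurableSet (innerPart L) := isOpen_interior.measurableSet
  have hhm : MeasurableSet (halfPlane m n) := (isOpen_halfPlane m n).measurableSet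
  rw [setIntegral_eq_of_ball hLm hhm (c := c) (r := r) ?_ hL,
    setIntegral_eq_of_ball (F := fun x => mat.plateOp p x * φ x) hLm hhm (c := c) (r := r) ?_ hL]
  · exact mat.setIntegral_halfPlane_density hp hφ.contDiff hφ.hasCompactSupport m n hn
  · exact fun x hx => by rw [hφ.eq_zero hr hx, mul_zero]
  · intro x hx
    have : hess φ x = 0 := by
      ext i j
      change pd j (pd i φ) x = 0
      exact image_eq_zero_of_notMem_tsupport fun hx' => hx (hφ.tsupport_subset_ball hr
        (tsupport_pd_subset _ _ (tsupport_pd_subset _ _ hx')))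
    rw [this, mat.density_zero]

/-- `u` is the deflection of the plate, and `uh` is an admissible approximation of it by piecewise
polynomials on a shape regular mesh. -/
structure IsApproximation (P : Problem) (mat : Material) (T : Triangulation P.Ω) (κ : ℝ) (k : ℕ)
    (u uh : Plane → ℝ) : Prop where
  one_le : 1 ≤ κ
  regular : T.ShapeRegular κ
  fits : P.Fits T
  solution : P.IsSolution mat u
  mem_V : uh ∈ P.V
  poly : T.IsPiecewisePoly k uh

/-- The squared norm of the second derivatives of `e` on the triangle `L`. -/
def Problem.energy (P : Problem) (e : Plane → ℝ) (L : Finset Plane) : ℝ :=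
  ∑ i, ∑ j, ∫ x in innerPart L, weakHess P.Ω e x i j ^ 2

lemma Problem.energy_nonneg (P : Problem) (e : Plane → ℝ) (L : Finset Plane) :
    0 ≤ P.energy e L :=
  Finset.sum_nonneg fun _ _ => Finset.sum_nonneg fun _ _ => integral_nonneg fun _ => sq_nonneg _

lemma Triangulation.ShapeRegular.nonempty_innerPart {Ω : Set Plane} {T : Triangulation Ω} {κ : ℝ}
    (hT : T.ShapeRegular κ) {K : Finset Plane} (hK : K ∈ T.tri) : (innerPart K).Nonempty := by
  obtain ⟨c, ρ, hρ, hsub, -⟩ := hT K hK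
  exact ⟨c, interior_maximal (Metric.ball_subset_closedBall.trans hsub) Metric.isOpen_ball
    (Metric.mem_ball_self hρ)⟩

variable {P : Problem} {mat : Material} {T : Triangulation P.Ω} {κ : ℝ} {k : ℕ} {u uh : Plane → ℝ}

lemma IsApproximation.isPoly (G : IsApproximation P mat T κ k u uh) {K : Finset Plane}
    (hK : K ∈ T.tri) : IsPoly k (onElement K uh) :=
  (G.poly.onElement hK (G.regular.nonempty_innerPart hK)).1

lemma memLp_innerPart {P : Problem} {T : Triangulation P.Ω} {K : Finset Plane} (hK : K ∈ T.tri)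
    {h : Plane → ℝ} (hh : MemLp h 2 (volume.restrict P.Ω)) :
    MemLp h 2 (volume.restrict (innerPart K)) :=
  hh.mono_measure (Measure.restrict_mono (P.innerPart_subset T hK) le_rfl)

lemma memLp_innerPart_of_continuous {F : Plane → ℝ} (hF : Continuous F) (K : Finset Plane) :
    MemLp F 2 (volume.restrict (innerPart K)) := by
  obtain ⟨C, hC⟩ := (isCompact_hull K).exists_bound_of_continuousOn hF.continuousOn
  have hfin : IsFiniteMeasure (volume.restrict (hull K)) :=
    ⟨by rw [Measure.restrict_apply_univ]; exact (isCompact_hull K).measure_lt_top⟩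
  refine MemLp.mono_measure (Measure.restrict_mono interior_subset le_rfl)
    (MemLp.of_bound hF.aestronglyMeasurable C ?_ : MemLp F 2 (volume.restrict (hull K)))
  filter_upwards [ae_restrict_mem (isClosed_hull K).measurableSet] with x hx using hC x hx

/-- The element and edge residuals, tested with a function that is supported near a face of the
mesh, are bounded by the error. -/
lemma IsApproximation.abs_residual_le (G : IsApproximation P mat T κ k u uh)
    {F : Finset Plane} (hF : 2 ≤ F.card) {s : Finset (Finset Plane)} (hs : s ⊆ T.tri)
    (hsF : ∀ L ∈ T.tri, F ⊆ L → L ∈ s) {c : Plane} {r B : ℝ} (hr : 0 < r) {φ : Plane → ℝ}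
    (hφ : IsTestFunction c r B φ)
    (hD : ∀ L ∈ s, ∀ x ∈ Metric.ball c r, x ∈ hull L → x ∈ openStar F L)
    {m n : Finset Plane → Plane} (hn : ∀ L ∈ s, ‖n L‖ = 1)
    (hhalf : ∀ L ∈ s, ∀ y ∈ Metric.ball c r, y ∈ innerPart L ↔ y ∈ halfPlane (m L) (n L))
    (h0 : ∀ᵐ x ∂(arc (P.Γc ∪ P.Γs)), (⋃ L ∈ s, hull L).indicator φ x = 0)
    (h1 : ∀ i, ∀ᵐ x ∂(arc P.Γc), (⋃ L ∈ s, hull L).indicator (pd i φ) x = 0) :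
    |(∑ L ∈ s, ∫ x in innerPart L, (mat.plateOp (onElement L uh) x - P.f x) * φ x)
        + (∑ L ∈ s, mat.lineTerm (onElement L uh) φ (m L) (n L))
        - ∫ x, P.g x * (⋃ L ∈ s, hull L).indicator φ x ∂(arc P.S)|
      ≤ 16 * mat.densityBound * (B / r) * ∑ L ∈ s, √(P.energy (u - uh) L) := by
  have heq := P.error_equation mat T G.fits G.solution G.mem_V G.poly
    (fun K hK => G.regular.nonempty_innerPart hK) hF hs hsF hφ.contDiff hφ.hasCompactSupport
    (fun L hL x hx => hD L hL x (hφ.tsupport_subset_ball hr hx)) h0 h1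
  have hgreen : ∀ L ∈ s, ∫ x in innerPart L, mat.density (hess (onElement L uh) x) (hess φ x)
      = (∫ x in innerPart L, (mat.plateOp (onElement L uh) x - P.f x) * φ x)
        + (∫ x in innerPart L, P.f x * φ x)
        + mat.lineTerm (onElement L uh) φ (m L) (n L) := by
    intro L hL
    have hp := (G.isPoly (hs hL)).contDiff
    have hφL : MemLp φ 2 (volume.restrict (innerPart L)) :=
      memLp_innerPart_of_continuous hφ.contDiff.continuous L
    have hfL := memLp_innerPart (hs hL) P.f_mem
    have hpL := memLp_innerPart_of_continuous (mat.contDiff_plateOp hp).continuous L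
    have i1 : Integrable (fun x => (mat.plateOp (onElement L uh) x - P.f x) * φ x)
        (volume.restrict (innerPart L)) := (hpL.sub hfL).integrable_mul hφL
    have i2 : Integrable (fun x => P.f x * φ x) (volume.restrict (innerPart L)) :=
      hfL.integrable_mul hφL
    rw [mat.setIntegral_innerPart_density hp hr hφ (hn L hL) (hhalf L hL), ← integral_add i1 i2]
    congr 2
    ext x
    ring
  rw [Finset.sum_congr rfl hgreen, Finset.sum_add_distrib, Finset.sum_add_distrib] at heq
  have hbound : |∑ L ∈ s, ∫ x in innerPart L, mat.density (weakHess P.Ω (u - uh) x) (hess φ x)|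
      ≤ 16 * mat.densityBound * (B / r) * ∑ L ∈ s, √(P.energy (u - uh) L) := by
    refine (Finset.abs_sum_le_sum_abs _ _).trans ?_
    rw [Finset.mul_sum]
    refine Finset.sum_le_sum fun L hL => hφ.abs_setIntegral_density_le hr mat fun i j => ?_
    have hu : MemH2 P.Ω u := G.solution.1.2.1
    have huh : MemH2 P.Ω uh := G.mem_V.2.1
    refine memLp_innerPart (hs hL) ?_
    refine (((hu.weakDeriv_spec P.isOpen i j).2.2).sub
      ((huh.weakDeriv_spec P.isOpen i j).2.2)).ae_eq ?_
    filter_upwards [hu.weakHess_sub P.isOpen huh] with x hx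
    rw [hx]
    rfl
  refine le_trans (le_of_eq ?_) hbound
  rw [heq, ← abs_neg]
  congr 1
  ring

/-! ### The element residuals -/

lemma abs_sum_monom_le {N : ℕ} (v : Fin (N + 1) × Fin (N + 1) → ℝ) {R : ℝ} (hR : 1 ≤ R) {y : Plane}
    (hy : ‖y‖ ≤ R) : |∑ a, v a * monom a.1 a.2 y| ≤ R ^ (2 * N) * ∑ a, |v a| := by
  refine (Finset.abs_sum_le_sum_abs _ _).trans ?_
  rw [Finset.mul_sum]
  refine Finset.sum_le_sum fun a _ => ?_
  have hc : ∀ (i : Fin 2) (b : Fin (N + 1)), |y i ^ (b : ℕ)| ≤ R ^ N := fun i b => by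
    have h1 : |y i| ≤ R := (PiLp.norm_apply_le y i).trans hy
    rw [abs_pow]
    exact (pow_le_pow_left₀ (abs_nonneg _) h1 _).trans
      (pow_le_pow_right₀ hR (Nat.lt_succ_iff.mp b.2))
  rw [abs_mul, monom, abs_mul, mul_comm, two_mul, pow_add]
  exact mul_le_mul_of_nonneg_right
    (mul_le_mul (hc 0 a.1) (hc 1 a.2) (abs_nonneg _) (by positivity)) (abs_nonneg _)

lemma densityBound_nonneg (mat : Material) : 0 ≤ mat.densityBound := by
  rw [Material.densityBound]
  positivity

/-- The oscillation of `f` on the triangle `K`, without its weight. -/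
def Problem.oscSq (P : Problem) (q : MvPolynomial (Fin 2) ℝ) (K : Finset Plane) : ℝ :=
  ∫ x in innerPart K, (P.f x - q.eval x) ^ 2

lemma Problem.oscSq_nonneg (P : Problem) (q : MvPolynomial (Fin 2) ℝ) (K : Finset Plane) :
    0 ≤ P.oscSq q K := integral_nonneg fun _ => sq_nonneg _

lemma IsSegmentUnion.measurableSet {Γ : Set Plane} (h : IsSegmentUnion Γ) : MeasurableSet Γ := by
  obtain ⟨s, rfl⟩ := h
  refine Finset.measurableSet_biUnion _ fun e _ => ?_
  rw [← convexHull_pair (𝕜 := ℝ)]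
  exact ((Set.toFinite {e.1, e.2}).isClosed_convexHull ℝ).measurableSet

lemma Triangulation.mem_edges_of_mem_lineEdges {Ω S : Set Plane} (T : Triangulation Ω)
    {E : Finset Plane} (h : E ∈ T.lineEdges S) : E ∈ T.interiorEdges ∧ E ∈ T.edges := by
  classical
  have h1 := (Finset.mem_filter.mp h).1
  exact ⟨h1, (Finset.mem_filter.mp h1).1⟩

lemma Triangulation.card_of_mem_edges {Ω : Set Plane} (T : Triangulation Ω)
    {E : Finset Plane} (h : E ∈ T.edges) : E.card = 2 := by
  obtain ⟨a, b, hab, rfl⟩ := T.exists_pair h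
  exact Finset.card_pair hab

variable {P : Problem} {mat : Material} {T : Triangulation P.Ω} {κ : ℝ} {k : ℕ} {u uh : Plane → ℝ}

/-- The line load is not seen by a test function that is supported near a face which is not one of
the edges on the line. -/
lemma IsApproximation.lineLoad_eq_zero (G : IsApproximation P mat T κ k u uh) {F : Finset Plane}
    (hF : 2 ≤ F.card) (hFS : F ∉ T.lineEdges P.S) {s : Finset (Finset Plane)} (hs : s ⊆ T.tri)
    {φ : Plane → ℝ} (hD : ∀ L ∈ s, ∀ x ∈ tsupport φ, x ∈ hull L → x ∈ openStar F L) :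
    ∫ x, P.g x * (⋃ L ∈ s, hull L).indicator φ x ∂(arc P.S) = 0 := by
  refine integral_eq_zero_of_ae ?_
  have hS : MeasurableSet P.S := by
    rw [G.fits.line]
    exact (isClosed_biUnion_hull _).measurableSet
  filter_upwards [ae_restrict_mem hS] with x hx
  rw [G.fits.line] at hx
  obtain ⟨E, hE, hxE⟩ := Set.mem_iUnion₂.mp hx
  by_cases hxA : x ∈ ⋃ L ∈ s, hull L
  · obtain ⟨L, hL, hxL⟩ := Set.mem_iUnion₂.mp hxA
    have hz : φ x = 0 := image_eq_zero_of_notMem_tsupport fun hxφ => by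
      have := T.eq_of_mem_openStar (hs hL) hF (T.mem_edges_of_mem_lineEdges hE).2
        (hD L hL x hxφ hxL) hxE
      exact hFS (this ▸ hE)
    rw [Set.indicator_of_mem hxA, hz, mul_zero]
    rfl
  · rw [Set.indicator_of_notMem hxA, mul_zero]
    rfl

lemma IsApproximation.lineLoad_eq (G : IsApproximation P mat T κ k u uh) {E : Finset Plane}
    (hES : E ∈ T.lineEdges P.S) {s : Finset (Finset Plane)} (hs : s ⊆ T.tri)
    {φ : Plane → ℝ} (hD : ∀ L ∈ s, ∀ x ∈ tsupport φ, x ∈ hull L → x ∈ openStar E L)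
    (hEs : ∃ L ∈ s, E ⊆ L) :
    ∫ x, P.g x * (⋃ L ∈ s, hull L).indicator φ x ∂(arc P.S)
      = ∫ x, P.g x * φ x ∂(arc (hull E)) := by
  have hEe := (T.mem_edges_of_mem_lineEdges hES).2
  classical
  have hESsub : hull E ⊆ P.S := (Finset.mem_filter.mp hES).2
  have hEm : MeasurableSet (hull E) := (isClosed_hull E).measurableSet
  obtain ⟨L₀, hL₀, hEL₀⟩ := hEs
  have hS : MeasurableSet P.S := by
    rw [G.fits.line]
    exact (isClosed_biUnion_hull _).measurableSet
  rw [arc, arc, ← Set.inter_eq_self_of_subset_right hESsub, ← setIntegral_indicator hEm]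
  refine integral_congr_ae ?_
  filter_upwards [ae_restrict_mem hS] with x hx
  by_cases hxE : x ∈ hull E
  · have hxA : x ∈ ⋃ L ∈ s, hull L :=
      Set.mem_iUnion₂.mpr ⟨L₀, hL₀, convexHull_mono (by exact_mod_cast hEL₀) hxE⟩
    rw [Set.indicator_of_mem hxA, Set.indicator_of_mem hxE]
  · rw [Set.indicator_of_notMem hxE]
    rw [G.fits.line] at hx
    obtain ⟨E', hE', hxE'⟩ := Set.mem_iUnion₂.mp hx
    by_cases hxA : x ∈ ⋃ L ∈ s, hull L
    · obtain ⟨L, hL, hxL⟩ := Set.mem_iUnion₂.mp hxA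
      have hz : φ x = 0 := image_eq_zero_of_notMem_tsupport fun hxφ => by
        have := T.eq_of_mem_openStar (hs hL) (T.card_of_mem_edges hEe).ge
          (T.mem_edges_of_mem_lineEdges hE').2 (hD L hL x hxφ hxL) hxE'
        exact hxE (this ▸ hxE')
      rw [Set.indicator_of_mem hxA, hz, mul_zero]
    · rw [Set.indicator_of_notMem hxA, mul_zero]

/-- The algebra behind the bound of the element residual `q = A(uh) - fh`. Here `V` is the sum of the
moduli of the coefficients of `q`. The quadratic lower bound by `V ^ 2` that results from testing
with a multiple of `q` meets an upper bound that is linear in `V`, as the test function is. -/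
lemma le_sq_of_quadratic {c r V W e o β : ℝ} (hc : 0 < c) (hr : 0 < r) (hV : 0 ≤ V)
    (he : 0 ≤ e) (ho : 0 ≤ o)
    (h : c * (r ^ 2 * V ^ 2) ≤ 4 * W * V * (β / r * √e + 2 * r * √o)) :
    c ^ 2 * (r ^ 6 * V ^ 2) ≤ 32 * W ^ 2 * (β ^ 2 * e + 4 * (r ^ 4 * o)) := by
  rcases hV.eq_or_lt with rfl | hV
  · have : 0 ≤ W ^ 2 * (β ^ 2 * e + 4 * (r ^ 4 * o)) := by positivity
    linarith
  have h1 : c * r ^ 3 * V ≤ 4 * W * (β * √e + 2 * r ^ 2 * √o) := by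
    have e1 : c * (r ^ 2 * V ^ 2) = (c * r ^ 3 * V) * (V / r) := by field_simp
    have e2 : 4 * W * V * (β / r * √e + 2 * r * √o)
        = (4 * W * (β * √e + 2 * r ^ 2 * √o)) * (V / r) := by field_simp
    rw [e1, e2] at h
    exact le_of_mul_le_mul_right h (by positivity)
  have h2 : (c * r ^ 3 * V) ^ 2 ≤ (4 * W * (β * √e + 2 * r ^ 2 * √o)) ^ 2 :=
    pow_le_pow_left₀ (by positivity) h1 2
  have h3 : (β * √e + 2 * r ^ 2 * √o) ^ 2 ≤ 2 * (β ^ 2 * e + 4 * (r ^ 4 * o)) := by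
    have h4 := sq_nonneg (β * √e - 2 * r ^ 2 * √o)
    have h5 := Real.sq_sqrt he
    have h6 := Real.sq_sqrt ho
    have e1 : (β * √e) ^ 2 = β ^ 2 * e := by rw [mul_pow, h5]
    have e2 : (2 * r ^ 2 * √o) ^ 2 = 4 * (r ^ 4 * o) := by rw [mul_pow, h6]; ring
    nlinarith
  have h4 := mul_le_mul_of_nonneg_left h3 (by positivity : 0 ≤ 16 * W ^ 2)
  nlinarith

/-- The element residual, tested with a function that is supported inside the triangle. -/
lemma IsApproximation.abs_setIntegral_residual_mul_le (G : IsApproximation P mat T κ k u uh)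
    {K : Finset Plane} (hK : K ∈ T.tri) {c : Plane} {r B : ℝ} (hr : 0 < r)
    (hsub : Metric.ball c r ⊆ hull K) {φ : Plane → ℝ} (hφ : IsTestFunction c r B φ) :
    |∫ x in innerPart K, (mat.plateOp (onElement K uh) x - P.f x) * φ x|
      ≤ 16 * mat.densityBound * (B / r) * √(P.energy (u - uh) K) := by
  set n : Plane := EuclideanSpace.single 0 1 with hnd
  have hn : ‖n‖ = 1 := by simp [hnd]
  have hball : Metric.ball c r ⊆ innerPart K := interior_maximal hsub Metric.isOpen_ball
  -- the test function vanishes near the edges, so that only the element residual is tested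
  set m : Plane := c + (2 * r) • n with hm
  have hmdist : ∀ y ∈ Metric.ball c r, y ∈ halfPlane m n := fun y hy => by
    have h1 : ⟪y - c, n⟫ ≤ ‖y - c‖ * ‖n‖ := real_inner_le_norm _ _
    rw [← dist_eq_norm, hn, mul_one] at h1
    have h2 : ⟪y - m, n⟫ = ⟪y - c, n⟫ - 2 * r := by
      rw [hm, ← sub_sub, inner_sub_left, inner_smul_left, real_inner_self_eq_norm_sq, hn]
      simp
    have h3 := Metric.mem_ball.mp hy
    change ⟪y - m, n⟫ < 0
    linarith
  have hlineNot : ∀ s, line m (tangent n) s ∉ Metric.ball c r := fun s hs => by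
    have h1 := hmdist _ hs
    have h2 : ⟪line m (tangent n) s - m, n⟫ = 0 := by
      rw [line, add_sub_cancel_left, inner_smul_left, real_inner_comm, inner_tangent_self, mul_zero]
    exact absurd h1 (by change ¬ ⟪_, _⟫ < 0; rw [h2]; exact lt_irrefl _)
  have hlineTerm : mat.lineTerm (onElement K uh) φ m n = 0 := by
    refine integral_eq_zero_of_ae (Eventually.of_forall fun s => ?_)
    have hnot := fun h' => hlineNot s (hφ.tsupport_subset_ball hr h')
    have h1 : φ (line m (tangent n) s) = 0 := image_eq_zero_of_notMem_tsupport hnot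
    have h2 : fderiv ℝ φ (line m (tangent n) s) = 0 :=
      image_eq_zero_of_notMem_tsupport fun h' => hnot (tsupport_fderiv_subset ℝ h')
    simp [h1, h2]
  have hcard : 2 ≤ K.card := by rw [T.card_eq K hK]; norm_num
  have hzero : ∀ x ∉ innerPart K, ∀ i, φ x = 0 ∧ pd i φ x = 0 := fun x hx i => by
    have hnot : x ∉ tsupport φ := fun h' => hx (hball (hφ.tsupport_subset_ball hr h'))
    exact ⟨image_eq_zero_of_notMem_tsupport hnot, image_eq_zero_of_notMem_tsupport fun h' =>
      hnot (tsupport_pd_subset _ _ h')⟩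
  have hfront : ∀ x ∈ frontier P.Ω, x ∉ innerPart K := fun x hx hxK => by
    rw [P.isOpen.frontier_eq] at hx
    exact hx.2 (P.innerPart_subset T hK hxK)
  have hΓ : MeasurableSet (P.Γc ∪ P.Γs) ∧ MeasurableSet P.Γc := by
    exact ⟨P.clamped_segments.measurableSet.union P.supported_segments.measurableSet,
      P.clamped_segments.measurableSet⟩
  have hres := G.abs_residual_le hcard (s := {K}) (by simpa using hK)
    (fun L hL hKL => by
      rw [Finset.mem_singleton]
      exact (Finset.eq_of_subset_of_card_le hKL (by rw [T.card_eq K hK, T.card_eq L hL])).symm)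
    hr hφ (fun L hL x hx hxL => by
      rw [Finset.mem_singleton] at hL
      subst hL
      exact T.mem_openStar_self hK (hball hx))
    (m := fun _ => m) (n := fun _ => n) (fun _ _ => hn)
    (fun L hL y hy => by
      rw [Finset.mem_singleton] at hL
      subst hL
      exact ⟨fun _ => hmdist y hy, fun _ => hball hy⟩)
    (by
      filter_upwards [ae_restrict_mem hΓ.1] with x hx
      rw [Set.indicator_apply_eq_zero]
      exact fun _ => (hzero x (hfront x (P.boundary ▸ Or.inl hx)) 0).1)
    (fun i => by
      filter_upwards [ae_restrict_mem hΓ.2] with x hx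
      rw [Set.indicator_apply_eq_zero]
      exact fun _ => (hzero x (hfront x (P.boundary ▸ Or.inl (Or.inl hx))) i).2)
  have hload : ∫ x, P.g x * (⋃ L ∈ ({K} : Finset (Finset Plane)), hull L).indicator φ x ∂(arc P.S)
      = 0 := by
    refine G.lineLoad_eq_zero (F := K) hcard (fun hKE => ?_) (by simpa using hK)
      (fun L hL x hx hxL => ?_)
    · have h2 := T.card_of_mem_edges (T.mem_edges_of_mem_lineEdges hKE).2
      have h3 := T.card_eq K hK
      omega
    · rw [Finset.mem_singleton] at hL
      subst hL
      exact T.mem_openStar_self hK (hball (hφ.tsupport_subset_ball hr hx))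
  simp only [Finset.sum_singleton] at hres
  rw [hlineTerm, hload, add_zero, sub_zero] at hres
  exact hres

/-- The weighted element residuals are bounded by the error and the oscillation of the load. -/
theorem exists_element_bound (mat : Material) (κ : ℝ) (k : ℕ) : ∃ C > 0,
    ∀ (P : Problem) (T : Triangulation P.Ω) (u uh : Plane → ℝ),
      IsApproximation P mat T κ k u uh →
      ∀ K ∈ T.tri, ∀ q : MvPolynomial (Fin 2) ℝ, q.totalDegree ≤ k →
        size K ^ 4 * ∫ x in innerPart K, (mat.plateOp (onElement K uh) x - P.f x) ^ 2
          ≤ C * (P.energy (u - uh) K + size K ^ 4 * P.oscSq q K) := by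
  obtain ⟨c₀, hc₀, hcoer⟩ := exists_coercive_plane k
  obtain ⟨W, hW, hbub⟩ := exists_bubble_bound k
  set β := 16 * mat.densityBound with hβ
  have hβ0 : 0 ≤ β := mul_nonneg (by norm_num) (densityBound_nonneg mat)
  set C₁ := 8 * |κ| ^ (4 * k + 6) / c₀ ^ 2 * (32 * W ^ 2) with hC₁
  have hC₁0 : 0 ≤ C₁ := by positivity
  refine ⟨C₁ * (β ^ 2 + 4) + 2, by positivity, fun P T u uh G K hK q hq => ?_⟩
  have hκ := G.one_le
  obtain ⟨c, r, hr, hsub, hsize⟩ := G.regular K hK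
  set n : Plane := EuclideanSpace.single 0 1 with hnd
  have hn : ‖n‖ = 1 := by simp [hnd]
  have hball : Metric.ball c r ⊆ innerPart K :=
    interior_maximal (Metric.ball_subset_closedBall.trans hsub) Metric.isOpen_ball
  have hbdd : Bornology.IsBounded (hull K) := (isCompact_hull K).isBounded
  have hcK : c ∈ hull K := hsub (Metric.mem_closedBall_self hr.le)
  have hrK : r ≤ size K := by
    have h1 : c + r • n ∈ hull K := hsub (by simp [norm_smul, hn, abs_of_pos hr])
    have := Metric.dist_le_diam_of_mem hbdd h1 hcK
    rw [size]
    simpa only [dist_self_add_left, norm_smul, hn, Real.norm_eq_abs, abs_of_pos hr, mul_one]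
      using this
  have hKball : innerPart K ⊆ Metric.closedBall c (κ * r) := fun x hx =>
    (Metric.dist_le_diam_of_mem hbdd (interior_subset hx) hcK).trans hsize
  -- the residual polynomial in the reference frame
  set p := onElement K uh with hp
  set R : Plane → ℝ := fun x => mat.plateOp p x - q.eval x with hR
  have hRp : IsPoly k R := (mat.isPoly_plateOp (G.isPoly hK)).sub ⟨q, hq, fun _ => rfl⟩
  obtain ⟨v, hv⟩ := (isPoly_fromRef hRp c n r).exists_coeff le_rfl
  set V := ∑ a, |v a| with hVd
  have hV0 : 0 ≤ V := Finset.sum_nonneg fun a _ => abs_nonneg _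
  set φ : Plane → ℝ := fun x => ∑ a, v a * bubble a.1 a.2 (toRef c n r x) with hφd
  have hφ : IsTestFunction c r (4 * W * V) φ :=
    isTestFunction_sum hbub hn hr (fun a : Fin (k + 1) × Fin (k + 1) => (a.1 : ℕ))
      (fun a => (a.2 : ℕ)) (fun a => Nat.lt_succ_iff.mp a.1.2) (fun a => Nat.lt_succ_iff.mp a.2.2) v
  have hpair : ∫ x in innerPart K, R x * φ x
      = r ^ 2 * ∫ y, bump₂ y * (∑ a, v a * monom a.1 a.2 y) ^ 2 := by
    rw [setIntegral_eq_of_ball (U := innerPart K) (F := fun x => R x * φ x)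
      isOpen_interior.measurableSet MeasurableSet.univ (c := c) (r := r)
      (fun x hx => by rw [hφ.eq_zero hr hx, mul_zero]) fun x hx => by simp [hball hx],
      Measure.restrict_univ, integral_fromRef c n hn hr]
    congr 2
    ext y
    have e1 : R (fromRef c n r y) = ∑ a, v a * monom a.1 a.2 y := hv y
    have e2 : φ (fromRef c n r y) = bump₂ y * ∑ a, v a * monom a.1 a.2 y := by
      simp only [hφd, toRef_fromRef c n hn hr, bubble, Finset.mul_sum]
      exact Finset.sum_congr rfl fun a _ => by ring
    rw [e1, e2]
    ring
  have hres := G.abs_setIntegral_residual_mul_le hK hr (Metric.ball_subset_closedBall.trans hsub) hφ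
  set e := P.energy (u - uh) K with he
  set o := P.oscSq q K with ho
  have he0 : 0 ≤ e := P.energy_nonneg _ _
  have ho0 : 0 ≤ o := P.oscSq_nonneg _ _
  have hqc : Continuous fun x : Plane => q.eval x := (contDiff_eval q).continuous
  have hfq : MemLp (fun x => P.f x - q.eval x) 2 (volume.restrict (innerPart K)) :=
    (memLp_innerPart hK P.f_mem).sub (memLp_innerPart_of_continuous hqc K)
  have hRl : MemLp R 2 (volume.restrict (innerPart K)) :=
    memLp_innerPart_of_continuous hRp.contDiff.continuous K
  have hφl : MemLp φ 2 (volume.restrict (innerPart K)) :=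
    memLp_innerPart_of_continuous hφ.contDiff.continuous K
  -- the polynomial residual is a sum of the true residual and of the oscillation
  have hsplit : ∫ x in innerPart K, R x * φ x
      = (∫ x in innerPart K, (mat.plateOp p x - P.f x) * φ x)
        + ∫ x in innerPart K, (P.f x - q.eval x) * φ x := by
    have i2 : Integrable (fun x => (P.f x - q.eval x) * φ x) (volume.restrict (innerPart K)) :=
      hfq.integrable_mul hφl
    have i1 : Integrable (fun x => (mat.plateOp p x - P.f x) * φ x)
        (volume.restrict (innerPart K)) := by
      have : Integrable (fun x => R x * φ x) (volume.restrict (innerPart K)) :=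
        hRl.integrable_mul hφl
      refine (this.sub i2).congr (Eventually.of_forall fun x => ?_)
      simp only [hR, Pi.sub_apply]
      ring
    rw [← integral_add i1 i2]
    congr 1
    ext x
    simp only [hR]
    ring
  have hosc := hφ.abs_setIntegral_mul_le hr hfq
  have hquad : c₀ * (r ^ 2 * V ^ 2) ≤ 4 * W * V * (β / r * √e + 2 * r * √o) := by
    have h1 : c₀ * (r ^ 2 * V ^ 2) ≤ ∫ x in innerPart K, R x * φ x := by
      rw [hpair]
      have := mul_le_mul_of_nonneg_left (hcoer v) (sq_nonneg r)
      linarith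
    have h2 := (le_abs_self _).trans hres
    have h3 := (le_abs_self _).trans hosc
    rw [hsplit] at h1
    calc c₀ * (r ^ 2 * V ^ 2) ≤ _ := h1
      _ ≤ β * (4 * W * V / r) * √e + 2 * r * (4 * W * V) * √o := add_le_add h2 h3
      _ = _ := by ring
  have hV := le_sq_of_quadratic hc₀ hr hV0 he0 ho0 hquad
  -- the size of the polynomial residual on the whole triangle
  have hRsq : ∫ x in innerPart K, R x ^ 2 ≤ (κ ^ (2 * k) * V) ^ 2 * (2 * (κ * r)) ^ 2 := by
    have hvol : volume (innerPart K) ≤ ENNReal.ofReal ((2 * (κ * r)) ^ 2) :=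
      (measure_mono hKball).trans (volume_closedBall_le c (by positivity))
    have := norm_setIntegral_le_of_norm_le_const (f := fun x => R x ^ 2) (μ := volume)
      (C := (κ ^ (2 * k) * V) ^ 2) (lt_of_le_of_lt hvol ENNReal.ofReal_lt_top) fun x hx => by
        have hx1 : ‖toRef c n r x‖ ≤ κ := by
          rw [norm_toRef c n hn hr, inv_mul_le_iff₀ hr, mul_comm]
          exact hKball hx
        have e1 : R x = ∑ a, v a * monom a.1 a.2 (toRef c n r x) := by
          have := hv (toRef c n r x)
          rwa [fromRef_toRef c n hn hr] at this
        rw [norm_pow, Real.norm_eq_abs, e1]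
        exact pow_le_pow_left₀ (abs_nonneg _) (abs_sum_monom_le v hκ hx1) 2
    refine ((le_abs_self _).trans this).trans ?_
    exact mul_le_mul_of_nonneg_left (ENNReal.toReal_le_of_le_ofReal (by positivity) hvol)
      (by positivity)
  have hsum : ∫ x in innerPart K, (mat.plateOp p x - P.f x) ^ 2
      ≤ 2 * (∫ x in innerPart K, R x ^ 2) + 2 * o := by
    have i1 := hRl.integrable_sq
    have i2 := hfq.integrable_sq
    rw [ho, Problem.oscSq, ← integral_const_mul, ← integral_const_mul,
      ← integral_add (i1.const_mul 2) (i2.const_mul 2)]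
    refine integral_mono_of_nonneg (Eventually.of_forall fun x => sq_nonneg _)
      ((i1.const_mul 2).add (i2.const_mul 2)) (Eventually.of_forall fun x => ?_)
    simp only [hR]
    nlinarith [sq_nonneg (mat.plateOp p x - q.eval x + (P.f x - q.eval x))]
  have hs0 : 0 ≤ size K := Metric.diam_nonneg
  have hs4 : size K ^ 4 ≤ (κ * r) ^ 4 := pow_le_pow_left₀ hs0 hsize 4
  have hr4 : r ^ 4 * o ≤ size K ^ 4 * o :=
    mul_le_mul_of_nonneg_right (pow_le_pow_left₀ hr.le hrK 4) ho0
  have hmain : size K ^ 4 * (2 * ∫ x in innerPart K, R x ^ 2)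
      ≤ C₁ * (β ^ 2 * e + 4 * (size K ^ 4 * o)) := by
    calc size K ^ 4 * (2 * ∫ x in innerPart K, R x ^ 2)
        ≤ (κ * r) ^ 4 * (2 * ((κ ^ (2 * k) * V) ^ 2 * (2 * (κ * r)) ^ 2)) :=
          mul_le_mul hs4 (by linarith)
            (mul_nonneg zero_le_two (integral_nonneg fun x => sq_nonneg _)) (by positivity)
      _ = 8 * |κ| ^ (4 * k + 6) / c₀ ^ 2 * (c₀ ^ 2 * (r ^ 6 * V ^ 2)) := by
          rw [abs_of_pos (by linarith : 0 < κ)]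
          field_simp
          ring
      _ ≤ 8 * |κ| ^ (4 * k + 6) / c₀ ^ 2 * (32 * W ^ 2 * (β ^ 2 * e + 4 * (size K ^ 4 * o))) := by
          refine mul_le_mul_of_nonneg_left (hV.trans ?_) (by positivity)
          exact mul_le_mul_of_nonneg_left (by linarith) (by positivity)
      _ = _ := by rw [hC₁]; ring
  have hso : 0 ≤ size K ^ 4 * o := mul_nonneg (by positivity) ho0
  calc size K ^ 4 * ∫ x in innerPart K, (mat.plateOp p x - P.f x) ^ 2
      ≤ size K ^ 4 * (2 * (∫ x in innerPart K, R x ^ 2) + 2 * o) :=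
        mul_le_mul_of_nonneg_left hsum (by positivity)
    _ ≤ C₁ * (β ^ 2 * e + 4 * (size K ^ 4 * o)) + 2 * (size K ^ 4 * o) := by linarith
    _ ≤ _ := by nlinarith [mul_nonneg hC₁0 he0, mul_nonneg (mul_nonneg hC₁0 (sq_nonneg β)) hso]

/-! ### Inverse estimates on a line -/

lemma IsPoly.exists_coeff_line {k N : ℕ} (hkN : k ≤ N) {J : Plane → ℝ} (hJ : IsPoly k J)
    (c n : Plane) (r : ℝ) : ∃ v : Fin (N + 1) → ℝ,
      ∀ s, J (line c (tangent n) (r * s)) = ∑ b, v b * s ^ (b : ℕ) := by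
  obtain ⟨v, hv⟩ := (isPoly_fromRef hJ c n r).exists_coeff hkN
  refine ⟨fun b => v (0, b), fun s => ?_⟩
  have h := hv !₂[0, s]
  rw [fromRef_line] at h
  rw [h, Fintype.sum_prod_type, Finset.sum_eq_single 0]
  · simp
  · intro a _ ha
    refine Finset.sum_eq_zero fun b _ => ?_
    have : (a : ℕ) ≠ 0 := fun h0 => ha (Fin.ext h0)
    simp [this]
  · simp

lemma abs_sum_pow_le {N : ℕ} (v : Fin (N + 1) → ℝ) {R : ℝ} (hR : 1 ≤ R) {s : ℝ} (hs : |s| ≤ R) :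
    |∑ b, v b * s ^ (b : ℕ)| ≤ R ^ N * ∑ b, |v b| := by
  refine (Finset.abs_sum_le_sum_abs _ _).trans ?_
  rw [Finset.mul_sum]
  refine Finset.sum_le_sum fun b _ => ?_
  rw [abs_mul, abs_pow, mul_comm]
  exact mul_le_mul_of_nonneg_right ((pow_le_pow_left₀ (abs_nonneg _) hs _).trans
    (pow_le_pow_right₀ hR (Nat.lt_succ_iff.mp b.2))) (abs_nonneg _)

lemma le_div_of_sq_le {c V y : ℝ} (hc : 0 < c) (hV : 0 ≤ V) (hy : 0 ≤ y) (h : c * V ^ 2 ≤ y * V) :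
    V ≤ y / c := by
  rcases hV.eq_or_lt with rfl | hV
  · positivity
  · rw [le_div_iff₀ hc]
    nlinarith

lemma fderiv_sum_bubble {N : ℕ} {c n : Plane} (hn : ‖n‖ = 1) {r : ℝ} (hr : 0 < r) (α : ℕ)
    (v : Fin (N + 1) → ℝ) (s : ℝ) :
    fderiv ℝ (fun x => ∑ b : Fin (N + 1), v b * bubble α b (toRef c n r x))
        (line c (tangent n) (r * s)) n
      = r⁻¹ * ∑ b : Fin (N + 1), v b * if α = 1 then bump s * s ^ (b : ℕ) else 0 := by
  have hd : ∀ b : Fin (N + 1), Differentiable ℝ fun x => bubble α b (toRef c n r x) := fun b =>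
    (contDiff_comp_toRef (contDiff_bubble α b) c n r).differentiable (by simp)
  rw [fderiv_fun_sum fun b _ => (hd b _).const_mul (v b), sum_apply, Finset.mul_sum]
  refine Finset.sum_congr rfl fun b _ => ?_
  rw [fderiv_const_mul (hd b _), smul_apply, fderiv_comp_toRef_normal
    ((contDiff_bubble α b).differentiable (by simp)) c n hn, ← fromRef_line,
    toRef_fromRef c n hn hr, pd_zero_bubble, smul_eq_mul]
  ring

/-- A polynomial on a line is bounded by its pairings with test functions whose normal derivative
vanishes on the line. -/
lemma exists_line_bound_value (N : ℕ) {R : ℝ} (hR : 1 ≤ R) : ∃ C > 0,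
    ∀ (c n : Plane) (r X : ℝ) (J : Plane → ℝ), ‖n‖ = 1 → 0 < r → 0 ≤ X → IsPoly N J →
      (∀ φ B, IsTestFunction c r B φ → (∀ s, fderiv ℝ φ (line c (tangent n) s) n = 0) →
        |∫ s, J (line c (tangent n) s) * φ (line c (tangent n) s)| ≤ X * B) →
      ∀ s, |s| ≤ R * r → |J (line c (tangent n) s)| ≤ C * (X / r) := by
  obtain ⟨c₀, hc₀, hcoer⟩ := exists_coercive_line N
  obtain ⟨W, hW, hbub⟩ := exists_bubble_bound N
  refine ⟨R ^ N * (4 * W / c₀), by positivity, fun c n r X J hn hr hX hJ hpair s hs => ?_⟩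
  obtain ⟨v, hv⟩ := hJ.exists_coeff_line le_rfl c n r
  set V := ∑ b, |v b| with hVd
  have hV0 : 0 ≤ V := Finset.sum_nonneg fun a _ => abs_nonneg _
  set φ : Plane → ℝ := fun x => ∑ b : Fin (N + 1), v b * bubble 0 b (toRef c n r x) with hφd
  have hφ : IsTestFunction c r (4 * W * V) φ :=
    isTestFunction_sum hbub hn hr (fun _ : Fin (N + 1) => 0) (fun b => (b : ℕ))
      (fun _ => Nat.zero_le _) (fun b => Nat.lt_succ_iff.mp b.2) v
  have hline : ∀ s, toRef c n r (line c (tangent n) (r * s)) = !₂[0, s] := fun s => by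
    rw [← fromRef_line, toRef_fromRef c n hn hr]
  have hmul : ∀ s : ℝ, r * (r⁻¹ * s) = s := fun s => mul_inv_cancel_left₀ hr.ne' s
  have hder : ∀ s, fderiv ℝ φ (line c (tangent n) s) n = 0 := fun s => by
    rw [← hmul s, hφd, fderiv_sum_bubble hn hr]
    simp
  have hval : ∫ s, J (line c (tangent n) s) * φ (line c (tangent n) s)
      = r * ∫ s, bump s * (∑ b, v b * s ^ (b : ℕ)) ^ 2 := by
    rw [integral_line_scale c n hr fun x => J x * φ x]
    congr 2
    ext s
    have e1 : φ (fromRef c n r !₂[0, s]) = bump s * ∑ b, v b * s ^ (b : ℕ) := by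
      simp only [hφd, toRef_fromRef c n hn hr, bubble_zero_line, if_true, Finset.mul_sum]
      exact Finset.sum_congr rfl fun b _ => by ring
    rw [e1, fromRef_line, hv]
    ring
  have hmain : V ≤ 4 * W * (X / r) / c₀ := by
    refine le_div_of_sq_le hc₀ hV0 (by positivity) ?_
    have h1 := (le_abs_self _).trans (hpair φ _ hφ hder)
    rw [hval] at h1
    have h2 := mul_le_mul_of_nonneg_left (hcoer v) hr.le
    have h3 : r * (c₀ * V ^ 2) ≤ r * (4 * W * (X / r) * V) := by
      calc r * (c₀ * V ^ 2) ≤ X * (4 * W * V) := h2.trans h1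
        _ = _ := by field_simp
    exact le_of_mul_le_mul_left h3 hr
  have hs' : |r⁻¹ * s| ≤ R := by
    rw [abs_mul, abs_of_pos (inv_pos.mpr hr), inv_mul_le_iff₀ hr, mul_comm]
    exact hs
  rw [← hmul s, hv]
  calc _ ≤ R ^ N * V := abs_sum_pow_le v hR hs'
    _ ≤ R ^ N * (4 * W * (X / r) / c₀) := mul_le_mul_of_nonneg_left hmain (by positivity)
    _ = _ := by ring

/-- A polynomial on a line is bounded by its pairings with the normal derivatives of test functions
that vanish on the line. -/
lemma exists_line_bound_normal (N : ℕ) {R : ℝ} (hR : 1 ≤ R) : ∃ C > 0,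
    ∀ (c n : Plane) (r X : ℝ) (J : Plane → ℝ), ‖n‖ = 1 → 0 < r → 0 ≤ X → IsPoly N J →
      (∀ φ B, IsTestFunction c r B φ → (∀ s, φ (line c (tangent n) s) = 0) →
        |∫ s, J (line c (tangent n) s) * fderiv ℝ φ (line c (tangent n) s) n| ≤ X * B) →
      ∀ s, |s| ≤ R * r → |J (line c (tangent n) s)| ≤ C * X := by
  obtain ⟨c₀, hc₀, hcoer⟩ := exists_coercive_line N
  obtain ⟨W, hW, hbub⟩ := exists_bubble_bound (N + 1)
  refine ⟨R ^ N * (4 * W / c₀), by positivity, fun c n r X J hn hr hX hJ hpair s hs => ?_⟩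
  obtain ⟨v, hv⟩ := hJ.exists_coeff_line le_rfl c n r
  set V := ∑ b, |v b| with hVd
  have hV0 : 0 ≤ V := Finset.sum_nonneg fun a _ => abs_nonneg _
  set φ : Plane → ℝ := fun x => ∑ b : Fin (N + 1), v b * bubble 1 b (toRef c n r x) with hφd
  have hφ : IsTestFunction c r (4 * W * V) φ :=
    isTestFunction_sum hbub hn hr (fun _ : Fin (N + 1) => 1) (fun b => (b : ℕ))
      (fun _ => Nat.le_add_left 1 N) (fun b => b.2.le) v
  have hline : ∀ s, toRef c n r (line c (tangent n) (r * s)) = !₂[0, s] := fun s => by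
    rw [← fromRef_line, toRef_fromRef c n hn hr]
  have hmul : ∀ s : ℝ, r * (r⁻¹ * s) = s := fun s => mul_inv_cancel_left₀ hr.ne' s
  have hzero : ∀ s, φ (line c (tangent n) s) = 0 := fun s => by
    rw [← hmul s]
    simp only [hφd, hline, bubble_zero_line]
    simp
  have hder : ∀ s, fderiv ℝ φ (line c (tangent n) (r * s)) n
      = r⁻¹ * (bump s * ∑ b, v b * s ^ (b : ℕ)) := fun s => by
    rw [hφd, fderiv_sum_bubble hn hr]
    simp only [if_true, Finset.mul_sum]
    exact Finset.sum_congr rfl fun b _ => by ring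
  have hval : ∫ s, J (line c (tangent n) s) * fderiv ℝ φ (line c (tangent n) s) n
      = ∫ s, bump s * (∑ b, v b * s ^ (b : ℕ)) ^ 2 := by
    rw [integral_line_scale c n hr fun x => J x * fderiv ℝ φ x n, ← integral_const_mul]
    congr 1
    ext s
    rw [fromRef_line, hder, hv]
    field_simp
  have hmain : V ≤ 4 * W * X / c₀ := by
    refine le_div_of_sq_le hc₀ hV0 (by positivity) ?_
    have h1 := (le_abs_self _).trans (hpair φ _ hφ hzero)
    rw [hval] at h1
    calc c₀ * V ^ 2 ≤ X * (4 * W * V) := (hcoer v).trans h1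
      _ = _ := by ring
  have hs' : |r⁻¹ * s| ≤ R := by
    rw [abs_mul, abs_of_pos (inv_pos.mpr hr), inv_mul_le_iff₀ hr, mul_comm]
    exact hs
  rw [← hmul s, hv]
  calc _ ≤ R ^ N * V := abs_sum_pow_le v hR hs'
    _ ≤ R ^ N * (4 * W * X / c₀) := mul_le_mul_of_nonneg_left hmain (by positivity)
    _ = _ := by ring

lemma integral_arc_sq_le {a b n : Plane} (hn : ‖n‖ = 1) (h : ⟪b - a, n⟫ = 0) {J : Plane → ℝ} {M : ℝ}
    (hJ : ∀ s, |s| ≤ dist a b / 2 → |J (line (midpoint ℝ a b) (tangent n) s)| ≤ M) :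
    ∫ x, J x ^ 2 ∂(arc (hull {a, b})) ≤ dist a b * M ^ 2 := by
  rw [integral_arc_hull_pair hn h]
  have := norm_setIntegral_le_of_norm_le_const (μ := volume) (C := M ^ 2)
    (s := Set.Icc (-(dist a b / 2)) (dist a b / 2))
    (f := fun s => J (line (midpoint ℝ a b) (tangent n) s) ^ 2) (by simp) fun s hs => by
      rw [norm_pow, Real.norm_eq_abs]
      exact pow_le_pow_left₀ (abs_nonneg _) (hJ s (abs_le.mpr hs)) 2
  refine ((le_abs_self _).trans this).trans (le_of_eq ?_)
  rw [Real.volume_real_Icc_of_le (by linarith [dist_nonneg (x := a) (y := b)])]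
  ring

/-! ### The edge residuals -/

/-- The error and the oscillation of the load on the triangle `L`, with their weights. -/
def Problem.localBound (P : Problem) (e : Plane → ℝ) (fh : Finset Plane → MvPolynomial (Fin 2) ℝ)
    (L : Finset Plane) : ℝ :=
  P.energy e L + size L ^ 4 * P.oscSq (fh L) L

lemma size_nonneg (K : Finset Plane) : 0 ≤ size K := Metric.diam_nonneg

lemma Problem.localBound_nonneg (P : Problem) (e : Plane → ℝ)
    (fh : Finset Plane → MvPolynomial (Fin 2) ℝ) (L : Finset Plane) : 0 ≤ P.localBound e fh L :=
  add_nonneg (P.energy_nonneg _ _)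
    (mul_nonneg (pow_nonneg (size_nonneg L) 4) (P.oscSq_nonneg _ _))

/-- The triangles `s` that have the edge `{a, b}` fill the part of a disc around its midpoint that
lies in the domain. Moreover `JV` and `JM` are the edge residuals of `uh`, that is, the sum of the
boundary terms which arise from the triangles in `s` on integration by parts. -/
structure IsEdgePatch {Ω : Set Plane} (mat : Material) (T : Triangulation Ω) (uh : Plane → ℝ) (k : ℕ)
    (a b n : Plane) (r : ℝ) (s : Finset (Finset Plane)) (JV JM : Plane → ℝ) : Prop where
  subset_tri : s ⊆ T.tri
  mem_of_subset : ∀ L ∈ T.tri, {a, b} ⊆ L → L ∈ s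
  subset_of_mem : ∀ L ∈ s, {a, b} ⊆ L
  card_le : s.card ≤ 2
  nonempty : s.Nonempty
  norm_eq : ‖n‖ = 1
  perp : ⟪b - a, n⟫ = 0
  mem_openStar : ∀ L ∈ s, ∀ x ∈ Metric.ball (midpoint ℝ a b) r, x ∈ hull L → x ∈ openStar {a, b} L
  isPoly_shear : IsPoly k JV
  isPoly_moment : IsPoly k JM
  green : ∃ N : Finset Plane → Plane, (∀ L ∈ s, ‖N L‖ = 1) ∧
    (∀ L ∈ s, ∀ y ∈ Metric.ball (midpoint ℝ a b) r,
      y ∈ innerPart L ↔ y ∈ halfPlane (midpoint ℝ a b) (N L)) ∧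
    ∀ φ, ContDiff ℝ ∞ φ → HasCompactSupport φ →
      ∑ L ∈ s, mat.lineTerm (onElement L uh) φ (midpoint ℝ a b) (N L)
        = ∫ t, (JV (line (midpoint ℝ a b) (tangent n) t) * φ (line (midpoint ℝ a b) (tangent n) t)
          - JM (line (midpoint ℝ a b) (tangent n) t)
            * fderiv ℝ φ (line (midpoint ℝ a b) (tangent n) t) n)

/-- The extension by zero of the restriction of `φ` to the triangles in `s` satisfies the essential
boundary conditions. -/
def Problem.EssentialBC (P : Problem) (s : Finset (Finset Plane)) (φ : Plane → ℝ) : Prop :=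
  (∀ᵐ x ∂(arc (P.Γc ∪ P.Γs)), (⋃ L ∈ s, hull L).indicator φ x = 0) ∧
    ∀ i, ∀ᵐ x ∂(arc P.Γc), (⋃ L ∈ s, hull L).indicator (pd i φ) x = 0

variable {P : Problem} {mat : Material} {T : Triangulation P.Ω} {κ : ℝ} {k l : ℕ} {u uh : Plane → ℝ}
  {fh : Finset Plane → MvPolynomial (Fin 2) ℝ} {a b n : Plane} {r : ℝ}
  {s : Finset (Finset Plane)} {JV JM : Plane → ℝ} {C₀ : ℝ}

/-- The edge residuals, tested with an admissible function: of the terms that arise on integration by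
parts, the element residuals have been bounded before. -/
lemma IsEdgePatch.abs_pairing_le (h : IsEdgePatch mat T uh l a b n r s JV JM)
    (G : IsApproximation P mat T κ k u uh) (hab : a ≠ b) (hr : 0 < r) (hrd : r ≤ dist a b)
    (hC₀ : 0 ≤ C₀)
    (helem : ∀ K ∈ T.tri, size K ^ 4 * ∫ x in innerPart K,
      (mat.plateOp (onElement K uh) x - P.f x) ^ 2 ≤ C₀ * P.localBound (u - uh) fh K)
    {B : ℝ} {φ : Plane → ℝ} (hφ : IsTestFunction (midpoint ℝ a b) r B φ)
    (hbc : P.EssentialBC s φ) :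
    |(∫ t, (JV (line (midpoint ℝ a b) (tangent n) t) * φ (line (midpoint ℝ a b) (tangent n) t)
          - JM (line (midpoint ℝ a b) (tangent n) t)
            * fderiv ℝ φ (line (midpoint ℝ a b) (tangent n) t) n))
        - ∫ x, P.g x * (⋃ L ∈ s, hull L).indicator φ x ∂(arc P.S)|
      ≤ (16 * mat.densityBound + 2 * √C₀) * (B / r)
        * ∑ L ∈ s, √(P.localBound (u - uh) fh L) := by
  obtain ⟨N, hN, hhalf, hgreen⟩ := h.green
  have hres := G.abs_residual_le (Finset.card_pair hab).ge h.subset_tri h.mem_of_subset hr hφ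
    h.mem_openStar (m := fun _ => midpoint ℝ a b) hN hhalf hbc.1 hbc.2
  rw [hgreen φ hφ.contDiff hφ.hasCompactSupport] at hres
  have hB := hφ.nonneg
  have helt : |∑ L ∈ s, ∫ x in innerPart L, (mat.plateOp (onElement L uh) x - P.f x) * φ x|
      ≤ 2 * √C₀ * (B / r) * ∑ L ∈ s, √(P.localBound (u - uh) fh L) := by
    refine (Finset.abs_sum_le_sum_abs _ _).trans ?_
    rw [Finset.mul_sum]
    refine Finset.sum_le_sum fun L hL => ?_
    have hLT := h.subset_tri hL
    have hmem : MemLp (fun x => mat.plateOp (onElement L uh) x - P.f x) 2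
        (volume.restrict (innerPart L)) :=
      (memLp_innerPart_of_continuous (mat.contDiff_plateOp (G.isPoly hLT).contDiff).continuous
        L).sub (memLp_innerPart hLT P.f_mem)
    refine (hφ.abs_setIntegral_mul_le hr hmem).trans ?_
    set R := ∫ x in innerPart L, (mat.plateOp (onElement L uh) x - P.f x) ^ 2 with hR
    have hR0 : 0 ≤ R := integral_nonneg fun x => sq_nonneg _
    have hrL : r ≤ size L := by
      have := size_mono (h.subset_of_mem L hL)
      rw [size_pair] at this
      exact hrd.trans this
    have h1 : r ^ 2 * √R ≤ √C₀ * √(P.localBound (u - uh) fh L) := by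
      rw [← Real.sqrt_mul hC₀, ← Real.sqrt_sq (by positivity : 0 ≤ r ^ 2),
        ← Real.sqrt_mul (by positivity)]
      refine Real.sqrt_le_sqrt ((le_trans ?_ (helem L hLT)))
      rw [← pow_mul]
      exact mul_le_mul_of_nonneg_right (pow_le_pow_left₀ hr.le hrL _) hR0
    calc 2 * r * B * √R = 2 * (B / r) * (r ^ 2 * √R) := by field_simp
      _ ≤ 2 * (B / r) * (√C₀ * √(P.localBound (u - uh) fh L)) :=
        mul_le_mul_of_nonneg_left h1 (by positivity)
      _ = _ := by ring
  have hen : 16 * mat.densityBound * (B / r) * ∑ L ∈ s, √(P.energy (u - uh) L)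
      ≤ 16 * mat.densityBound * (B / r) * ∑ L ∈ s, √(P.localBound (u - uh) fh L) := by
    have := densityBound_nonneg mat
    refine mul_le_mul_of_nonneg_left (Finset.sum_le_sum fun L _ => Real.sqrt_le_sqrt ?_)
      (by positivity)
    exact le_add_of_nonneg_right (mul_nonneg (pow_nonneg (size_nonneg L) 4) (P.oscSq_nonneg _ _))
  rw [abs_le] at hres helt ⊢
  constructor <;> linarith [hres.1, hres.2, helt.1, helt.2]

lemma IsEdgePatch.sq_sum_sqrt_le (h : IsEdgePatch mat T uh l a b n r s JV JM) (e : Plane → ℝ) :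
    (∑ L ∈ s, √(P.localBound e fh L)) ^ 2 ≤ 2 * ∑ L ∈ s, P.localBound e fh L := by
  have h1 := sq_sum_le_card_mul_sum_sq (s := s) (f := fun L => √(P.localBound e fh L))
  simp only [Real.sq_sqrt (P.localBound_nonneg e fh _)] at h1
  refine h1.trans (mul_le_mul_of_nonneg_right (by exact_mod_cast h.card_le) ?_)
  exact Finset.sum_nonneg fun L _ => P.localBound_nonneg e fh L

/-- A test function near an edge sees the line load only if the edge lies on the line. -/
lemma IsEdgePatch.lineLoad (h : IsEdgePatch mat T uh l a b n r s JV JM)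
    (G : IsApproximation P mat T κ k u uh) (hab : a ≠ b) (hr : 0 < r)
    {B : ℝ} {φ : Plane → ℝ} (hφ : IsTestFunction (midpoint ℝ a b) r B φ) :
    (({a, b} : Finset Plane) ∉ T.lineEdges P.S →
      ∫ x, P.g x * (⋃ L ∈ s, hull L).indicator φ x ∂(arc P.S) = 0) ∧
    (({a, b} : Finset Plane) ∈ T.lineEdges P.S →
      ∫ x, P.g x * (⋃ L ∈ s, hull L).indicator φ x ∂(arc P.S)
        = ∫ x, P.g x * φ x ∂(arc (hull {a, b}))) := by
  have hD : ∀ L ∈ s, ∀ x ∈ tsupport φ, x ∈ hull L → x ∈ openStar {a, b} L := fun L hL x hx =>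
    h.mem_openStar L hL x (hφ.tsupport_subset_ball hr hx)
  obtain ⟨L, hL⟩ := h.nonempty
  exact ⟨fun hS => G.lineLoad_eq_zero (Finset.card_pair hab).ge hS h.subset_tri hD,
    fun hS => G.lineLoad_eq hS h.subset_tri hD ⟨L, hL, h.subset_of_mem L hL⟩⟩

lemma IsTestFunction.integral_arc_hull_pair {B : ℝ} {φ : Plane → ℝ}
    (hφ : IsTestFunction (midpoint ℝ a b) r B φ) (hr : 0 < r) (hrd : r ≤ dist a b / 2)
    (hn : ‖n‖ = 1) (hp : ⟪b - a, n⟫ = 0) (J : Plane → ℝ) :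
    ∫ x, J x * φ x ∂(arc (hull {a, b})) = ∫ t, J (line (midpoint ℝ a b) (tangent n) t)
      * φ (line (midpoint ℝ a b) (tangent n) t) := by
  rw [Kirchhoff.integral_arc_hull_pair hn hp]
  refine setIntegral_eq_integral_of_forall_compl_eq_zero fun t ht => ?_
  rw [hφ.eq_zero hr, mul_zero]
  rw [Metric.mem_ball, dist_eq_norm, line, add_sub_cancel_left, norm_smul, norm_tangent, hn, mul_one,
    Real.norm_eq_abs]
  intro hlt
  exact ht (_root_.abs_le.mp (hlt.le.trans hrd))

/-- The weighted bending moment residual of an edge is bounded by the error and the oscillation on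
the adjacent triangles. -/
theorem exists_moment_bound (mat : Material) {κ : ℝ} (hκ : 1 ≤ κ) (k : ℕ) {C₀ : ℝ} (hC₀ : 0 ≤ C₀) :
    ∃ C > 0, ∀ (P : Problem) (T : Triangulation P.Ω) (u uh : Plane → ℝ)
      (fh : Finset Plane → MvPolynomial (Fin 2) ℝ) (a b n : Plane) (s : Finset (Finset Plane))
      (JV JM : Plane → ℝ), IsApproximation P mat T κ k u uh →
      (∀ K ∈ T.tri, size K ^ 4 * ∫ x in innerPart K,
        (mat.plateOp (onElement K uh) x - P.f x) ^ 2 ≤ C₀ * P.localBound (u - uh) fh K) →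
      a ≠ b → IsEdgePatch mat T uh k a b n (dist a b / (2 * (κ + 1))) s JV JM →
      (∀ φ B, IsTestFunction (midpoint ℝ a b) (dist a b / (2 * (κ + 1))) B φ →
        (∀ t, φ (line (midpoint ℝ a b) (tangent n) t) = 0) → P.EssentialBC s φ) →
      dist a b * ∫ x, JM x ^ 2 ∂(arc (hull {a, b}))
        ≤ C * ∑ L ∈ s, P.localBound (u - uh) fh L := by
  -- half of the edge has the length `(κ + 1) * r`, where `r` is the radius of the half disc
  obtain ⟨C₁, hC₁, hline⟩ := exists_line_bound_normal k (R := κ + 1) (by linarith)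
  set C₂ := 16 * mat.densityBound + 2 * √C₀ with hC₂
  have hC₂0 : 0 ≤ C₂ := by have := densityBound_nonneg mat; positivity
  refine ⟨2 * (2 * (κ + 1) * C₁ * C₂) ^ 2 + 1, by positivity,
    fun P T u uh fh a b n s JV JM G helem hab h hadm => ?_⟩
  have hd : 0 < dist a b := dist_pos.mpr hab
  set r := dist a b / (2 * (κ + 1)) with hr
  have hdr : dist a b = 2 * (κ + 1) * r := by rw [hr]; field_simp
  have hr0 : 0 < r := by positivity
  have hrd : r ≤ dist a b / 2 := by rw [hdr]; nlinarith
  set Y := ∑ L ∈ s, √(P.localBound (u - uh) fh L) with hY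
  have hY0 : 0 ≤ Y := Finset.sum_nonneg fun L _ => Real.sqrt_nonneg _
  have hYsq := h.sq_sum_sqrt_le (P := P) (fh := fh) (u - uh)
  have hJ := hline (midpoint ℝ a b) n r (C₂ * Y / r) JM h.norm_eq hr0 (by positivity)
    h.isPoly_moment fun φ B hφ hz => by
      have hpair := h.abs_pairing_le G hab hr0 (by linarith) hC₀ helem hφ (hadm φ B hφ hz)
      have hload : ∫ x, P.g x * (⋃ L ∈ s, hull L).indicator φ x ∂(arc P.S) = 0 := by
        by_cases hS : ({a, b} : Finset Plane) ∈ T.lineEdges P.S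
        · rw [(h.lineLoad G hab hr0 hφ).2 hS,
            hφ.integral_arc_hull_pair hr0 hrd h.norm_eq h.perp]
          simp [hz]
        · exact (h.lineLoad G hab hr0 hφ).1 hS
      simp only [hload, hz, mul_zero, zero_sub, sub_zero, integral_neg, abs_neg] at hpair
      refine hpair.trans (le_of_eq ?_)
      ring
  have hsq := integral_arc_sq_le h.norm_eq h.perp (J := JM) (M := C₁ * (C₂ * Y / r))
    fun t ht => hJ t (by rw [hdr] at ht; linarith)
  have hZ0 : 0 ≤ ∑ L ∈ s, P.localBound (u - uh) fh L :=
    Finset.sum_nonneg fun L _ => P.localBound_nonneg _ fh L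
  calc dist a b * ∫ x, JM x ^ 2 ∂(arc (hull {a, b}))
      ≤ dist a b * (dist a b * (C₁ * (C₂ * Y / r)) ^ 2) := mul_le_mul_of_nonneg_left hsq hd.le
    _ = (2 * (κ + 1) * C₁ * C₂) ^ 2 * Y ^ 2 := by rw [hdr]; field_simp
    _ ≤ (2 * (κ + 1) * C₁ * C₂) ^ 2 * (2 * ∑ L ∈ s, P.localBound (u - uh) fh L) :=
      mul_le_mul_of_nonneg_left hYsq (sq_nonneg _)
    _ ≤ _ := by linarith

/-- The weighted shear force residual of an edge is bounded by the error and the oscillation on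
the adjacent triangles, and the oscillation of the line load if there is one on the edge. -/
theorem exists_shear_bound (mat : Material) {κ : ℝ} (hκ : 1 ≤ κ) (k m : ℕ) {C₀ : ℝ} (hC₀ : 0 ≤ C₀) :
    ∃ C > 0, ∀ (P : Problem) (T : Triangulation P.Ω) (u uh : Plane → ℝ)
      (fh : Finset Plane → MvPolynomial (Fin 2) ℝ) (a b n : Plane) (s : Finset (Finset Plane))
      (JV JM : Plane → ℝ), IsApproximation P mat T κ k u uh →
      (∀ K ∈ T.tri, size K ^ 4 * ∫ x in innerPart K,
        (mat.plateOp (onElement K uh) x - P.f x) ^ 2 ≤ C₀ * P.localBound (u - uh) fh K) →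
      a ≠ b → IsEdgePatch mat T uh k a b n (dist a b / (2 * (κ + 1))) s JV JM →
      (∀ φ B, IsTestFunction (midpoint ℝ a b) (dist a b / (2 * (κ + 1))) B φ →
        P.EssentialBC s φ) →
      (({a, b} : Finset Plane) ∉ T.lineEdges P.S →
        dist a b ^ 3 * ∫ x, JV x ^ 2 ∂(arc (hull {a, b}))
          ≤ C * ∑ L ∈ s, P.localBound (u - uh) fh L) ∧
      (({a, b} : Finset Plane) ∈ T.lineEdges P.S → ∀ q : MvPolynomial (Fin 2) ℝ,
        q.totalDegree ≤ m → dist a b ^ 3 * ∫ x, (JV x - P.g x) ^ 2 ∂(arc (hull {a, b}))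
          ≤ C * ((∑ L ∈ s, P.localBound (u - uh) fh L)
            + dist a b ^ 3 * ∫ x, (P.g x - q.eval x) ^ 2 ∂(arc (hull {a, b})))) := by
  obtain ⟨C₁, hC₁, hline⟩ := exists_line_bound_value (max k m) (R := κ + 1) (by linarith)
  set C₂ := 16 * mat.densityBound + 2 * √C₀ with hC₂
  have hC₂0 : 0 ≤ C₂ := by have := densityBound_nonneg mat; positivity
  set A := 2 * (κ + 1) with hA
  have hA0 : 0 < A := by positivity
  refine ⟨8 * (A ^ 2 * C₁ * C₂) ^ 2 + 4 * (A * C₁) ^ 2 + 2, by positivity,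
    fun P T u uh fh a b n s JV JM G helem hab h hadm => ?_⟩
  have hd : 0 < dist a b := dist_pos.mpr hab
  set r := dist a b / A with hr
  have hdr : dist a b = A * r := by rw [hr]; field_simp
  have hr0 : 0 < r := by positivity
  have hrd : r ≤ dist a b / 2 := by rw [hdr]; nlinarith
  set Y := ∑ L ∈ s, √(P.localBound (u - uh) fh L) with hY
  have hY0 : 0 ≤ Y := Finset.sum_nonneg fun L _ => Real.sqrt_nonneg _
  have hYsq := h.sq_sum_sqrt_le (P := P) (fh := fh) (u - uh)
  set Z := ∑ L ∈ s, P.localBound (u - uh) fh L with hZ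
  have hZ0 : 0 ≤ Z := Finset.sum_nonneg fun L _ => P.localBound_nonneg _ fh L
  -- the estimate of a polynomial residual `J` whose pairings are bounded by `X`
  have hfinal : ∀ (X : ℝ) (J : Plane → ℝ), 0 ≤ X → IsPoly (max k m) J →
      (∀ φ B, IsTestFunction (midpoint ℝ a b) r B φ →
        (∀ t, fderiv ℝ φ (line (midpoint ℝ a b) (tangent n) t) n = 0) →
        |∫ t, J (line (midpoint ℝ a b) (tangent n) t) * φ (line (midpoint ℝ a b) (tangent n) t)|
          ≤ X * B) →
      dist a b ^ 3 * ∫ x, J x ^ 2 ∂(arc (hull {a, b})) ≤ (A * C₁) ^ 2 * (dist a b * X) ^ 2 := by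
    intro X J hX hJp hpair
    have hJ := hline (midpoint ℝ a b) n r X J h.norm_eq hr0 hX hJp hpair
    have hsq := integral_arc_sq_le h.norm_eq h.perp (J := J) (M := C₁ * (X / r))
      fun t ht => hJ t (by rw [hdr, hA] at ht; linarith)
    calc dist a b ^ 3 * ∫ x, J x ^ 2 ∂(arc (hull {a, b}))
        ≤ dist a b ^ 3 * (dist a b * (C₁ * (X / r)) ^ 2) :=
          mul_le_mul_of_nonneg_left hsq (by positivity)
      _ = _ := by rw [hdr]; field_simp
  have hVpoly : IsPoly (max k m) JV := h.isPoly_shear.mono (le_max_left _ _)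
  have hdY : ∀ G₂ : ℝ, 0 ≤ G₂ → (A * C₁) ^ 2 * (dist a b * (C₂ * Y / r + G₂)) ^ 2
      ≤ 4 * (A ^ 2 * C₁ * C₂) ^ 2 * Z + 2 * (A * C₁) ^ 2 * (dist a b * G₂) ^ 2 := by
    intro G₂ hG₂
    have e1 : dist a b * (C₂ * Y / r + G₂) = A * C₂ * Y + dist a b * G₂ := by
      rw [hdr]
      field_simp
    have e2 : (A * C₂ * Y + dist a b * G₂) ^ 2 ≤ 2 * (A * C₂ * Y) ^ 2 + 2 * (dist a b * G₂) ^ 2 := by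
      nlinarith [sq_nonneg (A * C₂ * Y - dist a b * G₂)]
    have e3 : (A * C₂ * Y) ^ 2 ≤ (A * C₂) ^ 2 * (2 * Z) := by
      rw [mul_pow]
      exact mul_le_mul_of_nonneg_left hYsq (sq_nonneg _)
    rw [e1]
    calc _ ≤ (A * C₁) ^ 2 * (2 * ((A * C₂) ^ 2 * (2 * Z)) + 2 * (dist a b * G₂) ^ 2) :=
          mul_le_mul_of_nonneg_left (by linarith) (sq_nonneg _)
      _ = _ := by ring
  constructor
  · intro hS
    have h1 := hfinal (C₂ * Y / r + 0) JV (by positivity) hVpoly fun φ B hφ hz => by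
      have hpair := h.abs_pairing_le G hab hr0 (by linarith) hC₀ helem hφ (hadm φ B hφ)
      simp only [(h.lineLoad G hab hr0 hφ).1 hS, hz, mul_zero, sub_zero] at hpair
      refine hpair.trans (le_of_eq ?_)
      ring
    have h2 := hdY 0 le_rfl
    nlinarith [sq_nonneg (A ^ 2 * C₁ * C₂), sq_nonneg (A * C₁),
      mul_nonneg (sq_nonneg (A ^ 2 * C₁ * C₂)) hZ0, mul_nonneg (sq_nonneg (A * C₁)) hZ0]
  · intro hS q hq
    set μE := arc (hull {a, b}) with hμE
    have hμfin : IsFiniteMeasure μE := ⟨by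
      rw [hμE, arc_hull_pair_univ h.norm_eq h.perp]
      exact ENNReal.ofReal_lt_top⟩
    have hpolyE : ∀ {F : Plane → ℝ}, Continuous F → MemLp F 2 μE := fun {F} hF => by
      obtain ⟨M, hM⟩ := (isCompact_hull {a, b}).exists_bound_of_continuousOn hF.continuousOn
      refine MemLp.of_bound hF.aestronglyMeasurable M ?_
      filter_upwards [ae_restrict_mem (isClosed_hull {a, b}).measurableSet] with x hx using hM x hx
    have hqc : Continuous fun x : Plane => q.eval x := (contDiff_eval q).continuous
    have hgE : MemLp P.g 2 μE := by
      classical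
      exact P.g_mem.mono_measure (Measure.restrict_mono (Finset.mem_filter.mp hS).2 le_rfl)
    have hgq : MemLp (fun x => P.g x - q.eval x) 2 μE := hgE.sub (hpolyE hqc)
    set G₂ := ∫ x, (P.g x - q.eval x) ^ 2 ∂μE with hG₂
    have hG₂0 : 0 ≤ G₂ := integral_nonneg fun x => sq_nonneg _
    set J : Plane → ℝ := fun x => JV x - q.eval x with hJ
    have hJp : IsPoly (max k m) J :=
      hVpoly.sub ⟨q, hq.trans (le_max_right _ _), fun _ => rfl⟩
    have h1 := hfinal (C₂ * Y / r + √(dist a b) * √G₂) J (by positivity) hJp fun φ B hφ hz => by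
      have hpair := h.abs_pairing_le G hab hr0 (by linarith) hC₀ helem hφ (hadm φ B hφ)
      have hφE : MemLp φ 2 μE := hpolyE hφ.contDiff.continuous
      simp only [(h.lineLoad G hab hr0 hφ).2 hS, hz, mul_zero, sub_zero] at hpair
      rw [← hφ.integral_arc_hull_pair hr0 hrd h.norm_eq h.perp] at hpair ⊢
      have hosc := abs_integral_mul_le hgq MeasurableSet.univ (R := √(dist a b)) hφ.nonneg
        (Real.sqrt_nonneg _)
        (by rw [Real.sq_sqrt hd.le, hμE, arc_hull_pair_univ h.norm_eq h.perp])
        hφ.abs_le fun x hx => absurd (Set.mem_univ x) hx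
      have i1 : Integrable (fun x => JV x * φ x) μE :=
        (hpolyE hVpoly.contDiff.continuous).integrable_mul hφE
      have i2 : Integrable (fun x => P.g x * φ x) μE := hgE.integrable_mul hφE
      have i3 : Integrable (fun x => (P.g x - q.eval x) * φ x) μE := hgq.integrable_mul hφE
      have hsplit : ∫ x, J x * φ x ∂μE = ((∫ x, JV x * φ x ∂μE) - ∫ x, P.g x * φ x ∂μE)
          + ∫ x, (P.g x - q.eval x) * φ x ∂μE := by
        have i12 : Integrable (fun x => JV x * φ x - P.g x * φ x) μE := i1.sub i2
        rw [← integral_sub i1 i2, ← integral_add i12 i3]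
        congr 1
        ext x
        simp only [hJ]
        ring
      rw [hsplit]
      refine (abs_add_le _ _).trans ((add_le_add hpair hosc).trans (le_of_eq ?_))
      ring
    have h2 := hdY (√(dist a b) * √G₂) (by positivity)
    have e1 : (dist a b * (√(dist a b) * √G₂)) ^ 2 = dist a b ^ 3 * G₂ := by
      rw [mul_pow, mul_pow, Real.sq_sqrt hd.le, Real.sq_sqrt hG₂0]
      ring
    rw [e1] at h2
    have hsum : ∫ x, (JV x - P.g x) ^ 2 ∂μE ≤ 2 * (∫ x, J x ^ 2 ∂μE) + 2 * G₂ := by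
      have i1 := (hpolyE hJp.contDiff.continuous).integrable_sq
      have i2 := hgq.integrable_sq
      rw [hG₂, ← integral_const_mul, ← integral_const_mul,
        ← integral_add (i1.const_mul 2) (i2.const_mul 2)]
      refine integral_mono_of_nonneg (Eventually.of_forall fun x => sq_nonneg _)
        ((i1.const_mul 2).add (i2.const_mul 2)) (Eventually.of_forall fun x => ?_)
      simp only [hJ]
      nlinarith [sq_nonneg (JV x - q.eval x + (P.g x - q.eval x))]
    have hd3 : 0 ≤ dist a b ^ 3 * G₂ := by positivity
    have hs1 := mul_nonneg (sq_nonneg (A ^ 2 * C₁ * C₂)) hZ0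
    have hs2 := mul_nonneg (sq_nonneg (A * C₁)) hZ0
    have hs3 := mul_nonneg (sq_nonneg (A ^ 2 * C₁ * C₂)) hd3
    calc dist a b ^ 3 * ∫ x, (JV x - P.g x) ^ 2 ∂μE
        ≤ dist a b ^ 3 * (2 * (∫ x, J x ^ 2 ∂μE) + 2 * G₂) :=
          mul_le_mul_of_nonneg_left hsum (by positivity)
      _ ≤ 2 * (4 * (A ^ 2 * C₁ * C₂) ^ 2 * Z + 2 * (A * C₁) ^ 2 * (dist a b ^ 3 * G₂))
          + 2 * (dist a b ^ 3 * G₂) := by linarith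
      _ ≤ _ := by linarith

/-! ### The patches of triangles around an edge -/

lemma Material.integrable_lineTerm (mat : Material) {p φ : Plane → ℝ} (hp : ContDiff ℝ ∞ p)
    (hφ : ContDiff ℝ ∞ φ) (hc : HasCompactSupport φ) (m n n' : Plane) {v : Plane} (hv : ‖v‖ = 1) :
    Integrable fun t => mat.Vn p n (line m v t) * φ (line m v t)
      - mat.Mnn p n (line m v t) * fderiv ℝ φ (line m v t) n' := by
  have hV : Continuous (mat.Vn p n) :=
    ((mat.contDiff_Qn hp n).continuous).add
      (((mat.contDiff_Mns hp n).continuous_fderiv (by simp)).clm_apply continuous_const)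
  have hM : Continuous (mat.Mnn p n) := (mat.contDiff_Mnn hp n).continuous
  have hd : Continuous fun x => fderiv ℝ φ x n' :=
    (hφ.continuous_fderiv (by simp)).clm_apply continuous_const
  have hline := (contDiff_line m v).continuous
  have h1 : HasCompactSupport fun x => mat.Vn p n x * φ x := hc.mul_left
  have h2 : HasCompactSupport fun x => mat.Mnn p n x * fderiv ℝ φ x n' :=
    (hc.fderiv_apply ℝ n').mul_left
  exact (((hV.mul hφ.continuous).comp hline).integrable_of_hasCompactSupport
      (hasCompactSupport_comp_line h1 m hv)).sub
    (((hM.mul hd).comp hline).integrable_of_hasCompactSupport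
      (hasCompactSupport_comp_line h2 m hv))

lemma Material.lineTerm_neg (mat : Material) (p φ : Plane → ℝ) (m n : Plane) :
    mat.lineTerm p φ m (-n) = ∫ t, (mat.Vn p (-n) (line m (tangent n) t) * φ (line m (tangent n) t)
      - mat.Mnn p (-n) (line m (tangent n) t) * fderiv ℝ φ (line m (tangent n) t) (-n)) := by
  have ht : tangent (-n) = -tangent n := by
    ext i
    fin_cases i <;> simp [tangent]
  have hl : ∀ t, line m (tangent (-n)) t = line m (tangent n) (-t) := fun t => by
    simp [line, ht]
  simp only [lineTerm, hl]
  exact integral_neg_eq_self (fun t => mat.Vn p (-n) (line m (tangent n) t)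
    * φ (line m (tangent n) t) - mat.Mnn p (-n) (line m (tangent n) t)
    * fderiv ℝ φ (line m (tangent n) t) (-n)) volume

/-- On a common edge, the boundary terms of two half planes add up to jumps. -/
lemma Material.lineTerm_add_lineTerm_neg (mat : Material) {p q φ : Plane → ℝ}
    (hp : ContDiff ℝ ∞ p) (hq : ContDiff ℝ ∞ q) (hφ : ContDiff ℝ ∞ φ) (hc : HasCompactSupport φ)
    (m : Plane) {n : Plane} (hn : ‖n‖ = 1) :
    mat.lineTerm p φ m n + mat.lineTerm q φ m (-n)
      = ∫ t, ((mat.Vn p n (line m (tangent n) t) + mat.Vn q (-n) (line m (tangent n) t))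
          * φ (line m (tangent n) t)
        - (mat.Mnn p n (line m (tangent n) t) - mat.Mnn q (-n) (line m (tangent n) t))
          * fderiv ℝ φ (line m (tangent n) t) n) := by
  have ht : ‖tangent n‖ = 1 := by rw [norm_tangent, hn]
  rw [mat.lineTerm_neg, Material.lineTerm,
    ← integral_add (mat.integrable_lineTerm hp hφ hc _ _ _ ht)
      (mat.integrable_lineTerm hq hφ hc _ _ _ ht)]
  congr 1
  ext t
  rw [map_neg]
  ring

variable {P : Problem} {mat : Material} {T : Triangulation P.Ω} {κ : ℝ} {k : ℕ} {u uh : Plane → ℝ}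

open Classical in
/-- The patch of an interior edge consists of two triangles. -/
lemma IsApproximation.isEdgePatch_interior (G : IsApproximation P mat T κ k u uh) {a b : Plane}
    (hab : a ≠ b) (hE : ({a, b} : Finset Plane) ∈ T.interiorEdges) :
    IsEdgePatch mat T uh k a b (outerNormal (T.tri₁ {a, b}) {a, b}) (dist a b / (2 * (κ + 1)))
      {T.tri₁ {a, b}, T.tri₂ {a, b}} (mat.jumpVn T {a, b} uh) (mat.jumpMnn T {a, b} uh) ∧
    Metric.ball (midpoint ℝ a b) (dist a b / (2 * (κ + 1))) ⊆ P.Ω := by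
  have hκ : 0 < κ := by linarith [G.one_le]
  have hEe : ({a, b} : Finset Plane) ∈ T.edges := (Finset.mem_filter.mp hE).1
  have hspec := T.tri₁_spec hEe
  have hspec' := T.tri₂_spec P.isOpen hκ G.regular hE
  generalize hKd : T.tri₁ {a, b} = K at hspec hspec' ⊢
  generalize hLd : T.tri₂ {a, b} = L at hspec' ⊢
  obtain ⟨hK, hEK⟩ := hspec
  obtain ⟨hL, hEL, hne⟩ := hspec'
  have hr : 0 < dist a b / (2 * (κ + 1)) := by have := dist_pos.mpr hab; positivity
  have hdK := T.isHalfDisc hκ G.regular hK hab hEK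
  have hdL := T.isHalfDisc hκ G.regular hL hab hEL
  have hneg := T.normal_eq_neg hK hL hne.symm hab hr hr hdK hdL
  have hball : Metric.ball (midpoint ℝ a b) (dist a b / (2 * (κ + 1))) ⊆ P.Ω := by
    rw [← P.interior_closure]
    refine interior_maximal ?_ Metric.isOpen_ball
    refine (hdK.ball_subset (hneg ▸ hdL)).trans ?_
    exact Set.union_subset (T.hull_subset_closure hK) (T.hull_subset_closure hL)
  have hs : ∀ M ∈ ({K, L} : Finset (Finset Plane)), M ∈ T.tri ∧ {a, b} ⊆ M := by
    intro M hM
    rcases Finset.mem_insert.mp hM with rfl | hM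
    · exact ⟨hK, hEK⟩
    · rw [Finset.mem_singleton] at hM
      exact hM ▸ ⟨hL, hEL⟩
  have hhd : ∀ M ∈ ({K, L} : Finset (Finset Plane)),
      IsHalfDisc M a b (outerNormal M {a, b}) (dist a b / (2 * (κ + 1))) := fun M hM =>
    T.isHalfDisc hκ G.regular (hs M hM).1 hab (hs M hM).2
  have hJV : mat.jumpVn T {a, b} uh = fun x => mat.Vn (onElement K uh) (outerNormal K {a, b}) x
      + mat.Vn (onElement L uh) (outerNormal L {a, b}) x := by
    funext x
    simp only [Material.jumpVn, Material.edgeVn, hKd, hLd]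
  have hJM : mat.jumpMnn T {a, b} uh = fun x => mat.Mnn (onElement K uh) (outerNormal K {a, b}) x
      - mat.Mnn (onElement L uh) (outerNormal L {a, b}) x := by
    funext x
    simp only [Material.jumpMnn, Material.edgeMnn, hKd, hLd]
  rw [hJV, hJM]
  refine ⟨⟨fun M hM => (hs M hM).1, fun M hM hEM => ?_, fun M hM => (hs M hM).2,
    Finset.card_le_two, ⟨K, by simp⟩, hdK.norm_eq, hdK.perp,
    fun M hM x hx hxM => (hhd M hM).mem_openStar x hx hxM,
    (mat.isPoly_Vn (G.isPoly hK) _).add (mat.isPoly_Vn (G.isPoly hL) _),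
    (mat.isPoly_Mnn (G.isPoly hK) _).sub (mat.isPoly_Mnn (G.isPoly hL) _),
    fun M => outerNormal M {a, b}, fun M hM => (hhd M hM).norm_eq,
    fun M hM y hy => (hhd M hM).innerPart_inter_ball hy, fun φ hφ hc => ?_⟩, hball⟩
  · rcases T.eq_or_eq hκ G.regular hK hL hM hab hEK hEL hEM hne.symm with rfl | rfl <;> simp
  · simp only [Finset.sum_pair hne.symm, hneg]
    rw [mat.lineTerm_add_lineTerm_neg (G.isPoly hK).contDiff (G.isPoly hL).contDiff hφ hc _
      hdK.norm_eq]

/-- The patch of a boundary edge is a single triangle. -/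
lemma IsApproximation.isEdgePatch_boundary (G : IsApproximation P mat T κ k u uh) {a b : Plane}
    (hab : a ≠ b) (hE : ({a, b} : Finset Plane) ∈ T.edges) (hfr : hull {a, b} ⊆ frontier P.Ω) :
    IsEdgePatch mat T uh k a b (outerNormal (T.tri₁ {a, b}) {a, b}) (dist a b / (2 * (κ + 1)))
      {T.tri₁ {a, b}} (mat.edgeVn (T.tri₁ {a, b}) {a, b} uh)
      (mat.edgeMnn (T.tri₁ {a, b}) {a, b} uh) := by
  have hκ : 0 < κ := by linarith [G.one_le]
  set K := T.tri₁ {a, b} with hKd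
  obtain ⟨hK, hEK⟩ := T.tri₁_spec hE
  have hdK := T.isHalfDisc hκ G.regular hK hab hEK
  refine ⟨by simpa using hK, fun M hM hEM => ?_, fun M hM => ?_, by simp, ⟨K, by simp⟩,
    hdK.norm_eq, hdK.perp, fun M hM x hx hxM => ?_, mat.isPoly_Vn (G.isPoly hK) _,
    mat.isPoly_Mnn (G.isPoly hK) _, fun _ => outerNormal K {a, b}, fun _ _ => hdK.norm_eq,
    fun M hM y hy => ?_, fun φ hφ hc => ?_⟩
  · rw [Finset.mem_singleton]
    exact P.eq_of_subset_frontier T hκ G.regular hK hM hab hEK hEM hfr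
  · rw [Finset.mem_singleton] at hM
    exact hM ▸ hEK
  · rw [Finset.mem_singleton] at hM
    subst hM
    exact hdK.mem_openStar x hx hxM
  · rw [Finset.mem_singleton] at hM
    subst hM
    exact hdK.innerPart_inter_ball hy
  · rw [Finset.sum_singleton]
    rfl

/-! ### Essential boundary conditions of the test functions -/

lemma Problem.essentialBC_of_ae (P : Problem) {s : Finset (Finset Plane)} {φ : Plane → ℝ}
    (h0 : ∀ᵐ x ∂(arc (P.Γc ∪ P.Γs)), x ∈ ⋃ L ∈ s, hull L → φ x = 0)
    (h1 : ∀ᵐ x ∂(arc P.Γc), x ∈ ⋃ L ∈ s, hull L → x ∉ tsupport φ) : P.EssentialBC s φ := by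
  refine ⟨?_, fun i => ?_⟩
  · filter_upwards [h0] with x hx
    rw [Set.indicator_apply_eq_zero]
    exact hx
  · filter_upwards [h1] with x hx
    rw [Set.indicator_apply_eq_zero]
    exact fun hxA => image_eq_zero_of_notMem_tsupport fun h' =>
      hx hxA (tsupport_pd_subset _ _ h')

lemma Problem.measurableSet_Γ (P : Problem) :
    MeasurableSet P.Γc ∧ MeasurableSet (P.Γc ∪ P.Γs) :=
  ⟨P.clamped_segments.measurableSet,
    P.clamped_segments.measurableSet.union P.supported_segments.measurableSet⟩

/-- A test function near an interior edge does not reach the boundary. -/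
lemma Problem.essentialBC_of_subset (P : Problem) {s : Finset (Finset Plane)} {c : Plane}
    {r B : ℝ} {φ : Plane → ℝ} (hφ : IsTestFunction c r B φ) (hr : 0 < r)
    (hball : Metric.ball c r ⊆ P.Ω) : P.EssentialBC s φ := by
  have hfr : ∀ x ∈ P.Γc ∪ P.Γs, x ∉ tsupport φ := fun x hx hxφ => by
    have h1 : x ∈ frontier P.Ω := P.boundary ▸ Or.inl hx
    rw [P.isOpen.frontier_eq] at h1
    exact h1.2 (hball (hφ.tsupport_subset_ball hr hxφ))
  refine P.essentialBC_of_ae ?_ ?_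
  · filter_upwards [ae_restrict_mem P.measurableSet_Γ.2] with x hx _
    exact image_eq_zero_of_notMem_tsupport (hfr x hx)
  · filter_upwards [ae_restrict_mem P.measurableSet_Γ.1] with x hx _
    exact hfr x (Or.inl hx)

lemma ae_arc_notMem {Γ A : Set Plane} (h : (μH[1] : Measure Plane) (Γ ∩ A) = 0)
    (hA : MeasurableSet A) : ∀ᵐ x ∂(arc Γ), x ∉ A := by
  rw [ae_iff, arc, Measure.restrict_apply (by simpa using hA)]
  simpa [Set.inter_comm] using h

/-- Near a boundary edge, the boundary of the domain consists of this edge. -/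
lemma IsHalfDisc.mem_hull_of_frontier {K : Finset Plane} {a b n x : Plane} {r : ℝ}
    (h : IsHalfDisc K a b n r) (hrd : r ≤ dist a b / 2) (hK : innerPart K ⊆ P.Ω)
    (hx : x ∈ frontier P.Ω) (hxK : x ∈ hull K) (hxb : x ∈ Metric.ball (midpoint ℝ a b) r) :
    x ∈ hull {a, b} := by
  have h1 : x ∉ innerPart K := fun h' => by
    rw [P.isOpen.frontier_eq] at hx
    exact hx.2 (hK h')
  have h2 : ⟪x - midpoint ℝ a b, n⟫ = 0 :=
    le_antisymm (h.inner_le x hxK) (not_lt.mp fun h' => h1 ((h.innerPart_inter_ball hxb).mpr h'))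
  have h3 := eq_smul_tangent h.norm_eq h2
  rw [hull_pair_eq h.norm_eq h.perp]
  refine ⟨⟪tangent n, x - midpoint ℝ a b⟫, ?_, ?_⟩
  · rw [Set.mem_Icc, ← abs_le, abs_inner_tangent h.norm_eq h2, ← dist_eq_norm]
    exact (Metric.mem_ball.mp hxb).le.trans hrd
  · rw [line, ← h3, add_sub_cancel]

/-- Test functions near a boundary edge satisfy the essential boundary conditions if the edge is
free, or if it is simply supported and they vanish on it. -/
lemma IsApproximation.essentialBC_boundary (G : IsApproximation P mat T κ k u uh) {a b : Plane}
    (hab : a ≠ b) (hE : ({a, b} : Finset Plane) ∈ T.edges) {B : ℝ}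
    {φ : Plane → ℝ}
    (hφ : IsTestFunction (midpoint ℝ a b) (dist a b / (2 * (κ + 1))) B φ)
    (hΓ : hull {a, b} ⊆ P.Γf ∨ (hull {a, b} ⊆ P.Γs ∧ ∀ x ∈ hull {a, b}, φ x = 0)) :
    P.EssentialBC {T.tri₁ {a, b}} φ := by
  have hκ : 0 < κ := by linarith [G.one_le]
  have hd := dist_pos.mpr hab
  have hr : 0 < dist a b / (2 * (κ + 1)) := by positivity
  have hrd : dist a b / (2 * (κ + 1)) ≤ dist a b / 2 :=
    div_le_div_of_nonneg_left hd.le (by norm_num) (by linarith)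
  obtain ⟨hK, hEK⟩ := T.tri₁_spec hE
  have hdK := T.isHalfDisc hκ G.regular hK hab hEK
  have hEm : MeasurableSet (hull {a, b}) := (isClosed_hull _).measurableSet
  have hmem : ∀ x ∈ P.Γc ∪ P.Γs, x ∈ ⋃ L ∈ ({T.tri₁ {a, b}} : Finset (Finset Plane)), hull L →
      x ∈ tsupport φ → x ∈ hull {a, b} := fun x hx hxA hxφ => by
    simp only [Finset.mem_singleton, Set.iUnion_iUnion_eq_left] at hxA
    exact hdK.mem_hull_of_frontier hrd (P.innerPart_subset T hK)
      (P.boundary ▸ Or.inl hx) hxA (hφ.tsupport_subset_ball hr hxφ)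
  have hnull : ∀ᵐ x ∂(arc P.Γc), x ∉ hull {a, b} := by
    refine ae_arc_notMem ?_ hEm
    rcases hΓ with h | ⟨h, -⟩
    · exact measure_mono_null (Set.inter_subset_inter_right _ h) P.clamped_free
    · exact measure_mono_null (Set.inter_subset_inter_right _ h) P.clamped_supported
  refine P.essentialBC_of_ae ?_ ?_
  · rcases hΓ with h | ⟨-, h⟩
    · have hnull' : ∀ᵐ x ∂(arc (P.Γc ∪ P.Γs)), x ∉ hull {a, b} := by
        refine ae_arc_notMem ?_ hEm
        rw [Set.union_inter_distrib_right]
        refine measure_union_null ?_ ?_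
        · exact measure_mono_null (Set.inter_subset_inter_right _ h) P.clamped_free
        · exact measure_mono_null (Set.inter_subset_inter_right _ h) P.supported_free
      filter_upwards [ae_restrict_mem P.measurableSet_Γ.2, hnull'] with x hx hx' hxA
      exact image_eq_zero_of_notMem_tsupport fun hxφ => hx' (hmem x hx hxA hxφ)
    · filter_upwards [ae_restrict_mem P.measurableSet_Γ.2] with x hx hxA
      by_contra hne
      exact hne (h x (hmem x hx hxA (subset_tsupport φ hne)))
  · filter_upwards [ae_restrict_mem P.measurableSet_Γ.1, hnull] with x hx hx' hxA hxφ
    exact hx' (hmem x (Or.inl hx) hxA hxφ)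

/-! ### Summation over the mesh -/

lemma Triangulation.ShapeRegular.mono {Ω : Set Plane} {T : Triangulation Ω} {κ κ' : ℝ}
    (h : T.ShapeRegular κ) (hκ : κ ≤ κ') : T.ShapeRegular κ' := fun K hK => by
  obtain ⟨c, ρ, hρ, hsub, hsize⟩ := h K hK
  exact ⟨c, ρ, hρ, hsub, hsize.trans (mul_le_mul_of_nonneg_right hκ hρ.le)⟩

lemma setIntegral_hull (K : Finset Plane) (F : Plane → ℝ) :
    ∫ x in hull K, F x = ∫ x in innerPart K, F x :=
  setIntegral_congr_set (innerPart_ae_eq_hull K).symm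

lemma Problem.sum_setIntegral_innerPart_le (P : Problem) (T : Triangulation P.Ω) {F : Plane → ℝ}
    (hF : IntegrableOn F P.Ω) (h0 : ∀ x, 0 ≤ F x) :
    ∑ K ∈ T.tri, ∫ x in innerPart K, F x ≤ ∫ x in P.Ω, F x := by
  have hm : ∀ K ∈ T.tri, MeasurableSet (innerPart K) := fun K _ => isOpen_interior.measurableSet
  have hd : Set.Pairwise (T.tri : Set (Finset Plane)) (Function.onFun Disjoint innerPart) :=
    fun K hK L hL hne => T.disjoint_innerPart hK hL hne
  rw [← integral_biUnion_finset T.tri hm hd fun K hK => hF.mono_set (P.innerPart_subset T hK)]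
  have hs : ⋃ K ∈ T.tri, innerPart K ⊆ P.Ω :=
    Set.iUnion₂_subset fun K hK => P.innerPart_subset T hK
  exact setIntegral_mono_set hF (Eventually.of_forall h0) hs.eventuallyLE

lemma Problem.sum_energy_le (P : Problem) (T : Triangulation P.Ω) {e : Plane → ℝ}
    (he : ∀ i j, MemLp (fun x => weakHess P.Ω e x i j) 2 (volume.restrict P.Ω)) :
    ∑ K ∈ T.tri, P.energy e K ≤ normH2 P.Ω e ^ 2 := by
  have h : ∀ i j, ∑ K ∈ T.tri, ∫ x in innerPart K, weakHess P.Ω e x i j ^ 2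
      ≤ ∫ x in P.Ω, weakHess P.Ω e x i j ^ 2 := fun i j =>
    P.sum_setIntegral_innerPart_le T (he i j).integrable_sq fun x => sq_nonneg _
  calc ∑ K ∈ T.tri, P.energy e K
      = ∑ i, ∑ j, ∑ K ∈ T.tri, ∫ x in innerPart K, weakHess P.Ω e x i j ^ 2 := by
        simp only [Problem.energy]
        rw [Finset.sum_comm]
        exact Finset.sum_congr rfl fun i _ => Finset.sum_comm
    _ ≤ ∑ i, ∑ j, ∫ x in P.Ω, weakHess P.Ω e x i j ^ 2 :=
        Finset.sum_le_sum fun i _ => Finset.sum_le_sum fun j _ => h i j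
    _ ≤ _ := sum_weakHess_le_normH2 P.Ω e

lemma Problem.sum_oscSq (P : Problem) (T : Triangulation P.Ω)
    (fh : Finset Plane → MvPolynomial (Fin 2) ℝ) :
    ∑ K ∈ T.tri, size K ^ 4 * P.oscSq (fh K) K = P.oscF T fh ^ 2 := by
  rw [oscF, Real.sq_sqrt (Finset.sum_nonneg fun K _ => sq_nonneg _)]
  refine Finset.sum_congr rfl fun K _ => ?_
  rw [oscElement, mul_pow, normL2_sq, ← pow_mul, setIntegral_hull]
  rfl

lemma oscEdge_sq (E : Finset Plane) (g : Plane → ℝ) (q : MvPolynomial (Fin 2) ℝ) :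
    oscEdge E g q ^ 2 = size E ^ 3 * ∫ x, (g x - q.eval x) ^ 2 ∂(arc (hull E)) := by
  rw [oscEdge, mul_pow, normL2_sq, ← Real.rpow_natCast, ← Real.rpow_mul (size_nonneg E)]
  norm_num

open Classical in
/-- Every triangle has three edges. -/
lemma Triangulation.sum_edges_le {Ω : Set Plane} (T : Triangulation Ω) {Z : Finset Plane → ℝ}
    (hZ : ∀ K, 0 ≤ Z K) :
    ∑ E ∈ T.edges, ∑ K ∈ T.tri.filter (fun K => E ⊆ K), Z K ≤ 3 * ∑ K ∈ T.tri, Z K := by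
  simp only [Finset.sum_filter]
  rw [Finset.sum_comm, Finset.mul_sum]
  refine Finset.sum_le_sum fun K hK => ?_
  rw [← Finset.sum_filter, Finset.sum_const, nsmul_eq_mul]
  refine mul_le_mul_of_nonneg_right ?_ (hZ K)
  have hsub : T.edges.filter (fun E => E ⊆ K) ⊆ K.powersetCard 2 := fun E hE => by
    rw [Finset.mem_filter] at hE
    exact Finset.mem_powersetCard.mpr ⟨hE.2, T.card_of_mem_edges hE.1⟩
  have := Finset.card_le_card hsub
  rw [Finset.card_powersetCard, T.card_eq K hK] at this
  exact_mod_cast this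

open Classical in
lemma Triangulation.sum_le_sum_edges {Ω : Set Plane} (T : Triangulation Ω) {Z : Finset Plane → ℝ}
    (hZ : ∀ K, 0 ≤ Z K) {s : Finset (Finset Plane)} (hs : s ⊆ T.edges) {F : Finset Plane → ℝ}
    {C : ℝ} (hC : 0 ≤ C)
    (hF : ∀ E ∈ s, F E ≤ C * ∑ K ∈ T.tri.filter (fun K => E ⊆ K), Z K) :
    ∑ E ∈ s, F E ≤ 3 * C * ∑ K ∈ T.tri, Z K := by
  calc ∑ E ∈ s, F E ≤ ∑ E ∈ s, C * ∑ K ∈ T.tri.filter (fun K => E ⊆ K), Z K :=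
        Finset.sum_le_sum hF
    _ ≤ ∑ E ∈ T.edges, C * ∑ K ∈ T.tri.filter (fun K => E ⊆ K), Z K :=
        Finset.sum_le_sum_of_subset_of_nonneg hs fun E _ _ =>
          mul_nonneg hC (Finset.sum_nonneg fun K _ => hZ K)
    _ = C * ∑ E ∈ T.edges, ∑ K ∈ T.tri.filter (fun K => E ⊆ K), Z K := by rw [Finset.mul_sum]
    _ ≤ C * (3 * ∑ K ∈ T.tri, Z K) := mul_le_mul_of_nonneg_left (T.sum_edges_le hZ) hC
    _ = _ := by ring

variable {P : Problem} {mat : Material} {T : Triangulation P.Ω} {κ : ℝ} {k l : ℕ} {u uh : Plane → ℝ}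
  {fh : Finset Plane → MvPolynomial (Fin 2) ℝ} {a b n : Plane} {r : ℝ}
  {s : Finset (Finset Plane)} {JV JM : Plane → ℝ}

open Classical in
lemma IsEdgePatch.sum_le (h : IsEdgePatch mat T uh l a b n r s JV JM) {Z : Finset Plane → ℝ}
    (hZ : ∀ K, 0 ≤ Z K) : ∑ L ∈ s, Z L ≤ ∑ K ∈ T.tri.filter (fun K => {a, b} ⊆ K), Z K :=
  Finset.sum_le_sum_of_subset_of_nonneg (fun L hL => Finset.mem_filter.mpr
    ⟨h.subset_tri hL, h.subset_of_mem L hL⟩) fun L _ _ => hZ L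

lemma eq_zero_on_hull_pair {φ : Plane → ℝ} (hn : ‖n‖ = 1)
    (hp : ⟪b - a, n⟫ = 0) (hz : ∀ t, φ (line (midpoint ℝ a b) (tangent n) t) = 0) :
    ∀ x ∈ hull {a, b}, φ x = 0 := by
  intro x hx
  rw [hull_pair_eq hn hp] at hx
  obtain ⟨t, -, rfl⟩ := hx
  exact hz t

open Classical in
/-- The estimator of an approximation is bounded by its error and the oscillations. -/
theorem exists_estimator_bound (mat : Material) {κ : ℝ} (hκ : 1 ≤ κ) (k m : ℕ) :
    ∃ C > 0, ∀ (P : Problem) (T : Triangulation P.Ω) (u uh : Plane → ℝ),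
      IsApproximation P mat T κ k u uh →
      ∀ fh gh : Finset Plane → MvPolynomial (Fin 2) ℝ, (∀ K ∈ T.tri, (fh K).totalDegree ≤ k) →
        (∀ E ∈ T.lineEdges P.S, (gh E).totalDegree ≤ m) →
        P.estimator mat T uh ^ 2
          ≤ C * (normH2 P.Ω (u - uh) ^ 2 + P.oscF T fh ^ 2 + P.oscG T gh ^ 2) := by
  obtain ⟨C₀, hC₀, helem⟩ := exists_element_bound mat κ k
  obtain ⟨C₁, hC₁, hmoment⟩ := exists_moment_bound mat hκ k hC₀.le
  obtain ⟨C₂, hC₂, hshear⟩ := exists_shear_bound mat hκ k m hC₀.le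
  -- the two sums of moments and the three sums of shear forces count every triangle three times
  refine ⟨C₀ + 6 * C₁ + 9 * C₂, by positivity, fun P T u uh G fh gh hfh hgh => ?_⟩
  set Z := P.localBound (u - uh) fh with hZd
  have hZ : ∀ K, 0 ≤ Z K := P.localBound_nonneg _ _
  have hel : ∀ K ∈ T.tri, size K ^ 4 * ∫ x in innerPart K,
      (mat.plateOp (onElement K uh) x - P.f x) ^ 2 ≤ C₀ * Z K := fun K hK =>
    helem P T u uh G K hK (fh K) (hfh K hK)
  have hκ0 : 0 < κ := by linarith
  have hr : ∀ {a b : Plane}, a ≠ b → 0 < dist a b / (2 * (κ + 1)) := fun hab => by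
    have := dist_pos.mpr hab
    positivity
  -- the triangles are disjoint up to null sets, so the energies of the error add up to at most its
  -- squared `H²` norm
  have htotal : ∑ K ∈ T.tri, Z K ≤ normH2 P.Ω (u - uh) ^ 2 + P.oscF T fh ^ 2 := by
    have huH : MemH2 P.Ω u := G.solution.1.2.1
    have huhH : MemH2 P.Ω uh := G.mem_V.2.1
    simp only [hZd, Problem.localBound]
    rw [Finset.sum_add_distrib, P.sum_oscSq]
    refine add_le_add_left (P.sum_energy_le T fun i j => ?_) _
    refine (((huH.weakDeriv_spec P.isOpen i j).2.2).sub
      ((huhH.weakDeriv_spec P.isOpen i j).2.2)).ae_eq ?_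
    filter_upwards [huH.weakHess_sub P.isOpen huhH] with x hx
    rw [hx]
    rfl
  have hint : T.interiorEdges ⊆ T.edges := Finset.filter_subset _ _
  have hlin : T.lineEdges P.S ⊆ T.interiorEdges := Finset.filter_subset _ _
  have hbd : ∀ Γ, T.boundaryEdges Γ ⊆ T.edges := fun Γ => Finset.filter_subset _ _
  have hnotline : ∀ {E : Finset Plane}, hull E ⊆ frontier P.Ω → E ∉ T.lineEdges P.S :=
    fun hfr hE => (Finset.mem_filter.mp (hlin hE)).2 hfr
  have b1 : ∑ K ∈ T.tri, size K ^ 4 * normL2 (volume.restrict (hull K))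
      (fun x => mat.plateOp (onElement K uh) x - P.f x) ^ 2 ≤ C₀ * ∑ K ∈ T.tri, Z K := by
    rw [Finset.mul_sum]
    refine Finset.sum_le_sum fun K hK => ?_
    rw [normL2_sq, setIntegral_hull]
    exact hel K hK
  -- the oscillation of `g` on an edge has to stay on the left when the sum over the edges is turned
  -- into a sum over the triangles, as it is not attached to a triangle
  have b2 : ∑ E ∈ T.lineEdges P.S, size E ^ 3 * normL2 (arc (hull E))
      (fun x => mat.jumpVn T E uh x - P.g x) ^ 2
        ≤ 3 * C₂ * (∑ K ∈ T.tri, Z K) + C₂ * P.oscG T gh ^ 2 := by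
    have h1 : ∀ E ∈ T.lineEdges P.S, size E ^ 3 * normL2 (arc (hull E))
        (fun x => mat.jumpVn T E uh x - P.g x) ^ 2 - C₂ * oscEdge E P.g (gh E) ^ 2
          ≤ C₂ * ∑ K ∈ T.tri.filter (fun K => E ⊆ K), Z K := fun E hE => by
      obtain ⟨a, b, hab, rfl⟩ := T.exists_pair (hint (hlin hE))
      obtain ⟨hp, hball⟩ := G.isEdgePatch_interior hab (hlin hE)
      have := (hshear P T u uh fh a b _ _ _ _ G hel hab hp fun φ B hφ =>
        P.essentialBC_of_subset hφ (hr hab) hball).2 hE (gh {a, b}) (hgh _ hE)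
      rw [normL2_sq, oscEdge_sq, size_pair]
      linarith [mul_le_mul_of_nonneg_left (hp.sum_le hZ) hC₂.le]
    have h2 := T.sum_le_sum_edges hZ (hlin.trans hint) hC₂.le h1
    rw [Finset.sum_sub_distrib, ← Finset.mul_sum] at h2
    rw [Problem.oscG, Real.sq_sqrt (Finset.sum_nonneg fun E _ => sq_nonneg _)]
    linarith
  have b3 : ∑ E ∈ T.interiorEdges \ T.lineEdges P.S, size E ^ 3 * normL2 (arc (hull E))
      (mat.jumpVn T E uh) ^ 2 ≤ 3 * C₂ * ∑ K ∈ T.tri, Z K := by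
    refine T.sum_le_sum_edges hZ (Finset.sdiff_subset.trans hint) hC₂.le fun E hE => ?_
    obtain ⟨hE, hES⟩ := Finset.mem_sdiff.mp hE
    obtain ⟨a, b, hab, rfl⟩ := T.exists_pair (hint hE)
    obtain ⟨hp, hball⟩ := G.isEdgePatch_interior hab hE
    have := (hshear P T u uh fh a b _ _ _ _ G hel hab hp fun φ B hφ =>
      P.essentialBC_of_subset hφ (hr hab) hball).1 hES
    rw [normL2_sq, size_pair]
    exact this.trans (mul_le_mul_of_nonneg_left (hp.sum_le hZ) hC₂.le)
  have b4 : ∑ E ∈ T.interiorEdges, size E * normL2 (arc (hull E)) (mat.jumpMnn T E uh) ^ 2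
      ≤ 3 * C₁ * ∑ K ∈ T.tri, Z K := by
    refine T.sum_le_sum_edges hZ hint hC₁.le fun E hE => ?_
    obtain ⟨a, b, hab, rfl⟩ := T.exists_pair (hint hE)
    obtain ⟨hp, hball⟩ := G.isEdgePatch_interior hab hE
    have := hmoment P T u uh fh a b _ _ _ _ G hel hab hp fun φ B hφ _ =>
      P.essentialBC_of_subset hφ (hr hab) hball
    rw [normL2_sq, size_pair]
    exact this.trans (mul_le_mul_of_nonneg_left (hp.sum_le hZ) hC₁.le)
  have b5 : ∑ E ∈ T.boundaryEdges P.Γf, size E ^ 3 * normL2 (arc (hull E))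
      (mat.edgeVn (T.tri₁ E) E uh) ^ 2 ≤ 3 * C₂ * ∑ K ∈ T.tri, Z K := by
    refine T.sum_le_sum_edges hZ (hbd _) hC₂.le fun E hE => ?_
    obtain ⟨hEe, hfr, hEΓ⟩ := Finset.mem_filter.mp hE
    obtain ⟨a, b, hab, rfl⟩ := T.exists_pair hEe
    have hp := G.isEdgePatch_boundary hab hEe hfr
    have := (hshear P T u uh fh a b _ _ _ _ G hel hab hp fun φ B hφ =>
      G.essentialBC_boundary hab hEe hφ (Or.inl hEΓ)).1 (hnotline hfr)
    rw [normL2_sq, size_pair]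
    exact this.trans (mul_le_mul_of_nonneg_left (hp.sum_le hZ) hC₂.le)
  have b6 : ∑ E ∈ T.boundaryEdges P.Γf ∪ T.boundaryEdges P.Γs, size E * normL2 (arc (hull E))
      (mat.edgeMnn (T.tri₁ E) E uh) ^ 2 ≤ 3 * C₁ * ∑ K ∈ T.tri, Z K := by
    refine T.sum_le_sum_edges hZ (Finset.union_subset (hbd _) (hbd _)) hC₁.le fun E hE => ?_
    have hE' : E ∈ T.edges ∧ hull E ⊆ frontier P.Ω ∧ (hull E ⊆ P.Γf ∨ hull E ⊆ P.Γs) := by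
      rcases Finset.mem_union.mp hE with hE | hE
      · obtain ⟨h1, h2, h3⟩ := Finset.mem_filter.mp hE
        exact ⟨h1, h2, Or.inl h3⟩
      · obtain ⟨h1, h2, h3⟩ := Finset.mem_filter.mp hE
        exact ⟨h1, h2, Or.inr h3⟩
    obtain ⟨hEe, hfr, hEΓ⟩ := hE'
    obtain ⟨a, b, hab, rfl⟩ := T.exists_pair hEe
    have hp := G.isEdgePatch_boundary hab hEe hfr
    have := hmoment P T u uh fh a b _ _ _ _ G hel hab hp fun φ B hφ hz =>
      G.essentialBC_boundary hab hEe hφ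
        (hEΓ.imp_right fun h => ⟨h, eq_zero_on_hull_pair hp.norm_eq hp.perp hz⟩)
    rw [normL2_sq, size_pair]
    exact this.trans (mul_le_mul_of_nonneg_left (hp.sum_le hZ) hC₁.le)
  have hG : 0 ≤ P.oscG T gh ^ 2 := sq_nonneg _
  have hsumZ : 0 ≤ ∑ K ∈ T.tri, Z K := Finset.sum_nonneg fun K _ => hZ K
  rw [Problem.estimator, Real.sq_sqrt (by
    have h0 : ∀ (t : Finset (Finset Plane)) (w : Finset Plane → ℝ) (j : ℕ),
        0 ≤ ∑ E ∈ t, size E ^ j * w E ^ 2 := fun t w j =>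
      Finset.sum_nonneg fun E _ => mul_nonneg (pow_nonneg (size_nonneg E) j) (sq_nonneg _)
    have h0' : ∀ (t : Finset (Finset Plane)) (w : Finset Plane → ℝ),
        0 ≤ ∑ E ∈ t, size E * w E ^ 2 := fun t w =>
      Finset.sum_nonneg fun E _ => mul_nonneg (size_nonneg E) (sq_nonneg _)
    exact add_nonneg (add_nonneg (add_nonneg (add_nonneg (add_nonneg (h0 _ _ _) (h0 _ _ _))
      (h0 _ _ _)) (h0' _ _)) (h0 _ _ _)) (h0' _ _))]
  have hmul := mul_le_mul_of_nonneg_left htotal (by positivity : 0 ≤ C₀ + 6 * C₁ + 9 * C₂)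
  have hG' : C₂ * P.oscG T gh ^ 2 ≤ (C₀ + 6 * C₁ + 9 * C₂) * P.oscG T gh ^ 2 :=
    mul_le_mul_of_nonneg_right (by linarith) hG
  linarith

end Kirchhoff

end

open Kirchhoff in
theorem theorem3p3 (mat : Material) (κ : ℝ) (k m : ℕ) :
    ∃ C : ℝ, 0 < C ∧
      ∀ (P : Problem) (T : Triangulation P.Ω), T.ShapeRegular κ → P.Fits T →
      ∀ Vh : Submodule ℝ (Plane → ℝ), (∀ v ∈ Vh, v ∈ P.V ∧ T.IsPiecewisePoly k v) →
      ∀ u uh : Plane → ℝ, P.IsSolution mat u → P.IsDiscreteSolution mat Vh uh →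
      ∀ fh gh : Finset Plane → MvPolynomial (Fin 2) ℝ,
        (∀ K ∈ T.tri, (fh K).totalDegree ≤ k) →
        (∀ E ∈ T.lineEdges P.S, (gh E).totalDegree ≤ m) →
        P.estimator mat T uh ≤
          C * (normH2 P.Ω (u - uh) + P.oscF T fh + P.oscG T gh) := by
  -- a larger shape constant only weakens the assumption, so it may be taken to be at least `1`
  obtain ⟨C, hC, hbound⟩ := exists_estimator_bound mat (le_max_right κ 1) k m
  refine ⟨√C, Real.sqrt_pos.mpr hC, fun P T hT hfit Vh hVh u uh hu huh fh gh hfh hgh => ?_⟩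
  have G : IsApproximation P mat T (max κ 1) k u uh :=
    ⟨le_max_right _ _, hT.mono (le_max_left _ _), hfit, hu, (hVh uh huh.1).1, (hVh uh huh.1).2⟩
  have h1 : 0 ≤ normH2 P.Ω (u - uh) := Real.sqrt_nonneg _
  have h2 : 0 ≤ P.oscF T fh := Real.sqrt_nonneg _
  have h3 : 0 ≤ P.oscG T gh := Real.sqrt_nonneg _
  refine (sq_le_sq₀ (Real.sqrt_nonneg _) (by positivity)).mp
    ((hbound P T u uh G fh gh hfh hgh).trans ?_)
  rw [mul_pow, Real.sq_sqrt hC.le]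
  refine mul_le_mul_of_nonneg_left ?_ hC.le
  nlinarith [mul_nonneg h1 h2, mul_nonneg h1 h3, mul_nonneg h2 h3]
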